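/- Let $M$ be a compact smooth Riemannian manifold (without boundary), let $G\subseteq O(n)$ be a compact Lie group, and let $E\to M$ be a smooth $G$-vector bundle of rank $n$, i.e. a vector bundle with a bundle metric and a reduction $P$ of its orthonormal frame bundle to $G$; let $\operatorname{ad}P\subseteq\operatorname{End}(E)$ be the adjoint bundle and $\Omega^1(\operatorname{ad}P)$ the space of smooth one-forms with values in it. Let $K$ be a compact Lie group acting smoothly on $M$ by isometries $x\mapsto kx$, with differential $k_*$, and on $E$ by smooth maps $\lambda_k$ that restrict to linear isometries $E_x\to E_{kx}$. A connection $D$ on $E$ is called $K$-equivariant if $D_{k_*u}(\tau_kY)=\tau_k(D_uY)$ for all $k\in K$, all smooth vector fields $u$ and all smooth sections $Y$ of $E$, where $(\tau_kY)(x)=\lambda_kY(k^{-1}x)$. For a smooth $G$-connection $D$ with curvature $F_D$, set $YM(D)=\frac12\int_M|F_D|^2\,dx$; $D$ is called a Yang–Mills connection if it is a critical point of $YM$, i.e. $\frac{d}{dt}\big|_{t=0}YM(D+t\varphi)=0$ for all $\varphi\in\Omega^1(\operatorname{ad}P)$. Let $D$ be a smooth $K$-equivariant $G$-connection on $E$ such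 that $$\int_M\langle F_D,D\varphi\rangle\,dx=0$$ for every $\varphi\in\Omega^1(\operatorname{ad}P)$ that is $K$-equivariant, i.e. satisfies $\varphi_u(x)=\lambda_k^{-1}\,\varphi_{k_*u}(kx)\,\lambda_k$ for all $x\in M$, $u\in T_xM$, $k\in K$; here $D\varphi$ is the exterior covariant derivative of $\varphi$. Then $D$ is a Yang–Mills connection. -/

import Mathlib

open Bundle Manifold MeasureTheory
open scoped ContDiff

noncomputable section

namespace YangMills

/-- Euclidean space `ℝᵈ`. -/
abbrev Euc (d : ℕ) : Type := EuclideanSpace ℝ (Fin d)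

/-! ### The structure group `G ⊆ O(n)` and its Lie algebra

`O(n)` is the group of linear isometries of `ℝⁿ`. -/

section StructureGroup

variable {n : ℕ}

/-- The linear operator underlying an element of `O(n)`. -/
def toOp (g : Euc n ≃ₗᵢ[ℝ] Euc n) : Euc n →L[ℝ] Euc n :=
  g.toContinuousLinearEquiv.toContinuousLinearMap

/-- Compactness of a subgroup of `O(n)`, for the topology of the space of linear operators. -/
def IsCompactGroup (G : Subgroup (Euc n ≃ₗᵢ[ℝ] Euc n)) : Prop :=
  IsCompact (toOp '' (G : Set (Euc n ≃ₗᵢ[ℝ] Euc n)))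

/-- The Lie algebra of `G`: the velocities at the identity of the curves in `G`. -/
def lieAlg (G : Subgroup (Euc n ≃ₗᵢ[ℝ] Euc n)) : Submodule ℝ (Euc n →L[ℝ] Euc n) where
  carrier := {ξ | ∃ γ : ℝ → (Euc n ≃ₗᵢ[ℝ] Euc n),
    (∀ t, γ t ∈ G) ∧ γ 0 = 1 ∧ HasDerivAt (fun t ↦ toOp (γ t)) ξ 0}
  zero_mem' := ⟨fun _ ↦ 1, fun _ ↦ G.one_mem, rfl, hasDerivAt_const _ _⟩
  add_mem' := by
    rintro ξ η ⟨γ, hγ, h0, hd⟩ ⟨δ, hδ, k0, kd⟩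
    refine ⟨fun t ↦ γ t * δ t, fun t ↦ G.mul_mem (hγ t) (hδ t), by simp [h0, k0], ?_⟩
    have h1 : toOp (1 : Euc n ≃ₗᵢ[ℝ] Euc n) = 1 := rfl
    have h := HasDerivAt.fun_mul hd kd
    simp only [h0, k0, h1, mul_one, one_mul] at h
    exact h
  smul_mem' := by
    rintro c ξ ⟨γ, hγ, h0, hd⟩
    refine ⟨fun t ↦ γ (c * t), fun t ↦ hγ _, by simp [h0], ?_⟩
    have hc : HasDerivAt (fun t : ℝ ↦ c * t) c 0 := by
      simpa using (hasDerivAt_id (0 : ℝ)).const_mul c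
    have hd' : HasDerivAt (fun t ↦ toOp (γ t)) ξ (c * 0) := by simpa using hd
    exact HasDerivAt.scomp (0 : ℝ) hd' hc

end StructureGroup

/-! ### Riemannian volume -/

section Volume

variable {m : ℕ} {M : Type*} [TopologicalSpace M] [ChartedSpace (Euc m) M]
  [IsManifold (𝓡 m) ∞ M] [RiemannianBundle (fun x : M ↦ TangentSpace (𝓡 m) x)]

/-- The coordinate vector field `∂ᵢ` of the chart around `x`, at the point with coordinates `z`. -/
def coordVec (x : M) (z : Euc m) (i : Fin m) :
    TangentSpace (𝓡 m) ((extChartAt (𝓡 m) x).symm z) :=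
  mfderiv 𝓘(ℝ, Euc m) (𝓡 m) (extChartAt (𝓡 m) x).symm z (EuclideanSpace.single i (1 : ℝ))

/-- `√(det (gᵢⱼ))` in the chart around `x`, as a function of the coordinates. -/
def chartDensity (x : M) (z : Euc m) : ℝ :=
  √(Matrix.of fun i j : Fin m ↦ inner ℝ (coordVec x z i) (coordVec x z j)).det

variable (m) in
/-- The Riemannian measure `√(det (gᵢⱼ)) dz` of the domain of the chart around `x`. -/
def chartVol [MeasurableSpace M] (x : M) : Measure M :=
  (((volume : Measure (Euc m)).restrict (extChartAt (𝓡 m) x).target).withDensity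
    (fun z : Euc m ↦ ENNReal.ofReal (chartDensity x z))).map (extChartAt (𝓡 m) x).symm

variable (m M) in
/-- The Riemannian measure `dx`. The chart measures agree on overlaps of chart domains, so that
their supremum is the measure that restricts to each of them. -/
def riemVol [MeasurableSpace M] : Measure M := ⨆ x : M, chartVol m x

end Volume

/-! ### Connections, curvature, and the Yang-Mills functional -/

section Bundles

variable {m n : ℕ} {M : Type*} [TopologicalSpace M] [ChartedSpace (Euc m) M]
  [IsManifold (𝓡 m) ∞ M]
  {V : M → Type*} [TopologicalSpace (TotalSpace (Euc n) V)]
  [∀ x, NormedAddCommGroup (V x)] [∀ x, InnerProductSpace ℝ (V x)]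
  [FiberBundle (Euc n) V] [VectorBundle ℝ (Euc n) V]

variable (m n V) in
/-- The principal `G`-bundle `P` of a `G`-vector bundle: a reduction of the bundle of orthonormal
frames to `G`. A frame at `x` is a linear isometry `ℝⁿ ≃ Vₓ`. -/
structure GStructure (G : Subgroup (Euc n ≃ₗᵢ[ℝ] Euc n)) where
  /-- The admissible frames at `x`, i.e. the fibre of `P` over `x`. -/
  frames (x : M) : Set (Euc n ≃ₗᵢ[ℝ] V x)
  /-- `G` acts simply transitively on the admissible frames at `x`. -/
  mem_iff {x : M} {p : Euc n ≃ₗᵢ[ℝ] V x} (hp : p ∈ frames x) (q : Euc n ≃ₗᵢ[ℝ] V x) :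
    q ∈ frames x ↔ ∃ g ∈ G, q = g.trans p
  /-- `P` has smooth local sections. -/
  exists_local (x : M) : ∃ U : Set M, IsOpen U ∧ x ∈ U ∧ ∃ s : ∀ y, Euc n ≃ₗᵢ[ℝ] V y,
    (∀ y ∈ U, s y ∈ frames y) ∧ ∀ w : Euc n,
      ContMDiffOn (𝓡 m) ((𝓡 m).prod 𝓘(ℝ, Euc n)) ∞ (fun y ↦ TotalSpace.mk' (Euc n) y (s y w)) U

variable {G : Subgroup (Euc n ≃ₗᵢ[ℝ] Euc n)}

/-- The fibre of `ad P` over `x`, as a set of endomorphisms of `Vₓ`. -/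
def adP (P : GStructure m n V G) (x : M) : Set (V x →L[ℝ] V x) :=
  {a | ∃ p ∈ P.frames x, ∃ ξ ∈ lieAlg G, ∀ w, a (p w) = p (ξ w)}

/-- A connection of `V` is a `G`-connection if its connection form in any smooth local section
of `P` has values in the Lie algebra of `G`. -/
def IsGConnection (P : GStructure m n V G) (D : CovariantDerivative (𝓡 m) (Euc n) V) : Prop :=
  ∀ (U : Set M) (s : ∀ y, Euc n ≃ₗᵢ[ℝ] V y), IsOpen U → (∀ y ∈ U, s y ∈ P.frames y) →
    (∀ w : Euc n, ContMDiffOn (𝓡 m) ((𝓡 m).prod 𝓘(ℝ, Euc n)) ∞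
      (fun y ↦ TotalSpace.mk' (Euc n) y (s y w)) U) →
    ∀ x ∈ U, ∀ u : TangentSpace (𝓡 m) x, ∃ ξ ∈ lieAlg G, ∀ w : Euc n,
      D (fun y ↦ s y w) x u = s x (ξ w)

variable (m V) in
/-- One-forms with values in the endomorphisms of `V` (no regularity): `φ x u : Vₓ → Vₓ`. -/
abbrev EndForm : Type _ := ∀ x : M, TangentSpace (𝓡 m) x →L[ℝ] V x →L[ℝ] V x

/-- `φ ∈ Ω¹(ad P)`: a smooth one-form with values in `ad P`. -/
def IsAdForm (P : GStructure m n V G) (φ : EndForm m V) : Prop :=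
  ContMDiff (𝓡 m) ((𝓡 m).prod 𝓘(ℝ, Euc m →L[ℝ] Euc n →L[ℝ] Euc n)) ∞
    (fun x ↦ TotalSpace.mk' (Euc m →L[ℝ] Euc n →L[ℝ] Euc n) x (φ x)) ∧
  ∀ (x : M) (u : TangentSpace (𝓡 m) x), φ x u ∈ adP P x

/-- The connection `D + tφ`. -/
def vary (D : CovariantDerivative (𝓡 m) (Euc n) V) (φ : EndForm m V) (t : ℝ) :
    CovariantDerivative (𝓡 m) (Euc n) V :=
  D.addOneForm fun x ↦ t • (show Euc m →L[ℝ] V x →L[ℝ] V x from φ x).flip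

/-- `D_X D_Y σ - D_Y D_X σ - D_[X,Y] σ`. -/
def curvFields (D : CovariantDerivative (𝓡 m) (Euc n) V) (X Y : ∀ x : M, TangentSpace (𝓡 m) x)
    (σ : ∀ x : M, V x) (x : M) : V x :=
  D (fun y ↦ D σ y (Y y)) x (X x) - D (fun y ↦ D σ y (X y)) x (Y x)
    - D σ x (VectorField.mlieBracket (𝓡 m) X Y x)

/-- The curvature `F_{uv} w` of `D`, computed with local extensions of `u`, `v`, `w`. -/
def curv (D : CovariantDerivative (𝓡 m) (Euc n) V) (x : M) (u v : TangentSpace (𝓡 m) x)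
    (w : V x) : V x :=
  curvFields D (FiberBundle.extend (Euc m) u) (FiberBundle.extend (Euc m) v)
    (FiberBundle.extend (Euc n) w) x

/-- `(D_X (φ_Y)) σ = D_X (φ_Y σ) - φ_Y (D_X σ)`: the covariant derivative of the endomorphism field
`φ_Y`. -/
def covEnd (D : CovariantDerivative (𝓡 m) (Euc n) V) (φ : EndForm m V)
    (X Y : ∀ x : M, TangentSpace (𝓡 m) x) (σ : ∀ x : M, V x) (x : M) : V x :=
  D (fun y ↦ φ y (Y y) (σ y)) x (X x) - φ x (Y x) (D σ x (X x))

/-- `(D_X (φ_Y) - D_Y (φ_X) - φ_[X,Y]) σ`. -/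
def extCovFields (D : CovariantDerivative (𝓡 m) (Euc n) V) (φ : EndForm m V)
    (X Y : ∀ x : M, TangentSpace (𝓡 m) x) (σ : ∀ x : M, V x) (x : M) : V x :=
  covEnd D φ X Y σ x - covEnd D φ Y X σ x - φ x (VectorField.mlieBracket (𝓡 m) X Y x) (σ x)

/-- The exterior covariant derivative `(Dφ)_{uv} w`, computed with local extensions of
`u`, `v`, `w`. -/
def extCov (D : CovariantDerivative (𝓡 m) (Euc n) V) (φ : EndForm m V) (x : M)
    (u v : TangentSpace (𝓡 m) x) (w : V x) : V x :=
  extCovFields D φ (FiberBundle.extend (Euc m) u) (FiberBundle.extend (Euc m) v)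
    (FiberBundle.extend (Euc n) w) x

variable [RiemannianBundle (fun x : M ↦ TangentSpace (𝓡 m) x)]

variable (n) in
/-- The inner product of two-forms at `x` with values in the endomorphisms of `Vₓ`:
`∑ ⟨A(bᵢ, bⱼ) eₐ, B(bᵢ, bⱼ) eₐ⟩` for orthonormal bases `b` of `TₓM` and `e` of `Vₓ`. -/
def formInner (x : M)
    (A B : TangentSpace (𝓡 m) x → TangentSpace (𝓡 m) x → V x → V x) : ℝ :=
  haveI : FiniteDimensional ℝ (V x) := VectorBundle.finiteDimensional ℝ (Euc n) V x
  haveI : FiniteDimensional ℝ (TangentSpace (𝓡 m) x) :=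
    inferInstanceAs (FiniteDimensional ℝ (Euc m))
  let b := stdOrthonormalBasis ℝ (TangentSpace (𝓡 m) x)
  let e := stdOrthonormalBasis ℝ (V x)
  ∑ i, ∑ j, ∑ a, inner ℝ (A (b i) (b j) (e a)) (B (b i) (b j) (e a))

variable [MeasurableSpace M]

/-- The Yang-Mills functional `½ ∫ |F|² dx`. -/
def YM (D : CovariantDerivative (𝓡 m) (Euc n) V) : ℝ :=
  1 / 2 * ∫ x, formInner n x (curv D x) (curv D x) ∂(riemVol m M)

/-- The first variation `∫ ⟨F, Dφ⟩ dx`. -/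
def firstVariation (D : CovariantDerivative (𝓡 m) (Euc n) V) (φ : EndForm m V) : ℝ :=
  ∫ x, formInner n x (curv D x) (extCov D φ x) ∂(riemVol m M)

/-- `D` is a Yang-Mills connection: a critical point of the Yang-Mills functional, with respect to
all variations `D + tφ`, `φ ∈ Ω¹(ad P)`. -/
def IsYangMills (P : GStructure m n V G) (D : CovariantDerivative (𝓡 m) (Euc n) V) : Prop :=
  ∀ φ : EndForm m V, IsAdForm P φ → HasDerivAt (fun t : ℝ ↦ YM (vary D φ t)) 0 0

end Bundles

/-! ### Group actions -/

section Actions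

variable {m n : ℕ} {M : Type*} [TopologicalSpace M] [ChartedSpace (Euc m) M]
  [IsManifold (𝓡 m) ∞ M]
  {V : M → Type*} [TopologicalSpace (TotalSpace (Euc n) V)]
  [∀ x, NormedAddCommGroup (V x)] [∀ x, InnerProductSpace ℝ (V x)]
  [FiberBundle (Euc n) V] [VectorBundle ℝ (Euc n) V]
  {EK : Type*} [NormedAddCommGroup EK] [NormedSpace ℝ EK] {HK : Type*} [TopologicalSpace HK]
  {K : Type*} [Group K] [TopologicalSpace K] [ChartedSpace HK K] [MulAction K M]

variable (m) in
/-- The differential `k_* : TₓM → T_{kx}M`. -/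
def push (k : K) (x : M) :
    TangentSpace (𝓡 m) x →L[ℝ] TangentSpace (𝓡 m) (k • x) :=
  mfderiv (𝓡 m) (𝓡 m) (fun y : M ↦ k • y) x

variable (m M K) in
/-- `K` acts on the Riemannian manifold `M` by isometries. -/
def ActsByIsometries [RiemannianBundle (fun x : M ↦ TangentSpace (𝓡 m) x)] : Prop :=
  ∀ (k : K) (x : M) (u : TangentSpace (𝓡 m) x), ‖push m k x u‖ = ‖u‖

variable (m n V K) in
/-- A smooth action `λ` of `K` on the total space of `V` by fibrewise linear isometries, compatible
with the action on `M` in the sense that `λ_k` maps `Vₓ` to `V_{kx}`. -/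
structure IsometricLift (IK : ModelWithCorners ℝ EK HK) where
  /-- The restriction of `λ_k` to the fibre over `x`. -/
  lam (k : K) (x : M) : V x →ₗᵢ[ℝ] V (k • x)
  one_act (x : M) (v : V x) :
    TotalSpace.mk' (Euc n) ((1 : K) • x) (lam 1 x v) = TotalSpace.mk' (Euc n) x v
  mul_act (k l : K) (x : M) (v : V x) :
    TotalSpace.mk' (Euc n) ((k * l) • x) (lam (k * l) x v) =
      TotalSpace.mk' (Euc n) (k • l • x) (lam k (l • x) (lam l x v))
  smooth : ContMDiff (IK.prod ((𝓡 m).prod 𝓘(ℝ, Euc n))) ((𝓡 m).prod 𝓘(ℝ, Euc n)) ∞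
    (fun q : K × TotalSpace (Euc n) V ↦
      TotalSpace.mk' (Euc n) (q.1 • q.2.proj) (lam q.1 q.2.proj q.2.snd))

variable {IK : ModelWithCorners ℝ EK HK}

/-- The induced action on sections, `(τ_k Y)(x) = λ_k Y(k⁻¹x)`. -/
def tau (L : IsometricLift m n V K IK) (k : K) (Y : ∀ x : M, V x) (x : M) : V x :=
  cast (congrArg V (smul_inv_smul k x)) (L.lam k (k⁻¹ • x) (Y (k⁻¹ • x)))

set_option linter.unusedSectionVars false in
theorem tau_smul (L : IsometricLift m n V K IK) (k : K) (Y : ∀ x : M, V x) (x : M) :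
    tau L k Y (k • x) = L.lam k x (Y x) := by
  have h : ∀ (y : M) (hy : y = x) (e : V (k • y) = V (k • x)),
      cast e (L.lam k y (Y y)) = L.lam k x (Y x) := by
    rintro y rfl e
    rfl
  exact h _ (inv_smul_smul k x) _

/-- `D` is `K`-equivariant: `D_{k_* u} (τ_k Y) = τ_k (D_u Y)`, written at the point `kx`. -/
def IsEquivariantConnection (L : IsometricLift m n V K IK)
    (D : CovariantDerivative (𝓡 m) (Euc n) V) : Prop :=
  ∀ (k : K) (Y : ∀ x : M, V x),
    ContMDiff (𝓡 m) ((𝓡 m).prod 𝓘(ℝ, Euc n)) ∞ (fun x ↦ TotalSpace.mk' (Euc n) x (Y x)) →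
    ∀ (x : M) (u : TangentSpace (𝓡 m) x),
      D (tau L k Y) (k • x) (push m k x u) = L.lam k x (D Y x u)

/-- `φ` is `K`-equivariant: `φ_u(x) = λ_k⁻¹ φ_{k_* u}(kx) λ_k`. -/
def IsEquivariantForm (L : IsometricLift m n V K IK) (φ : EndForm m V) : Prop :=
  ∀ (k : K) (x : M) (u : TangentSpace (𝓡 m) x) (v : V x),
    L.lam k x (φ x u v) = φ (k • x) (push m k x u) (L.lam k x v)

end Actions

end YangMills

end

open Bundle Manifold MeasureTheory
open scoped ContDiff

set_option linter.unusedSectionVars false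

noncomputable section

namespace YangMills

/-! ### The Lie algebra of the structure group -/

section LieAlgebra

variable {n : ℕ} {G : Subgroup (Euc n ≃ₗᵢ[ℝ] Euc n)}

/-! The first variation φ ↦ ∫⟨F, Dφ⟩ is represented in L² by one smooth form J, the codifferential
of the curvature: it equals ∫⟨J, φ⟩ for every smooth End(E)-valued φ. Two properties of J decide the
matter.

J has values in ad P. In a local section of P the connection is d + ξ with ξ in the Lie algebra of
G, and the Lie algebra is a closed subspace stable under brackets, so the curvature and its
covariant derivatives keep their values in ad P.

J is K-equivariant. Since K acts by isometries and D is equivariant, pulling back by k changes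
neither the first variation nor the L² product. Writing k*J for the pullback, ‖k*J − J‖² = ‖k*J‖² −
2⟨J, k*J⟩ + ‖J‖², where ⟨J, k*J⟩ is the first variation at k*J, hence at J, hence ‖J‖². So k*J = J.
The action is not assumed to preserve P, so k*J is not known in advance to lie in Ω¹(ad P); this is
why J has to represent the first variation on all End(E)-valued forms.

Therefore J is itself a test form allowed in the hypothesis. Testing with it gives ∫|J|² = 0, so J =
0 and the first variation vanishes identically. No variation is averaged over K.

The main steps are `hasDerivAt_YM_vary` (the first variation is the derivative of the functional),
`exists_codifferential` (local integration by parts in `exists_local_codifferential`, glued by a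
partition of unity), `pullForm_eq_self` and `firstVariation_eq_zero`. They rest on the tensoriality
of curvature and exterior derivative, on the invariance of the Riemannian measure under isometries,
and on the divergence theorem for coordinate fields. -/

theorem lieAlg_skew {ξ : Euc n →L[ℝ] Euc n} (hξ : ξ ∈ lieAlg G) (v w : Euc n) :
    inner ℝ (ξ v) w + inner ℝ v (ξ w) = 0 := by
  obtain ⟨γ, -, h0, hd⟩ := hξ
  have hv : HasDerivAt (fun t ↦ toOp (γ t) v) (ξ v) 0 :=
    hd.clm_apply (hasDerivAt_const 0 v) |>.congr_deriv (by simp)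
  have hw : HasDerivAt (fun t ↦ toOp (γ t) w) (ξ w) 0 :=
    hd.clm_apply (hasDerivAt_const 0 w) |>.congr_deriv (by simp)
  have h := hv.inner ℝ hw
  have hc : (fun t ↦ inner ℝ (toOp (γ t) v) (toOp (γ t) w)) = fun _ ↦ inner ℝ v w :=
    funext fun t ↦ (γ t).inner_map_map v w
  rw [hc] at h
  have h1 : ∀ u, toOp (γ 0) u = u := fun u ↦ by rw [h0]; rfl
  have := h.unique (hasDerivAt_const 0 _)
  rw [h1, h1] at this
  linarith

/-- `g ξ g⁻¹`. -/
def conjOp (g : Euc n ≃ₗᵢ[ℝ] Euc n) (ξ : Euc n →L[ℝ] Euc n) : Euc n →L[ℝ] Euc n :=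
  toOp g * ξ * toOp g⁻¹

/-- Conjugate the whole curve by g. This is what makes the fibre of ad P independent of the frame.
-/
theorem conjOp_mem_lieAlg {g : Euc n ≃ₗᵢ[ℝ] Euc n} (hg : g ∈ G) {ξ : Euc n →L[ℝ] Euc n}
    (hξ : ξ ∈ lieAlg G) : conjOp g ξ ∈ lieAlg G := by
  obtain ⟨γ, hγ, h0, hd⟩ := hξ
  refine ⟨fun t ↦ g * γ t * g⁻¹, fun t ↦ G.mul_mem (G.mul_mem hg (hγ t)) (G.inv_mem hg),
    by simp [h0], ?_⟩
  exact (hd.const_mul (toOp g)).mul_const (toOp g⁻¹)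

/-- Replaces inversion by a linear map, so that t ↦ γ(t)⁻¹ can be differentiated directly. -/
theorem toOp_inv_eq_adjoint (g : Euc n ≃ₗᵢ[ℝ] Euc n) :
    toOp g⁻¹ = ContinuousLinearMap.adjoint (toOp g) := by
  refine (ContinuousLinearMap.eq_adjoint_iff _ _).2 fun x y ↦ ?_
  calc inner ℝ (g⁻¹ x) y = inner ℝ (g (g⁻¹ x)) (g y) := (g.inner_map_map _ _).symm
    _ = inner ℝ x (g y) := by rw [show g (g⁻¹ x) = x from g.apply_symm_apply x]

/-- Difference quotients stay in S, and a finite-dimensional subspace is closed. -/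
theorem deriv_mem_of_forall_mem {E : Type*} [NormedAddCommGroup E] [NormedSpace ℝ E]
    [FiniteDimensional ℝ E] (S : Submodule ℝ E) {f : ℝ → E} (hf : ∀ t, f t ∈ S) {f' : E} {t : ℝ}
    (h : HasDerivAt f f' t) : f' ∈ S := by
  have hcl : IsClosed (S : Set E) := S.closed_of_finiteDimensional
  refine hcl.mem_of_tendsto (hasDerivAt_iff_tendsto_slope.1 h) (Filter.Eventually.of_forall ?_)
  intro s
  exact S.smul_mem _ (S.sub_mem (hf s) (hf t))

/-- The bracket is the derivative at 0 of t ↦ γ(t) η γ(t)⁻¹, a curve inside the subspace `lieAlg G`.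
-/
theorem lieAlg_bracket {ξ η : Euc n →L[ℝ] Euc n} (hξ : ξ ∈ lieAlg G) (hη : η ∈ lieAlg G) :
    ξ * η - η * ξ ∈ lieAlg G := by
  have hskew : ContinuousLinearMap.adjoint ξ = -ξ := by
    refine ((ContinuousLinearMap.eq_adjoint_iff _ _).2 fun x y ↦ ?_).symm
    have := lieAlg_skew hξ x y
    simp only [_root_.neg_apply, inner_neg_left]
    linarith
  obtain ⟨γ, hγ, h0, hd⟩ := hξ
  -- The inverse is the adjoint, so its velocity is the adjoint of ξ, which is −ξ by skewness.
  have hadj : HasDerivAt (fun t ↦ toOp (γ t)⁻¹) (-ξ) 0 := by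
    have h := ((ContinuousLinearMap.adjoint (𝕜 := ℝ) (E := Euc n)
      (F := Euc n)).toContinuousLinearEquiv.toContinuousLinearMap.hasFDerivAt
        (x := toOp (γ 0))).comp_hasDerivAt (0 : ℝ) hd
    rw [← hskew]
    refine (h.congr_of_eventuallyEq (Filter.Eventually.of_forall fun t ↦ ?_))
    exact toOp_inv_eq_adjoint (γ t)
  have h := (hd.mul_const η).mul hadj
  have h1 : toOp (1 : Euc n ≃ₗᵢ[ℝ] Euc n) = 1 := rfl
  simp only [h0, inv_one, h1, mul_one, one_mul] at h
  have := deriv_mem_of_forall_mem (lieAlg G) (fun t ↦ conjOp_mem_lieAlg (hγ t) hη) h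
  convert this using 1
  ext v
  simp [sub_eq_add_neg]

end LieAlgebra

/-! ### The fibres of ad P as linear subspaces -/

section AdjointBundle

variable {m n : ℕ} {M : Type*} [TopologicalSpace M] [ChartedSpace (Euc m) M]
  [IsManifold (𝓡 m) ∞ M]
  {V : M → Type*} [TopologicalSpace (TotalSpace (Euc n) V)]
  [∀ x, NormedAddCommGroup (V x)] [∀ x, InnerProductSpace ℝ (V x)]
  [FiberBundle (Euc n) V] [VectorBundle ℝ (Euc n) V]
  {G : Subgroup (Euc n ≃ₗᵢ[ℝ] Euc n)} (P : GStructure m n V G)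

-- Two admissible frames differ by some g in G, which changes ξ to gξg⁻¹. Membership can thus be
-- tested in one fixed frame, as closure under addition requires.
variable {P} in
theorem mem_adP_iff {x : M} {p : Euc n ≃ₗᵢ[ℝ] V x} (hp : p ∈ P.frames x) (a : V x →L[ℝ] V x) :
    a ∈ adP P x ↔ ∃ ξ ∈ lieAlg G, ∀ w, a (p w) = p (ξ w) := by
  refine ⟨?_, fun ⟨ξ, hξ, h⟩ ↦ ⟨p, hp, ξ, hξ, h⟩⟩
  rintro ⟨q, hq, ξ, hξ, h⟩
  obtain ⟨g, hg, rfl⟩ := (P.mem_iff hp q).1 hq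
  refine ⟨conjOp g ξ, conjOp_mem_lieAlg hg hξ, fun w ↦ ?_⟩
  have h2 := h (g⁻¹ w)
  have h3 : g (g⁻¹ w) = w := g.apply_symm_apply w
  simp only [LinearIsometryEquiv.trans_apply, h3] at h2
  rw [h2]
  rfl

theorem exists_frame (x : M) : ∃ p : Euc n ≃ₗᵢ[ℝ] V x, p ∈ P.frames x := by
  obtain ⟨U, -, hx, s, hs, -⟩ := P.exists_local x
  exact ⟨s x, hs x hx⟩

/-- The fibre of `ad P` as a subspace. -/
def adSub (x : M) : Submodule ℝ (V x →L[ℝ] V x) where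
  carrier := adP P x
  zero_mem' := by
    obtain ⟨p, hp⟩ := exists_frame P x
    exact ⟨p, hp, 0, Submodule.zero_mem _, by simp⟩
  add_mem' := by
    obtain ⟨p, hp⟩ := exists_frame P x
    intro a b ha hb
    rw [mem_adP_iff hp] at ha hb ⊢
    obtain ⟨ξ, hξ, h⟩ := ha
    obtain ⟨η, hη, k⟩ := hb
    exact ⟨ξ + η, Submodule.add_mem _ hξ hη, fun w ↦ by simp [h, k]⟩
  smul_mem' := by
    obtain ⟨p, hp⟩ := exists_frame P x
    intro c a ha
    rw [mem_adP_iff hp] at ha ⊢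
    obtain ⟨ξ, hξ, h⟩ := ha
    exact ⟨c • ξ, Submodule.smul_mem _ _ hξ, fun w ↦ by simp [h]⟩

end AdjointBundle

/-! ### Smooth sections of vector bundles -/

section Sections

open Filter Topology

variable {m : ℕ} {M : Type*} [TopologicalSpace M] [ChartedSpace (Euc m) M]
  [IsManifold (𝓡 m) ∞ M]
  {F : Type*} [NormedAddCommGroup F] [NormedSpace ℝ F]
  {W : M → Type*} [TopologicalSpace (TotalSpace F W)]
  [∀ x, AddCommGroup (W x)] [∀ x, Module ℝ (W x)] [∀ x, TopologicalSpace (W x)]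
  [FiberBundle F W] [VectorBundle ℝ F W]

variable (m F) in
/-- Smoothness of a section at a point. -/
abbrev SmoothAt (σ : ∀ x, W x) (x : M) : Prop :=
  ContMDiffAt (𝓡 m) ((𝓡 m).prod 𝓘(ℝ, F)) ∞ (fun y ↦ TotalSpace.mk' F y (σ y)) x

variable (m F) in
/-- Smoothness of a section. -/
abbrev SmoothSec (σ : ∀ x, W x) : Prop :=
  ContMDiff (𝓡 m) ((𝓡 m).prod 𝓘(ℝ, F)) ∞ (fun y ↦ TotalSpace.mk' F y (σ y))

variable (m F) in
/-- Smoothness of a section in a neighbourhood of a point. -/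
def SmoothNear (σ : ∀ x, W x) (x : M) : Prop :=
  ∀ᶠ y in 𝓝 x, SmoothAt m F σ y

variable (m) in
/-- Smoothness of a function in a neighbourhood of a point. -/
def SmoothFnNear {F' : Type*} [NormedAddCommGroup F'] [NormedSpace ℝ F'] (f : M → F') (x : M) :
    Prop :=
  ∀ᶠ y in 𝓝 x, ContMDiffAt (𝓡 m) 𝓘(ℝ, F') ∞ f y

theorem SmoothSec.near {σ : ∀ x, W x} (h : SmoothSec m F σ) (x : M) : SmoothNear m F σ x :=
  Eventually.of_forall h

theorem SmoothNear.at {σ : ∀ x, W x} {x : M} (h : SmoothNear m F σ x) : SmoothAt m F σ x :=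
  h.self_of_nhds

theorem SmoothAt.mdiff {σ : ∀ x, W x} {x : M} (h : SmoothAt m F σ x) :
    MDifferentiableAt (𝓡 m) ((𝓡 m).prod 𝓘(ℝ, F)) (fun y ↦ TotalSpace.mk' F y (σ y)) x :=
  h.mdifferentiableAt (by simp)

theorem SmoothNear.mdiff {σ : ∀ x, W x} {x : M} (h : SmoothNear m F σ x) :
    MDifferentiableAt (𝓡 m) ((𝓡 m).prod 𝓘(ℝ, F)) (fun y ↦ TotalSpace.mk' F y (σ y)) x :=
  h.at.mdiff

theorem SmoothNear.eventually {σ : ∀ x, W x} {x : M} (h : SmoothNear m F σ x) :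
    ∀ᶠ y in 𝓝 x, SmoothNear m F σ y :=
  eventually_eventually_nhds.2 h

theorem SmoothNear.congr {σ τ : ∀ x, W x} {x : M} (h : SmoothNear m F σ x)
    (e : ∀ᶠ y in 𝓝 x, σ y = τ y) : SmoothNear m F τ x := by
  filter_upwards [h, eventually_eventually_nhds.2 e] with y hy hy'
  exact ContMDiffAt.congr_of_eventuallyEq hy (hy'.mono fun z hz ↦ by simp [hz])

theorem SmoothNear.add {σ τ : ∀ x, W x} {x : M} (h : SmoothNear m F σ x)
    (k : SmoothNear m F τ x) : SmoothNear m F (σ + τ) x := by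
  filter_upwards [h, k] with y hy ky
  exact ContMDiffAt.add_section hy ky

theorem SmoothNear.smul {f : M → ℝ} {σ : ∀ x, W x} {x : M} (hf : SmoothFnNear m f x)
    (h : SmoothNear m F σ x) : SmoothNear m F (f • σ) x := by
  filter_upwards [hf, h] with y hy ky
  exact ContMDiffAt.smul_section hy ky

theorem SmoothNear.sum {ι : Type*} {s : Finset ι} {σ : ι → ∀ x, W x} {x : M}
    (h : ∀ i ∈ s, SmoothNear m F (σ i) x) : SmoothNear m F (fun y ↦ ∑ i ∈ s, σ i y) x := by
  have : ∀ᶠ y in 𝓝 x, ∀ i ∈ s, SmoothAt m F (σ i) y := (Finset.eventually_all s).2 h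
  filter_upwards [this] with y hy
  exact ContMDiffAt.sum_section hy

theorem smoothFnNear_const (c : ℝ) (x : M) : SmoothFnNear m (fun _ ↦ c) x :=
  Eventually.of_forall fun _ ↦ contMDiffAt_const

theorem SmoothFnNear.mdiff {F' : Type*} [NormedAddCommGroup F'] [NormedSpace ℝ F'] {f : M → F'}
    {x : M} (h : SmoothFnNear m f x) : MDifferentiableAt (𝓡 m) 𝓘(ℝ, F') f x :=
  h.self_of_nhds.mdifferentiableAt (by simp)

variable (F) in
theorem smoothNear_extend [ContMDiffVectorBundle ∞ F W (𝓡 m)] {x : M} (w : W x) :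
    SmoothNear m F (FiberBundle.extend F w) x := by
  obtain ⟨s, hs, h⟩ := FiberBundle.exists_contMDiffOn_extend (k := ∞) (𝓡 m) F w
  filter_upwards [eventually_mem_nhds_iff.2 hs] with y hy
  exact h.contMDiffAt hy

theorem exists_smooth_cutoff [T2Space M] {x : M} {U : Set M} (hU : U ∈ 𝓝 x) :
    ∃ ψ : M → ℝ, ContMDiff (𝓡 m) 𝓘(ℝ) ∞ ψ ∧ tsupport ψ ⊆ U ∧ ψ =ᶠ[𝓝 x] 1 := by
  obtain ⟨f, -, hf⟩ := (SmoothBumpFunction.nhds_basis_tsupport (I := 𝓡 m) x).mem_iff.1 hU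
  exact ⟨f, f.contMDiff, hf, f.eventuallyEq_one⟩

/-- Multiply by a bump function. Equivariance and smoothness of a connection are available for
globally smooth sections only, while local computations produce sections smooth near a point. -/
theorem exists_global_section [T2Space M] [ContMDiffVectorBundle ∞ F W (𝓡 m)]
    {σ : ∀ x, W x} {x : M} (h : SmoothNear m F σ x) :
    ∃ τ : ∀ x, W x, SmoothSec m F τ ∧ ∀ᶠ y in 𝓝 x, τ y = σ y := by
  obtain ⟨U, hUs, hUo, hxU⟩ := eventually_nhds_iff.1 h
  obtain ⟨ψ, hψ, hψs, hψ1⟩ := exists_smooth_cutoff (m := m) (hUo.mem_nhds hxU)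
  refine ⟨ψ • σ, ?_, ?_⟩
  · exact ContMDiffOn.smul_section_of_tsupport hψ.contMDiffOn hUo hψs
      fun y hy ↦ (hUs y hy).contMDiffWithinAt
  · filter_upwards [hψ1] with y hy
    simp [hy]

theorem exists_global_fn [T2Space M] {F' : Type*} [NormedAddCommGroup F'] [NormedSpace ℝ F']
    {f : M → F'} {x : M} (h : SmoothFnNear m f x) :
    ∃ g : M → F', ContMDiff (𝓡 m) 𝓘(ℝ, F') ∞ g ∧ ∀ᶠ y in 𝓝 x, g y = f y := by
  obtain ⟨U, hUs, hUo, hxU⟩ := eventually_nhds_iff.1 h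
  obtain ⟨ψ, hψ, hψs, hψ1⟩ := exists_smooth_cutoff (m := m) (hUo.mem_nhds hxU)
  refine ⟨ψ • f, ?_, ?_⟩
  · refine contMDiff_of_tsupport fun y hy ↦ ?_
    exact hψ.contMDiffAt.smul (hUs y (hψs (tsupport_smul_subset_left _ _ hy)))
  · filter_upwards [hψ1] with y hy
    simp [hy]

theorem exists_global_section_eq [T2Space M] [ContMDiffVectorBundle ∞ F W (𝓡 m)]
    {x : M} (w : W x) : ∃ τ : ∀ x, W x, SmoothSec m F τ ∧ τ x = w := by
  obtain ⟨τ, h, e⟩ := exists_global_section (smoothNear_extend (m := m) F w)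
  exact ⟨τ, h, by simpa using e.self_of_nhds⟩

/-- A local frame around a point: every section is a combination of the frame, with coefficients
that are smooth near the point if the section is. -/
theorem exists_local_frame [FiniteDimensional ℝ F] [ContMDiffVectorBundle ∞ F W (𝓡 m)] (x : M) :
    ∃ (s : Fin (Module.finrank ℝ F) → ∀ y, W y)
      (c : Fin (Module.finrank ℝ F) → ∀ y, W y →ₗ[ℝ] ℝ),
      (∀ i, SmoothNear m F (s i) x) ∧
      (∀ σ : ∀ y, W y, SmoothNear m F σ x → ∀ i, SmoothFnNear m (fun y ↦ c i y (σ y)) x) ∧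
      ∀ᶠ y in 𝓝 x, ∀ w : W y, w = ∑ i, c i y w • s i y := by
  have : ContMDiffVectorBundle 1 F W (𝓡 m) := ContMDiffVectorBundle.of_le (n := ∞) (by simp)
  let e := trivializationAt F W x
  let b := Module.finBasis ℝ F
  have hx : x ∈ e.baseSet := FiberBundle.mem_baseSet_trivializationAt F W x
  refine ⟨e.localFrame b, e.localFrameCoeff (𝓡 m) b, fun i ↦ ?_, fun σ hσ i ↦ ?_, ?_⟩
  · filter_upwards [e.open_baseSet.mem_nhds hx] with y hy
    exact contMDiffAt_localFrame_of_mem ∞ e b i hy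
  · filter_upwards [hσ, e.open_baseSet.mem_nhds hx] with y hy hy'
    exact contMDiffAt_localFrameCoeff b hy' hy i
  · filter_upwards [e.open_baseSet.mem_nhds hx] with y hy w
    have := Trivialization.eq_sum_localFrameCoeff_smul (I := 𝓡 m) (e := e) (b := b) hy
      (s := fun z ↦ FiberBundle.extend F w z)
    simpa using this

variable (m F) in
/-- Tensoriality at `x` of an operation on sections that are smooth near `x`. -/
structure Tensorial {A : Type*} [AddCommGroup A] [Module ℝ A] (Φ : (∀ y, W y) → A) (x : M) :
    Prop where
  add {σ τ : ∀ y, W y} : SmoothNear m F σ x → SmoothNear m F τ x → Φ (σ + τ) = Φ σ + Φ τ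
  smul {f : M → ℝ} {σ : ∀ y, W y} : SmoothFnNear m f x → SmoothNear m F σ x →
    Φ (f • σ) = f x • Φ σ

namespace Tensorial

variable {A : Type*} [AddCommGroup A] [Module ℝ A] {Φ : (∀ y, W y) → A} {x : M}

/-- Multiplication by the indicator ψ of the coincidence set makes the two sections equal
everywhere. As ψ is constant near x, it is an admissible multiplier, and ψ(x) = 1. -/
theorem congr (hΦ : Tensorial m F Φ x) {σ τ : ∀ y, W y} (hσ : SmoothNear m F σ x)
    (hτ : SmoothNear m F τ x) (h : ∀ᶠ y in 𝓝 x, σ y = τ y) : Φ σ = Φ τ := by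
  classical
  let ψ (y : M) : ℝ := if σ y = τ y then 1 else 0
  have hψx : ψ x = 1 := by simp [ψ, h.self_of_nhds]
  have heq : ψ • σ = ψ • τ := by
    ext y
    by_cases hy : σ y = τ y <;> simp [ψ, hy]
  have hψ : SmoothFnNear m ψ x := by
    filter_upwards [eventually_eventually_nhds.2 h] with y hy
    have : ContMDiffAt (𝓡 m) 𝓘(ℝ) ∞ (fun _ : M ↦ (1 : ℝ)) y := contMDiffAt_const
    exact this.congr_of_eventuallyEq (hy.mono fun z hz ↦ by simp [ψ, hz])
  calc Φ σ = Φ (ψ • σ) := by simp [hΦ.smul hψ hσ, hψx]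
    _ = Φ (ψ • τ) := by rw [heq]
    _ = Φ τ := by simp [hΦ.smul hψ hτ, hψx]

theorem sum (hΦ : Tensorial m F Φ x) {ι : Type*} {s : Finset ι} {σ : ι → ∀ y, W y}
    (hσ : ∀ i ∈ s, SmoothNear m F (σ i) x) :
    Φ (fun y ↦ ∑ i ∈ s, σ i y) = ∑ i ∈ s, Φ (σ i) := by
  classical
  induction s using Finset.induction_on with
  | empty =>
    have h0 : SmoothNear m F (0 : ∀ y, W y) x := Eventually.of_forall (contMDiff_zeroSection ℝ W)
    have := hΦ.smul (smoothFnNear_const 0 x) h0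
    simp only [zero_smul] at this
    have e : (fun _ : M ↦ (0 : ℝ)) • (0 : ∀ y, W y) = 0 := by ext; simp
    rw [e] at this
    rw [Finset.sum_empty]
    exact this
  | insert a s ha ih =>
    have hs := fun i hi ↦ hσ i (Finset.mem_insert_of_mem hi)
    simp only [Finset.sum_insert ha, ← ih hs]
    exact hΦ.add (hσ a (Finset.mem_insert_self a s)) (SmoothNear.sum hs)

/-- Expanding in a local frame turns Φ σ into a combination of the values on the frame, with
coefficients that depend on σ(x) alone. -/
theorem pointwise [FiniteDimensional ℝ F] [ContMDiffVectorBundle ∞ F W (𝓡 m)]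
    (hΦ : Tensorial m F Φ x) {σ τ : ∀ y, W y} (hσ : SmoothNear m F σ x)
    (hτ : SmoothNear m F τ x) (h : σ x = τ x) : Φ σ = Φ τ := by
  obtain ⟨s, c, hs, hc, he⟩ := exists_local_frame (m := m) (F := F) (W := W) x
  have key : ∀ σ : ∀ y, W y, SmoothNear m F σ x → Φ σ = ∑ i, c i x (σ x) • Φ (s i) := by
    intro σ hσ
    have h1 : ∀ i ∈ Finset.univ, SmoothNear m F ((fun y ↦ c i y (σ y)) • s i) x :=
      fun i _ ↦ SmoothNear.smul (hc σ hσ i) (hs i)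
    rw [hΦ.congr hσ (SmoothNear.sum h1) (he.mono fun y hy ↦ hy (σ y)), hΦ.sum h1]
    exact Finset.sum_congr rfl fun i _ ↦ hΦ.smul (hc σ hσ i) (hs i)
  rw [key σ hσ, key τ hτ, h]

end Tensorial

end Sections

/-! ### Smoothness of homomorphism-valued sections and forms -/

section HomSections

open Filter Topology

variable {m : ℕ} {M : Type*} [TopologicalSpace M] [ChartedSpace (Euc m) M]
  [IsManifold (𝓡 m) ∞ M]

/-- With a basis b of the finite-dimensional source and its coordinates cᵢ, the map is ∑ cᵢ ⊗ g(bᵢ).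
-/
theorem contMDiffAt_clm {F₁ F₂ : Type*} [NormedAddCommGroup F₁] [NormedSpace ℝ F₁]
    [FiniteDimensional ℝ F₁] [NormedAddCommGroup F₂] [NormedSpace ℝ F₂] {g : M → F₁ →L[ℝ] F₂}
    {x : M} (h : ∀ v, ContMDiffAt (𝓡 m) 𝓘(ℝ, F₂) ∞ (fun y ↦ g y v) x) :
    ContMDiffAt (𝓡 m) 𝓘(ℝ, F₁ →L[ℝ] F₂) ∞ g x := by
  let b := Module.finBasis ℝ F₁
  let c (i) : F₁ →L[ℝ] ℝ := LinearMap.toContinuousLinearMap (b.coord i)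
  have e : g = fun y ↦ ∑ i, ContinuousLinearMap.smulRightL ℝ F₁ F₂ (c i) (g y (b i)) := by
    ext y v
    simp only [ContinuousLinearMap.smulRightL_apply_apply, _root_.sum_apply,
      ContinuousLinearMap.smulRight_apply, c, LinearMap.coe_toContinuousLinearMap',
      Module.Basis.coord_apply]
    calc g y v = g y (∑ i, b.repr v i • b i) := by rw [b.sum_repr]
      _ = _ := by simp only [map_sum, map_smul]
  rw [e]
  refine ContMDiffAt.sum fun i _ ↦ ?_
  exact (ContinuousLinearMap.contMDiff _).contMDiffAt.comp x (h (b i))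

variable {F₁ F₂ : Type*} [NormedAddCommGroup F₁] [NormedSpace ℝ F₁] [FiniteDimensional ℝ F₁]
  [NormedAddCommGroup F₂] [NormedSpace ℝ F₂]
  {W₁ W₂ : M → Type*} [TopologicalSpace (TotalSpace F₁ W₁)]
  [∀ x, AddCommGroup (W₁ x)] [∀ x, Module ℝ (W₁ x)] [∀ x, TopologicalSpace (W₁ x)]
  [FiberBundle F₁ W₁] [VectorBundle ℝ F₁ W₁] [ContMDiffVectorBundle ∞ F₁ W₁ (𝓡 m)]
  [TopologicalSpace (TotalSpace F₂ W₂)]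
  [∀ x, AddCommGroup (W₂ x)] [∀ x, Module ℝ (W₂ x)] [∀ x, TopologicalSpace (W₂ x)]
  [∀ x, IsTopologicalAddGroup (W₂ x)] [∀ x, ContinuousSMul ℝ (W₂ x)]
  [FiberBundle F₂ W₂] [VectorBundle ℝ F₂ W₂] [ContMDiffVectorBundle ∞ F₂ W₂ (𝓡 m)]

/-- A section of a bundle of homomorphisms is smooth if it maps smooth sections to smooth
sections. -/
theorem smoothSec_hom [T2Space M] {φ : ∀ x, W₁ x →L[ℝ] W₂ x}
    (h : ∀ σ : ∀ x, W₁ x, SmoothSec m F₁ σ → SmoothSec m F₂ (fun x ↦ φ x (σ x))) :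
    SmoothSec m (F₁ →L[ℝ] F₂) φ := by
  intro x
  rw [contMDiffAt_hom_bundle]
  refine ⟨contMDiffAt_id, contMDiffAt_clm fun v ↦ ?_⟩
  let e₁ := trivializationAt F₁ W₁ x
  let e₂ := trivializationAt F₂ W₂ x
  have hx₁ : x ∈ e₁.baseSet := FiberBundle.mem_baseSet_trivializationAt F₁ W₁ x
  have hx₂ : x ∈ e₂.baseSet := FiberBundle.mem_baseSet_trivializationAt F₂ W₂ x
  -- Near x this section has constant coordinate v in the trivialization, so the coordinates of its
  -- image are those of φ applied to v.
  obtain ⟨τ, hτ, hτe⟩ := exists_global_section (smoothNear_extend (m := m) F₁ (e₁.symm x v))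
  have h1 := (contMDiffAt_section x).1 (h τ hτ x)
  refine h1.congr_of_eventuallyEq ?_
  filter_upwards [hτe, e₁.open_baseSet.mem_nhds hx₁, e₂.open_baseSet.mem_nhds hx₂] with y hy h₁ h₂
  have h3 : (e₁ ⟨x, e₁.symm x v⟩).2 = v := by simp [hx₁]
  have h4 : τ y = e₁.symm y v := by
    rw [hy]
    simp only [FiberBundle.extend]
    rw [show trivializationAt F₁ W₁ x = e₁ from rfl, h3]
  rw [h4]
  simp only [ContinuousLinearMap.inCoordinates, ContinuousLinearMap.comp_apply]
  rw [Trivialization.continuousLinearMapAt_apply, Trivialization.linearMapAt_apply, if_pos h₂,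
    Trivialization.symmL_apply _ h₁]

end HomSections

section EndForms

variable {m n : ℕ} {M : Type*} [TopologicalSpace M] [T2Space M] [ChartedSpace (Euc m) M]
  [IsManifold (𝓡 m) ∞ M]
  {V : M → Type*} [TopologicalSpace (TotalSpace (Euc n) V)]
  [∀ x, NormedAddCommGroup (V x)] [∀ x, InnerProductSpace ℝ (V x)]
  [FiberBundle (Euc n) V] [VectorBundle ℝ (Euc n) V] [ContMDiffVectorBundle ∞ (Euc n) V (𝓡 m)]

variable (n) in
/-- Smoothness of a one-form with values in the endomorphisms of `V`. -/
def SmoothEndForm (φ : EndForm m V) : Prop :=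
  ContMDiff (𝓡 m) ((𝓡 m).prod 𝓘(ℝ, Euc m →L[ℝ] Euc n →L[ℝ] Euc n)) ∞
    (fun x ↦ TotalSpace.mk' (Euc m →L[ℝ] Euc n →L[ℝ] Euc n) x (φ x))

/-- The bundle of these forms is a Hom bundle with values in a Hom bundle, hence two applications of
`smoothSec_hom`. -/
theorem smoothEndForm_iff {φ : EndForm m V} : SmoothEndForm n φ ↔
    ∀ (X : ∀ x : M, TangentSpace (𝓡 m) x) (σ : ∀ x, V x), SmoothSec m (Euc m) X →
      SmoothSec m (Euc n) σ → SmoothSec m (Euc n) fun x ↦ φ x (X x) (σ x) := by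
  refine ⟨fun h X σ hX hσ ↦ ?_, fun h ↦ ?_⟩
  · exact (ContMDiff.clm_bundle_apply h hX).clm_bundle_apply hσ
  · exact smoothSec_hom (F₂ := Euc n →L[ℝ] Euc n) (W₂ := fun x ↦ V x →L[ℝ] V x)
      fun X hX ↦ smoothSec_hom fun σ hσ ↦ h X σ hX hσ

theorem SmoothEndForm.near {φ : EndForm m V} (h : SmoothEndForm n φ)
    {X : ∀ x : M, TangentSpace (𝓡 m) x} {σ : ∀ x, V x} {x : M} (hX : SmoothNear m (Euc m) X x)
    (hσ : SmoothNear m (Euc n) σ x) : SmoothNear m (Euc n) (fun x ↦ φ x (X x) (σ x)) x := by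
  filter_upwards [hX, hσ] with y hy ky
  exact ((h y).clm_bundle_apply hy).clm_bundle_apply ky

end EndForms

/-! ### Vector fields as derivations -/

section Derivations

open Filter Topology

variable {m : ℕ} {M : Type*} [TopologicalSpace M] [ChartedSpace (Euc m) M]
  [IsManifold (𝓡 m) ∞ M]

/-- Chain rule for f = (f ∘ φ⁻¹) ∘ φ, at any point of the chart domain and not just at its centre.
-/
theorem mvfderiv_eq_fderiv_chart {F : Type*} [NormedAddCommGroup F] [NormedSpace ℝ F]
    {f : M → F} {x y : M} (hy : y ∈ (extChartAt (𝓡 m) x).source)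
    (hf : MDifferentiableAt (𝓡 m) 𝓘(ℝ, F) f y) (v : TangentSpace (𝓡 m) y) :
    mvfderiv (𝓡 m) f y v =
      fderiv ℝ (f ∘ (extChartAt (𝓡 m) x).symm) (extChartAt (𝓡 m) x y)
        (mvfderiv (𝓡 m) (extChartAt (𝓡 m) x) y v) := by
  set φ := extChartAt (𝓡 m) x with hφ
  have hyc : y ∈ (chartAt (Euc m) x).source := by rwa [← extChartAt_source (I := 𝓡 m)]
  have h1 : MDifferentiableAt (𝓡 m) 𝓘(ℝ, Euc m) φ y := mdifferentiableAt_extChartAt hyc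
  have hz : φ y ∈ φ.target := φ.map_source hy
  have h2 : MDifferentiableAt 𝓘(ℝ, Euc m) (𝓡 m) φ.symm (φ y) := by
    have := mdifferentiableWithinAt_extChartAt_symm (I := 𝓡 m) hz
    rwa [ModelWithCorners.range_eq_univ, mdifferentiableWithinAt_univ] at this
  have h3 : MDifferentiableAt 𝓘(ℝ, Euc m) 𝓘(ℝ, F) (f ∘ φ.symm) (φ y) := by
    refine MDifferentiableAt.comp (φ y) ?_ h2
    rwa [φ.left_inv hy]
  have e : f =ᶠ[𝓝 y] (f ∘ φ.symm) ∘ φ := by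
    filter_upwards [(isOpen_extChartAt_source (I := 𝓡 m) x).mem_nhds hy] with z hz
    simp [φ.left_inv hz]
  have h4 := mfderiv_comp y h3 h1
  simp only [mvfderiv, ContinuousLinearMap.comp_apply]
  rw [e.mfderiv_eq, h4, mfderiv_eq_fderiv]
  rfl

theorem contMDiff_mvfderiv_apply {F : Type*} [NormedAddCommGroup F] [NormedSpace ℝ F]
    {f : M → F} (hf : ContMDiff (𝓡 m) 𝓘(ℝ, F) ∞ f) {X : ∀ x : M, TangentSpace (𝓡 m) x}
    (hX : SmoothSec m (Euc m) X) :
    ContMDiff (𝓡 m) 𝓘(ℝ, F) ∞ fun y ↦ mvfderiv (𝓡 m) f y (X y) :=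
  (contMDiff_snd_tangentBundle_modelSpace F 𝓘(ℝ, F)).comp
    ((hf.contMDiff_tangentMap (m := ∞) (by simp)).comp hX)

theorem mvfderiv_congr {F : Type*} [NormedAddCommGroup F] [NormedSpace ℝ F]
    {f g : M → F} {x : M} (h : f =ᶠ[𝓝 x] g) : mvfderiv (𝓡 m) f x = mvfderiv (𝓡 m) g x := by
  ext v
  simp only [mvfderiv, ContinuousLinearMap.comp_apply]
  rw [h.mfderiv_eq]
  rfl

theorem SmoothFnNear.mvfderiv_apply [T2Space M] {F : Type*} [NormedAddCommGroup F]
    [NormedSpace ℝ F] {f : M → F} {x : M} (hf : SmoothFnNear m f x)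
    {X : ∀ x : M, TangentSpace (𝓡 m) x} (hX : SmoothNear m (Euc m) X x) :
    SmoothFnNear m (fun y ↦ mvfderiv (𝓡 m) f y (X y)) x := by
  obtain ⟨g, hg, hgf⟩ := exists_global_fn hf
  obtain ⟨Y, hY, hYX⟩ := exists_global_section hX
  have h := contMDiff_mvfderiv_apply hg hY
  filter_upwards [eventually_eventually_nhds.2 hgf, eventually_eventually_nhds.2 hYX] with y h1 h2
  refine (h y).congr_of_eventuallyEq ?_
  filter_upwards [eventually_eventually_nhds.2 h1, h2] with z k1 k2
  rw [mvfderiv_congr (m := m) k1, k2]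

/-- In the chart at x this becomes the identity for vector fields on Euclidean space, which
expresses the symmetry of the second derivative. It cancels the second derivatives of f in the
curvature of f • σ. -/
theorem mvfderiv_mlieBracket {f : M → ℝ} {x : M} (hf : SmoothFnNear m f x)
    {X Y : ∀ x : M, TangentSpace (𝓡 m) x} (hX : SmoothNear m (Euc m) X x)
    (hY : SmoothNear m (Euc m) Y x) [T2Space M] :
    mvfderiv (𝓡 m) f x (VectorField.mlieBracket (𝓡 m) X Y x) =
      mvfderiv (𝓡 m) (fun y ↦ mvfderiv (𝓡 m) f y (Y y)) x (X x) -
        mvfderiv (𝓡 m) (fun y ↦ mvfderiv (𝓡 m) f y (X y)) x (Y x) := by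
  set φ := extChartAt (𝓡 m) x with hφ
  have hx : x ∈ φ.source := mem_extChartAt_source x
  have hz : φ x ∈ φ.target := φ.map_source hx
  let fh : Euc m → ℝ := f ∘ φ.symm
  let hat (Z : ∀ x : M, TangentSpace (𝓡 m) x) : Euc m → Euc m :=
    fun z ↦ mvfderiv (𝓡 m) φ (φ.symm z) (Z (φ.symm z))
  have htgt : φ.target ∈ 𝓝 (φ x) := (isOpen_extChartAt_target x).mem_nhds hz
  have hcont : Tendsto φ.symm (𝓝 (φ x)) (𝓝 x) := by
    have := (continuousAt_extChartAt_symm (I := 𝓡 m) x).tendsto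
    rwa [← hφ, φ.left_inv hx] at this
  -- The pullback along φ⁻¹ applies the inverse of the differential of φ⁻¹, which is the
  -- differential of φ.
  have hpull : ∀ Z : ∀ x : M, TangentSpace (𝓡 m) x,
      VectorField.mpullbackWithin 𝓘(ℝ, Euc m) (𝓡 m) φ.symm Z (Set.range (𝓡 m))
        =ᶠ[𝓝 (φ x)] hat Z := by
    intro Z
    filter_upwards [htgt] with z hz
    simp only [VectorField.mpullbackWithin_apply, hat]
    have hinv := ContinuousLinearMap.inverse_eq
      (mfderivWithin_extChartAt_symm_comp_mfderiv_extChartAt (I := 𝓡 m) (x := x) hz)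
      (mfderiv_extChartAt_comp_mfderivWithin_extChartAt_symm (I := 𝓡 m) (x := x) hz)
    rw [← hφ] at hinv
    rw [hinv]
    rfl
  have hder : ∀ g : M → ℝ, SmoothFnNear m g x → ∀ Z : ∀ x : M, TangentSpace (𝓡 m) x,
      (fun y ↦ mvfderiv (𝓡 m) g y (Z y)) ∘ φ.symm =ᶠ[𝓝 (φ x)]
        fun z ↦ fderiv ℝ (g ∘ φ.symm) z (hat Z z) := by
    intro g hg Z
    filter_upwards [htgt, hcont.eventually hg] with z hz hgz
    simp only [Function.comp_apply, hat]
    rw [mvfderiv_eq_fderiv_chart (x := x) (φ.map_target hz) (hgz.mdifferentiableAt (by simp))]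
    rw [← hφ, φ.right_inv hz]
  have hdiff : ∀ Z : ∀ x : M, TangentSpace (𝓡 m) x, SmoothNear m (Euc m) Z x →
      DifferentiableAt ℝ (hat Z) (φ x) := by
    intro Z hZ
    have h := MDifferentiableWithinAt.differentiableWithinAt_mpullbackWithin_vectorField
      (I := 𝓡 m) (s := Set.univ) (x := x) (V := Z) (hZ.mdiff.mdifferentiableWithinAt)
    have h2 := h.differentiableAt (by simp)
    exact DifferentiableAt.congr_of_eventuallyEq h2 (hpull Z).symm
  have hfh : ContDiffAt ℝ ∞ fh (φ x) := by
    have h1 : ContMDiffAt 𝓘(ℝ, Euc m) (𝓡 m) ∞ φ.symm (φ x) := by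
      have := contMDiffWithinAt_extChartAt_symm_target (I := 𝓡 m) (n := ∞) x hz
      exact this.contMDiffAt htgt
    refine ContMDiffAt.contDiffAt (ContMDiffAt.comp (φ x) (I' := 𝓡 m) ?_ h1)
    rw [φ.left_inv hx]
    exact hf.self_of_nhds
  have hmain := VectorField.fderiv_apply_lieBracket (n := ∞) hfh (by simpa using ENat.LEInfty.out)
    (hdiff Y hY) (hdiff X hX)
  have hbr : mvfderiv (𝓡 m) φ x (VectorField.mlieBracket (𝓡 m) X Y x) =
      VectorField.lieBracket ℝ (hat X) (hat Y) (φ x) := by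
    have h1 : (mfderiv (𝓡 m) 𝓘(ℝ, Euc m) φ x).IsInvertible := isInvertible_mfderiv_extChartAt hx
    have h2 : VectorField.mlieBracket (𝓡 m) X Y x = (mfderiv (𝓡 m) 𝓘(ℝ, Euc m) φ x).inverse
        (VectorField.lieBracket ℝ (hat X) (hat Y) (φ x)) := by
      let pb (Z : ∀ x : M, TangentSpace (𝓡 m) x) : Euc m → Euc m :=
        VectorField.mpullbackWithin 𝓘(ℝ, Euc m) (𝓡 m) φ.symm Z (Set.range (𝓡 m))
      have h3 : VectorField.lieBracketWithin ℝ (pb X) (pb Y)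
          (φ.symm ⁻¹' Set.univ ∩ Set.range (𝓡 m)) (φ x) =
          VectorField.lieBracket ℝ (hat X) (hat Y) (φ x) := by
        rw [ModelWithCorners.range_eq_univ, Set.preimage_univ, Set.univ_inter,
          VectorField.lieBracketWithin_univ]
        exact (hpull X).lieBracket_vectorField_eq (hpull Y)
      rw [← VectorField.mlieBracketWithin_univ, VectorField.mlieBracketWithin_apply]
      exact congrArg _ h3
    rw [h2]
    exact h1.self_apply_inverse _
  have e1 : ∀ Z Z' : ∀ x : M, TangentSpace (𝓡 m) x, SmoothNear m (Euc m) Z x →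
      mvfderiv (𝓡 m) (fun y ↦ mvfderiv (𝓡 m) f y (Z y)) x (Z' x) =
      fderiv ℝ (fun z ↦ fderiv ℝ fh z (hat Z z)) (φ x) (hat Z' (φ x)) := by
    intro Z Z' hZ
    rw [mvfderiv_eq_fderiv_chart (x := x) hx (hf.mvfderiv_apply hZ).mdiff, ← hφ,
      (hder f hf Z).fderiv_eq]
    rw [← show hat Z' (φ x) = mvfderiv (𝓡 m) φ x (Z' x) from
      congrArg (fun y ↦ mvfderiv (𝓡 m) φ y (Z' y)) (φ.left_inv hx)]
  rw [mvfderiv_eq_fderiv_chart (x := x) hx hf.mdiff, ← hφ, hbr, e1 Y X hY, e1 X Y hX]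
  exact hmain

end Derivations

/-! ### Calculus of connections -/

section Connections

open Filter Topology VectorField

variable {m n : ℕ} {M : Type*} [TopologicalSpace M] [T2Space M] [ChartedSpace (Euc m) M]
  [IsManifold (𝓡 m) ∞ M]
  {V : M → Type*} [TopologicalSpace (TotalSpace (Euc n) V)]
  [∀ x, NormedAddCommGroup (V x)] [∀ x, InnerProductSpace ℝ (V x)]
  [FiberBundle (Euc n) V] [VectorBundle ℝ (Euc n) V] [ContMDiffVectorBundle ∞ (Euc n) V (𝓡 m)]
  {D : CovariantDerivative (𝓡 m) (Euc n) V}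

theorem cov_add {σ τ : ∀ x, V x} {x : M} (hσ : SmoothNear m (Euc n) σ x)
    (hτ : SmoothNear m (Euc n) τ x) : D (σ + τ) x = D σ x + D τ x :=
  D.isCovariantDerivativeOnUniv.add hσ.mdiff hτ.mdiff

theorem cov_smul {f : M → ℝ} {σ : ∀ x, V x} {x : M} (hf : SmoothFnNear m f x)
    (hσ : SmoothNear m (Euc n) σ x) (u : TangentSpace (𝓡 m) x) :
    D (f • σ) x u = f x • D σ x u + mvfderiv (𝓡 m) f x u • σ x := by
  rw [D.isCovariantDerivativeOnUniv.leibniz hσ.mdiff hf.mdiff]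
  rfl

theorem cov_const_smul (c : ℝ) {σ : ∀ x, V x} {x : M} (hσ : SmoothNear m (Euc n) σ x) :
    D (c • σ) x = c • D σ x :=
  D.isCovariantDerivativeOnUniv.smul_const c hσ.mdiff

theorem cov_congr {σ τ : ∀ x, V x} {x : M} (hσ : SmoothNear m (Euc n) σ x)
    (h : ∀ᶠ y in 𝓝 x, σ y = τ y) : D σ x = D τ x :=
  D.isCovariantDerivativeOnUniv.congr_of_eventuallyEq hσ.mdiff (hσ.congr h).mdiff
    univ_mem h

theorem cov_sum {ι : Type*} {s : Finset ι} {σ : ι → ∀ x, V x} {x : M}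
    (hσ : ∀ i ∈ s, SmoothNear m (Euc n) (σ i) x) :
    D (fun y ↦ ∑ i ∈ s, σ i y) x = ∑ i ∈ s, D (σ i) x := by
  classical
  induction s using Finset.induction_on with
  | empty =>
    simp only [Finset.sum_empty]
    exact D.isCovariantDerivativeOnUniv.zero
  | insert a s ha ih =>
    have hs := fun i hi ↦ hσ i (Finset.mem_insert_of_mem hi)
    simp only [Finset.sum_insert ha, ← ih hs]
    exact cov_add (hσ a (Finset.mem_insert_self a s)) (SmoothNear.sum hs)

theorem curvFields_swap (X Y : ∀ x : M, TangentSpace (𝓡 m) x) (σ : ∀ x, V x) (x : M) :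
    curvFields D X Y σ x = -curvFields D Y X σ x := by
  simp only [curvFields]
  rw [mlieBracket_swap_apply, map_neg]
  abel

theorem extCovFields_swap {φ : EndForm m V} (X Y : ∀ x : M, TangentSpace (𝓡 m) x)
    (σ : ∀ x, V x) (x : M) : extCovFields D φ X Y σ x = -extCovFields D φ Y X σ x := by
  simp only [extCovFields]
  rw [mlieBracket_swap_apply, map_neg, _root_.neg_apply]
  abel

section Smooth

variable (hD : CovariantDerivative.ContMDiffCovariantDerivative D ∞)
include hD

theorem cov_smooth {σ : ∀ x, V x} (hσ : SmoothSec m (Euc n) σ)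
    {X : ∀ x : M, TangentSpace (𝓡 m) x} (hX : SmoothSec m (Euc m) X) :
    SmoothSec m (Euc n) fun y ↦ D σ y (X y) := by
  have h := hD.contMDiff.contMDiff (σ := σ) (hσ.contMDiffOn.of_le (by simp))
  rw [contMDiffOn_univ] at h
  exact ContMDiff.clm_bundle_apply h hX

/-- D is local, so σ and X may be replaced by global smooth sections that agree with them near x. -/
theorem cov_near {σ : ∀ x, V x} {x : M} (hσ : SmoothNear m (Euc n) σ x)
    {X : ∀ x : M, TangentSpace (𝓡 m) x} (hX : SmoothNear m (Euc m) X x) :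
    SmoothNear m (Euc n) (fun y ↦ D σ y (X y)) x := by
  obtain ⟨τ, hτ, e⟩ := exists_global_section hσ
  obtain ⟨Y, hY, e'⟩ := exists_global_section hX
  refine ((cov_smooth hD hτ hY).near x).congr ?_
  filter_upwards [eventually_eventually_nhds.2 e, e'] with y h1 h2
  rw [cov_congr (hτ.near y) h1, h2]

/-- The Leibniz term (Yf) D_X σ produced by D_Y(f D_X σ) cancels against the one coming from [fX, Y]
= f[X, Y] − (Yf) X. -/
theorem curvFields_tensorial_left {Y : ∀ x : M, TangentSpace (𝓡 m) x} {σ : ∀ x, V x} {x : M}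
    (hσ : SmoothNear m (Euc n) σ x) :
    Tensorial m (Euc m) (fun X ↦ curvFields D X Y σ x) x where
  add {X X'} hX hX' := by
    have e : (fun y ↦ D σ y ((X + X') y)) = (fun y ↦ D σ y (X y)) + fun y ↦ D σ y (X' y) := by
      ext y; simp
    simp only [curvFields, e]
    rw [cov_add (cov_near hD hσ hX) (cov_near hD hσ hX'),
      mlieBracket_add_left hX.mdiff hX'.mdiff]
    simp only [Pi.add_apply, map_add, _root_.add_apply]
    abel
  smul {f X} hf hX := by
    have e : (fun y ↦ D σ y ((f • X) y)) = f • (fun y ↦ D σ y (X y)) := by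
      ext y; simp
    simp only [curvFields, e]
    rw [cov_smul hf (cov_near hD hσ hX), mlieBracket_smul_left hf.mdiff hX.mdiff]
    simp only [Pi.smul_apply', map_smul, map_add, smul_sub]
    module

theorem curvFields_tensorial_right {X : ∀ x : M, TangentSpace (𝓡 m) x} {σ : ∀ x, V x} {x : M}
    (hσ : SmoothNear m (Euc n) σ x) :
    Tensorial m (Euc m) (fun Y ↦ curvFields D X Y σ x) x where
  add {Y Y'} hY hY' := by
    simp only [curvFields_swap X]
    rw [(curvFields_tensorial_left hD hσ).add hY hY', neg_add]
  smul {f Y} hf hY := by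
    simp only [curvFields_swap X]
    rw [(curvFields_tensorial_left hD hσ).smul hf hY, smul_neg]

theorem cov_cov_smul {X Y : ∀ x : M, TangentSpace (𝓡 m) x} {f : M → ℝ} {σ : ∀ x, V x} {x : M}
    (hf : SmoothFnNear m f x) (hY : SmoothNear m (Euc m) Y x) (hσ : SmoothNear m (Euc n) σ x) :
    D (fun y ↦ D (f • σ) y (Y y)) x (X x) =
      f x • D (fun y ↦ D σ y (Y y)) x (X x) + mvfderiv (𝓡 m) f x (X x) • D σ x (Y x)
        + mvfderiv (𝓡 m) f x (Y x) • D σ x (X x)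
        + mvfderiv (𝓡 m) (fun y ↦ mvfderiv (𝓡 m) f y (Y y)) x (X x) • σ x := by
  have e : ∀ᶠ y in 𝓝 x, (f • (fun y ↦ D σ y (Y y)) +
      (fun y ↦ mvfderiv (𝓡 m) f y (Y y)) • σ) y = D (f • σ) y (Y y) := by
    filter_upwards [eventually_eventually_nhds.2 hf, hσ.eventually] with y h1 h2
    rw [cov_smul h1 h2]
    rfl
  have h1 := SmoothNear.smul hf (cov_near hD hσ hY)
  have h2 := SmoothNear.smul (hf.mvfderiv_apply hY) hσ
  rw [← cov_congr (h1.add h2) e, cov_add h1 h2, _root_.add_apply, cov_smul hf (cov_near hD hσ hY),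
    cov_smul (hf.mvfderiv_apply hY) hσ]
  abel

/-- In `cov_cov_smul` the terms with one derivative of f are symmetric in X and Y and drop out of
the commutator. The second derivatives leave ([X, Y]f) σ, which the bracket term removes. -/
theorem curvFields_tensorial {X Y : ∀ x : M, TangentSpace (𝓡 m) x} {x : M}
    (hX : SmoothNear m (Euc m) X x) (hY : SmoothNear m (Euc m) Y x) :
    Tensorial m (Euc n) (fun σ ↦ curvFields D X Y σ x) x where
  add {σ τ} hσ hτ := by
    have e : ∀ Z : ∀ x : M, TangentSpace (𝓡 m) x, SmoothNear m (Euc m) Z x →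
        D (fun y ↦ D (σ + τ) y (Z y)) x = D (fun y ↦ D σ y (Z y)) x + D (fun y ↦ D τ y (Z y)) x := by
      intro Z hZ
      rw [← cov_add (cov_near hD hσ hZ) (cov_near hD hτ hZ)]
      refine (cov_congr ((cov_near hD hσ hZ).add (cov_near hD hτ hZ)) ?_).symm
      filter_upwards [hσ.eventually, hτ.eventually] with y h1 h2
      rw [cov_add h1 h2]
      rfl
    simp only [curvFields]
    rw [e X hX, e Y hY, cov_add hσ hτ]
    simp only [_root_.add_apply]
    abel
  smul {f σ} hf hσ := by
    simp only [curvFields]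
    rw [cov_cov_smul hD hf hY hσ, cov_cov_smul hD hf hX hσ, cov_smul hf hσ,
      mvfderiv_mlieBracket hf hX hY]
    module

/-- Curvature computed with arbitrary extensions. -/
theorem curvFields_eq_curv {X Y : ∀ x : M, TangentSpace (𝓡 m) x} {σ : ∀ x, V x} {x : M}
    (hX : SmoothNear m (Euc m) X x) (hY : SmoothNear m (Euc m) Y x)
    (hσ : SmoothNear m (Euc n) σ x) : curvFields D X Y σ x = curv D x (X x) (Y x) (σ x) := by
  have hX' := smoothNear_extend (m := m) (Euc m) (X x)
  have hY' := smoothNear_extend (m := m) (Euc m) (Y x)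
  have hσ' := smoothNear_extend (m := m) (Euc n) (σ x)
  rw [curv, (curvFields_tensorial_left hD hσ).pointwise hX hX' (by simp),
    (curvFields_tensorial_right hD hσ).pointwise hY hY' (by simp),
    (curvFields_tensorial hD hX' hY').pointwise hσ hσ' (by simp)]

theorem covEnd_add_right {φ : EndForm m V} (hφ : SmoothEndForm n φ)
    {X Y : ∀ x : M, TangentSpace (𝓡 m) x} {σ τ : ∀ x, V x} {x : M}
    (hY : SmoothNear m (Euc m) Y x) (hσ : SmoothNear m (Euc n) σ x)
    (hτ : SmoothNear m (Euc n) τ x) :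
    covEnd D φ X Y (σ + τ) x = covEnd D φ X Y σ x + covEnd D φ X Y τ x := by
  have e : (fun y ↦ φ y (Y y) ((σ + τ) y)) =
      (fun y ↦ φ y (Y y) (σ y)) + fun y ↦ φ y (Y y) (τ y) := by
    ext y; simp
  simp only [covEnd, e]
  rw [cov_add (hφ.near hY hσ) (hφ.near hY hτ), cov_add hσ hτ]
  simp only [_root_.add_apply, map_add]
  abel

/-- Both terms of `covEnd` contribute (Xf) φ_Y σ, with opposite signs. -/
theorem covEnd_smul_right {φ : EndForm m V} (hφ : SmoothEndForm n φ)
    {X Y : ∀ x : M, TangentSpace (𝓡 m) x} {f : M → ℝ} {σ : ∀ x, V x} {x : M}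
    (hf : SmoothFnNear m f x) (hY : SmoothNear m (Euc m) Y x) (hσ : SmoothNear m (Euc n) σ x) :
    covEnd D φ X Y (f • σ) x = f x • covEnd D φ X Y σ x := by
  have e : (fun y ↦ φ y (Y y) ((f • σ) y)) = f • (fun y ↦ φ y (Y y) (σ y)) := by
    ext y; simp
  simp only [covEnd, e]
  rw [cov_smul hf (hφ.near hY hσ), cov_smul hf hσ]
  simp only [map_smul, map_add]
  module

/-- The Leibniz term (Yf) φ_X σ cancels against φ applied to the −(Yf) X part of [fX, Y]. -/
theorem extCovFields_tensorial_left {φ : EndForm m V} (hφ : SmoothEndForm n φ)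
    {Y : ∀ x : M, TangentSpace (𝓡 m) x} {σ : ∀ x, V x} {x : M}
    (hσ : SmoothNear m (Euc n) σ x) :
    Tensorial m (Euc m) (fun X ↦ extCovFields D φ X Y σ x) x where
  add {X X'} hX hX' := by
    have e : (fun y ↦ φ y ((X + X') y) (σ y)) =
        (fun y ↦ φ y (X y) (σ y)) + fun y ↦ φ y (X' y) (σ y) := by
      ext y; simp
    simp only [extCovFields, covEnd, e]
    rw [cov_add (hφ.near hX hσ) (hφ.near hX' hσ), mlieBracket_add_left hX.mdiff hX'.mdiff]
    simp only [Pi.add_apply, map_add, _root_.add_apply]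
    abel
  smul {f X} hf hX := by
    have e : (fun y ↦ φ y ((f • X) y) (σ y)) = f • (fun y ↦ φ y (X y) (σ y)) := by
      ext y; simp
    simp only [extCovFields, covEnd, e]
    rw [cov_smul hf (hφ.near hX hσ), mlieBracket_smul_left hf.mdiff hX.mdiff]
    simp only [Pi.smul_apply', map_smul, map_add, _root_.add_apply, _root_.smul_apply]
    module

theorem extCovFields_tensorial_right {φ : EndForm m V} (hφ : SmoothEndForm n φ)
    {X : ∀ x : M, TangentSpace (𝓡 m) x} {σ : ∀ x, V x} {x : M}
    (hσ : SmoothNear m (Euc n) σ x) :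
    Tensorial m (Euc m) (fun Y ↦ extCovFields D φ X Y σ x) x where
  add {Y Y'} hY hY' := by
    simp only [extCovFields_swap X]
    rw [(extCovFields_tensorial_left hD hφ hσ).add hY hY', neg_add]
  smul {f Y} hf hY := by
    simp only [extCovFields_swap X]
    rw [(extCovFields_tensorial_left hD hφ hσ).smul hf hY, smul_neg]

theorem extCovFields_tensorial {φ : EndForm m V} (hφ : SmoothEndForm n φ)
    {X Y : ∀ x : M, TangentSpace (𝓡 m) x} {x : M}
    (hX : SmoothNear m (Euc m) X x) (hY : SmoothNear m (Euc m) Y x) :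
    Tensorial m (Euc n) (fun σ ↦ extCovFields D φ X Y σ x) x where
  add {σ τ} hσ hτ := by
    simp only [extCovFields]
    rw [covEnd_add_right hD hφ hX hσ hτ, covEnd_add_right hD hφ hY hσ hτ]
    simp only [Pi.add_apply, map_add]
    abel
  smul {f σ} hf hσ := by
    simp only [extCovFields]
    rw [covEnd_smul_right hD hφ hf hX hσ, covEnd_smul_right hD hφ hf hY hσ]
    simp only [Pi.smul_apply', map_smul, smul_sub]

/-- The exterior covariant derivative computed with arbitrary extensions. -/
theorem extCovFields_eq_extCov {φ : EndForm m V} (hφ : SmoothEndForm n φ)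
    {X Y : ∀ x : M, TangentSpace (𝓡 m) x} {σ : ∀ x, V x} {x : M}
    (hX : SmoothNear m (Euc m) X x) (hY : SmoothNear m (Euc m) Y x)
    (hσ : SmoothNear m (Euc n) σ x) :
    extCovFields D φ X Y σ x = extCov D φ x (X x) (Y x) (σ x) := by
  have hX' := smoothNear_extend (m := m) (Euc m) (X x)
  have hY' := smoothNear_extend (m := m) (Euc m) (Y x)
  have hσ' := smoothNear_extend (m := m) (Euc n) (σ x)
  rw [extCov, (extCovFields_tensorial_left hD hφ hσ).pointwise hX hX' (by simp),
    (extCovFields_tensorial_right hD hφ hσ).pointwise hY hY' (by simp),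
    (extCovFields_tensorial hD hφ hX' hY').pointwise hσ hσ' (by simp)]

end Smooth

end Connections


/-! ### Curvature and exterior derivative as smooth trilinear fields; the curvature of D + tφ -/

/-- Only the values at x of the two sides of w, w' ↦ extension matter, by `Tensorial.pointwise`; the
extensions themselves are not compared away from x. -/
theorem Tensorial.map_extend_add {m : ℕ} {M : Type*} [TopologicalSpace M]
    [ChartedSpace (Euc m) M] [IsManifold (𝓡 m) ∞ M]
    {F : Type*} [NormedAddCommGroup F] [NormedSpace ℝ F] [FiniteDimensional ℝ F]
    {W : M → Type*} [TopologicalSpace (TotalSpace F W)]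
    [∀ x, AddCommGroup (W x)] [∀ x, Module ℝ (W x)] [∀ x, TopologicalSpace (W x)]
    [FiberBundle F W] [VectorBundle ℝ F W] [ContMDiffVectorBundle ∞ F W (𝓡 m)]
    {A : Type*} [AddCommGroup A] [Module ℝ A] {Φ : (∀ y, W y) → A} {x : M}
    (hΦ : Tensorial m F Φ x) (w w' : W x) :
    Φ (FiberBundle.extend F (w + w')) = Φ (FiberBundle.extend F w) + Φ (FiberBundle.extend F w') := by
  have h := smoothNear_extend (m := m) F w
  have h' := smoothNear_extend (m := m) F w'
  rw [← hΦ.add h h']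
  exact hΦ.pointwise (smoothNear_extend F _) (h.add h') (by simp)

theorem Tensorial.map_extend_smul {m : ℕ} {M : Type*} [TopologicalSpace M]
    [ChartedSpace (Euc m) M] [IsManifold (𝓡 m) ∞ M]
    {F : Type*} [NormedAddCommGroup F] [NormedSpace ℝ F] [FiniteDimensional ℝ F]
    {W : M → Type*} [TopologicalSpace (TotalSpace F W)]
    [∀ x, AddCommGroup (W x)] [∀ x, Module ℝ (W x)] [∀ x, TopologicalSpace (W x)]
    [FiberBundle F W] [VectorBundle ℝ F W] [ContMDiffVectorBundle ∞ F W (𝓡 m)]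
    {A : Type*} [AddCommGroup A] [Module ℝ A] {Φ : (∀ y, W y) → A} {x : M}
    (hΦ : Tensorial m F Φ x) (c : ℝ) (w : W x) :
    Φ (FiberBundle.extend F (c • w)) = c • Φ (FiberBundle.extend F w) := by
  have h := smoothNear_extend (m := m) F w
  rw [← hΦ.smul (smoothFnNear_const c x) h]
  exact hΦ.pointwise (smoothNear_extend F _) (SmoothNear.smul (smoothFnNear_const c x) h) (by simp)

/-- Linearity in each of three arguments. -/
def Trilinear {T V : Type*} [AddCommGroup T] [Module ℝ T] [AddCommGroup V] [Module ℝ V]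
    (A : T → T → V → V) : Prop :=
  ∃ B : T →ₗ[ℝ] T →ₗ[ℝ] V →ₗ[ℝ] V, A = fun u v w ↦ B u v w

theorem Trilinear.of {T V : Type*} [AddCommGroup T] [Module ℝ T] [AddCommGroup V] [Module ℝ V]
    {A : T → T → V → V} (h₁ : ∀ u u' v w, A (u + u') v w = A u v w + A u' v w)
    (k₁ : ∀ (c : ℝ) u v w, A (c • u) v w = c • A u v w)
    (h₂ : ∀ u v v' w, A u (v + v') w = A u v w + A u v' w)
    (k₂ : ∀ (c : ℝ) u v w, A u (c • v) w = c • A u v w)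
    (h₃ : ∀ u v w w', A u v (w + w') = A u v w + A u v w')
    (k₃ : ∀ (c : ℝ) u v w, A u v (c • w) = c • A u v w) : Trilinear A :=
  ⟨LinearMap.mk₂ ℝ (fun u v ↦ (⟨⟨A u v, h₃ u v⟩, fun c w ↦ k₃ c u v w⟩ : V →ₗ[ℝ] V))
    (fun u u' v ↦ LinearMap.ext (h₁ u u' v)) (fun c u v ↦ LinearMap.ext (k₁ c u v))
    (fun u v v' ↦ LinearMap.ext (h₂ u v v')) (fun c u v ↦ LinearMap.ext (k₂ c u v)), rfl⟩

section Pointwise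

open Filter Topology VectorField

variable {m n : ℕ} {M : Type*} [TopologicalSpace M] [T2Space M] [ChartedSpace (Euc m) M]
  [IsManifold (𝓡 m) ∞ M]
  {V : M → Type*} [TopologicalSpace (TotalSpace (Euc n) V)]
  [∀ x, NormedAddCommGroup (V x)] [∀ x, InnerProductSpace ℝ (V x)]
  [FiberBundle (Euc n) V] [VectorBundle ℝ (Euc n) V] [ContMDiffVectorBundle ∞ (Euc n) V (𝓡 m)]
  {D : CovariantDerivative (𝓡 m) (Euc n) V}

theorem curv_trilinear (hD : CovariantDerivative.ContMDiffCovariantDerivative D ∞) (x : M) :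
    Trilinear (curv D x) :=
  have hT (u : TangentSpace (𝓡 m) x) := smoothNear_extend (m := m) (Euc m) u
  have hV (w : V x) := smoothNear_extend (m := m) (Euc n) w
  .of (fun u u' _ w ↦ (curvFields_tensorial_left hD (hV w)).map_extend_add u u')
    (fun c u _ w ↦ (curvFields_tensorial_left hD (hV w)).map_extend_smul c u)
    (fun _ v v' w ↦ (curvFields_tensorial_right hD (hV w)).map_extend_add v v')
    (fun c _ v w ↦ (curvFields_tensorial_right hD (hV w)).map_extend_smul c v)
    (fun u v w w' ↦ (curvFields_tensorial hD (hT u) (hT v)).map_extend_add w w')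
    (fun c u v w ↦ (curvFields_tensorial hD (hT u) (hT v)).map_extend_smul c w)

theorem extCov_trilinear (hD : CovariantDerivative.ContMDiffCovariantDerivative D ∞)
    {φ : EndForm m V} (hφ : SmoothEndForm n φ) (x : M) : Trilinear (extCov D φ x) :=
  have hT (u : TangentSpace (𝓡 m) x) := smoothNear_extend (m := m) (Euc m) u
  have hV (w : V x) := smoothNear_extend (m := m) (Euc n) w
  .of (fun u u' _ w ↦ (extCovFields_tensorial_left hD hφ (hV w)).map_extend_add u u')
    (fun c u _ w ↦ (extCovFields_tensorial_left hD hφ (hV w)).map_extend_smul c u)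
    (fun _ v v' w ↦ (extCovFields_tensorial_right hD hφ (hV w)).map_extend_add v v')
    (fun c _ v w ↦ (extCovFields_tensorial_right hD hφ (hV w)).map_extend_smul c v)
    (fun u v w w' ↦ (extCovFields_tensorial hD hφ (hT u) (hT v)).map_extend_add w w')
    (fun c u v w ↦ (extCovFields_tensorial hD hφ (hT u) (hT v)).map_extend_smul c w)

theorem curv_swap (x : M) (u v : TangentSpace (𝓡 m) x) (w : V x) :
    curv D x u v w = -curv D x v u w := curvFields_swap _ _ _ _

theorem mlieBracket_smooth {X Y : ∀ x : M, TangentSpace (𝓡 m) x} (hX : SmoothSec m (Euc m) X)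
    (hY : SmoothSec m (Euc m) Y) : SmoothSec m (Euc m) (mlieBracket (𝓡 m) X Y) := by
  have : IsManifold (𝓡 m) (((⊤ : ℕ∞) : ℕ∞ω) + 1) M := by
    simpa using (inferInstance : IsManifold (𝓡 m) ∞ M)
  have : IsManifold (𝓡 m) (minSmoothness ℝ 2) M :=
    IsManifold.of_le (n := ∞) (by simpa using ENat.LEInfty.out)
  exact ContDiff.mlieBracket_vectorField (n := ⊤) (m := ⊤) hX hY (by simp)

theorem curv_smooth (hD : CovariantDerivative.ContMDiffCovariantDerivative D ∞)
    {X Y : ∀ x : M, TangentSpace (𝓡 m) x} {σ : ∀ x, V x} (hX : SmoothSec m (Euc m) X)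
    (hY : SmoothSec m (Euc m) Y) (hσ : SmoothSec m (Euc n) σ) :
    SmoothSec m (Euc n) fun x ↦ curv D x (X x) (Y x) (σ x) := by
  have e : (fun x ↦ curv D x (X x) (Y x) (σ x)) = curvFields D X Y σ := by
    ext x
    rw [curvFields_eq_curv hD (hX.near x) (hY.near x) (hσ.near x)]
  rw [e]
  exact (ContMDiff.sub_section (cov_smooth hD (cov_smooth hD hσ hY) hX)
    (cov_smooth hD (cov_smooth hD hσ hX) hY)).sub_section
    (cov_smooth hD hσ (mlieBracket_smooth hX hY))

theorem covEnd_smooth (hD : CovariantDerivative.ContMDiffCovariantDerivative D ∞)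
    {φ : EndForm m V} (hφ : SmoothEndForm n φ)
    {X Y : ∀ x : M, TangentSpace (𝓡 m) x} {σ : ∀ x, V x} (hX : SmoothSec m (Euc m) X)
    (hY : SmoothSec m (Euc m) Y) (hσ : SmoothSec m (Euc n) σ) :
    SmoothSec m (Euc n) (covEnd D φ X Y σ) :=
  ContMDiff.sub_section (cov_smooth hD (smoothEndForm_iff.1 hφ Y σ hY hσ) hX)
    (smoothEndForm_iff.1 hφ Y _ hY (cov_smooth hD hσ hX))

theorem extCov_smooth (hD : CovariantDerivative.ContMDiffCovariantDerivative D ∞)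
    {φ : EndForm m V} (hφ : SmoothEndForm n φ)
    {X Y : ∀ x : M, TangentSpace (𝓡 m) x} {σ : ∀ x, V x} (hX : SmoothSec m (Euc m) X)
    (hY : SmoothSec m (Euc m) Y) (hσ : SmoothSec m (Euc n) σ) :
    SmoothSec m (Euc n) fun x ↦ extCov D φ x (X x) (Y x) (σ x) := by
  have e : (fun x ↦ extCov D φ x (X x) (Y x) (σ x)) = extCovFields D φ X Y σ := by
    ext x
    rw [extCovFields_eq_extCov hD hφ (hX.near x) (hY.near x) (hσ.near x)]
  rw [e]
  exact (ContMDiff.sub_section (covEnd_smooth hD hφ hX hY hσ)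
    (covEnd_smooth hD hφ hY hX hσ)).sub_section
    (smoothEndForm_iff.1 hφ _ σ (mlieBracket_smooth hX hY) hσ)

/-- The commutator `[φ_u, φ_v]`. -/
def wedgeSq (φ : EndForm m V) (x : M) (u v : TangentSpace (𝓡 m) x) (w : V x) : V x :=
  φ x u (φ x v w) - φ x v (φ x u w)

theorem wedgeSq_trilinear (φ : EndForm m V) (x : M) : Trilinear (wedgeSq φ x) := by
  refine .of ?_ ?_ ?_ ?_ ?_ ?_ <;> intros <;> simp only [wedgeSq, map_add, map_smul,
    _root_.add_apply, _root_.smul_apply] <;> module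

theorem wedgeSq_smooth {φ : EndForm m V} (hφ : SmoothEndForm n φ)
    {X Y : ∀ x : M, TangentSpace (𝓡 m) x} {σ : ∀ x, V x} (hX : SmoothSec m (Euc m) X)
    (hY : SmoothSec m (Euc m) Y) (hσ : SmoothSec m (Euc n) σ) :
    SmoothSec m (Euc n) fun x ↦ wedgeSq φ x (X x) (Y x) (σ x) :=
  have h := smoothEndForm_iff.1 hφ
  ContMDiff.sub_section (h X _ hX (h Y σ hY hσ)) (h Y _ hY (h X σ hX hσ))

theorem vary_apply (φ : EndForm m V) (t : ℝ) (σ : ∀ x, V x) (x : M) (u : TangentSpace (𝓡 m) x) :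
    vary D φ t σ x u = D σ x u + t • φ x u (σ x) := rfl

/-- In the t-linear part, the terms φ_X(D_Y σ) from one order of differentiation are exactly those
that `covEnd` subtracts for the other order; the t²-part is the commutator. -/
theorem curv_vary (hD : CovariantDerivative.ContMDiffCovariantDerivative D ∞)
    {φ : EndForm m V} (hφ : SmoothEndForm n φ) (t : ℝ) (x : M) (u v : TangentSpace (𝓡 m) x)
    (w : V x) :
    curv (vary D φ t) x u v w =
      curv D x u v w + t • extCov D φ x u v w + t ^ 2 • wedgeSq φ x u v w := by
  have hu := smoothNear_extend (m := m) (Euc m) u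
  have hv := smoothNear_extend (m := m) (Euc m) v
  have hw := smoothNear_extend (m := m) (Euc n) w
  have key : ∀ X Y : ∀ x : M, TangentSpace (𝓡 m) x, SmoothNear m (Euc m) X x →
      SmoothNear m (Euc m) Y x → ∀ σ : ∀ x, V x, SmoothNear m (Euc n) σ x →
      vary D φ t (fun y ↦ vary D φ t σ y (Y y)) x (X x) =
        D (fun y ↦ D σ y (Y y)) x (X x) + t • D (fun y ↦ φ y (Y y) (σ y)) x (X x) +
        t • φ x (X x) (D σ x (Y x)) + t ^ 2 • φ x (X x) (φ x (Y x) (σ x)) := by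
    intro X Y hX hY σ hσ
    have e : (fun y ↦ vary D φ t σ y (Y y)) =
        (fun y ↦ D σ y (Y y)) + t • fun y ↦ φ y (Y y) (σ y) := by
      ext y; rw [vary_apply]; rfl
    have h1 := hφ.near hY hσ
    have h2 : SmoothNear m (Euc n) (t • fun y ↦ φ y (Y y) (σ y)) x :=
      SmoothNear.smul (smoothFnNear_const t x) h1
    rw [e, vary_apply, cov_add (cov_near hD hσ hY) h2, _root_.add_apply, cov_const_smul t h1]
    simp only [Pi.add_apply, Pi.smul_apply, map_add, map_smul, _root_.smul_apply]
    module
  simp only [curv, curvFields, extCov, extCovFields, covEnd, wedgeSq]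
  rw [key _ _ hu hv _ hw, key _ _ hv hu _ hw, vary_apply]
  simp only [FiberBundle.extend_apply_self]
  module

end Pointwise

/-! ### Dual frames and inner products of forms -/

/-- `X'` and `X` are dual frames of an inner product space. -/
def DualFrames {T κ : Type*} [NormedAddCommGroup T] [InnerProductSpace ℝ T] [Fintype κ]
    (X' X : κ → T) : Prop :=
  ∀ u, u = ∑ i, inner ℝ (X' i) u • X i

section DualFrames

variable {T κ : Type*} [NormedAddCommGroup T] [InnerProductSpace ℝ T] [Fintype κ]

theorem OrthonormalBasis.dualFrames (b : OrthonormalBasis κ ℝ T) : DualFrames b b :=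
  fun u ↦ (b.sum_repr' u).symm

theorem DualFrames.map {T₂ : Type*} [NormedAddCommGroup T₂] [InnerProductSpace ℝ T₂]
    {X' X : κ → T} (h : DualFrames X' X) (e : T ≃ₗᵢ[ℝ] T₂) :
    DualFrames (fun i ↦ e (X' i)) fun i ↦ e (X i) := by
  intro u
  obtain ⟨u, rfl⟩ := e.surjective u
  conv_lhs => rw [h u, map_sum]
  simp only [map_smul, LinearIsometryEquiv.inner_map_map]

/-- Both sides are the metric trace of f: expand one b i in X, then reassemble X' j from its
b-components. This frees the inner products of forms from the pointwise chosen orthonormal bases,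
which need not vary continuously, and allows smooth frames. -/
theorem sum_orthonormal_eq_sum_dual {ι : Type*} [Fintype ι] (b : OrthonormalBasis ι ℝ T)
    {X' X : κ → T} (h : DualFrames X' X) (f : T →ₗ[ℝ] T →ₗ[ℝ] ℝ) :
    ∑ i, f (b i) (b i) = ∑ i, f (X' i) (X i) := by
  have h1 : ∀ i, f (b i) (b i) = ∑ j, f (inner ℝ (b i) (X' j) • b i) (X j) := by
    intro i
    conv_lhs => arg 2; rw [h (b i)]
    rw [map_sum]
    refine Finset.sum_congr rfl fun j _ ↦ ?_
    rw [map_smul, map_smul, real_inner_comm, LinearMap.smul_apply]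
  simp only [h1]
  rw [Finset.sum_comm]
  refine Finset.sum_congr rfl fun j _ ↦ ?_
  rw [← LinearMap.sum_apply, ← map_sum, b.sum_repr' (X' j)]

end DualFrames

section FormInner

variable {m n : ℕ} {M : Type*} [TopologicalSpace M] [ChartedSpace (Euc m) M]
  [IsManifold (𝓡 m) ∞ M]
  {V : M → Type*} [TopologicalSpace (TotalSpace (Euc n) V)]
  [∀ x, NormedAddCommGroup (V x)] [∀ x, InnerProductSpace ℝ (V x)]
  [FiberBundle (Euc n) V] [VectorBundle ℝ (Euc n) V]
  [RiemannianBundle (fun x : M ↦ TangentSpace (𝓡 m) x)]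

variable (n) in
/-- The inner product at `x` of one-forms with values in the endomorphisms of `Vₓ`. -/
def oneInner (x : M) (A B : TangentSpace (𝓡 m) x →L[ℝ] V x →L[ℝ] V x) : ℝ :=
  have : FiniteDimensional ℝ (V x) := VectorBundle.finiteDimensional ℝ (Euc n) V x
  have : FiniteDimensional ℝ (TangentSpace (𝓡 m) x) :=
    inferInstanceAs (FiniteDimensional ℝ (Euc m))
  let b := stdOrthonormalBasis ℝ (TangentSpace (𝓡 m) x)
  let e := stdOrthonormalBasis ℝ (V x)
  ∑ i, ∑ a, inner ℝ (A (b i) (e a)) (B (b i) (e a))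

/-- The trace identity is applied in one slot at a time; the reorderings only bring the relevant sum
innermost. -/
theorem formInner_eq_sum {x : M} {A B : TangentSpace (𝓡 m) x → TangentSpace (𝓡 m) x → V x → V x}
    (hA : Trilinear A) (hB : Trilinear B) {κ ι : Type*} [Fintype κ] [Fintype ι]
    {X' X : κ → TangentSpace (𝓡 m) x} (hX : DualFrames X' X) {s' s : ι → V x}
    (hs : DualFrames s' s) :
    formInner n x A B = ∑ i, ∑ j, ∑ a, inner ℝ (A (X' i) (X' j) (s' a)) (B (X i) (X j) (s a)) := by
  obtain ⟨A, rfl⟩ := hA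
  obtain ⟨B, rfl⟩ := hB
  have : FiniteDimensional ℝ (V x) := VectorBundle.finiteDimensional ℝ (Euc n) V x
  have : FiniteDimensional ℝ (TangentSpace (𝓡 m) x) :=
    inferInstanceAs (FiniteDimensional ℝ (Euc m))
  let b := stdOrthonormalBasis ℝ (TangentSpace (𝓡 m) x)
  let e := stdOrthonormalBasis ℝ (V x)
  have h3 (u v u' v') : ∑ a, inner ℝ (A u v (e a)) (B u' v' (e a)) =
      ∑ a, inner ℝ (A u v (s' a)) (B u' v' (s a)) :=
    sum_orthonormal_eq_sum_dual e hs ((innerₗ (V x)).compl₁₂ (A u v) (B u' v'))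
  have h2 (u u' w w') : ∑ j, inner ℝ (A u (b j) w) (B u' (b j) w') =
      ∑ j, inner ℝ (A u (X' j) w) (B u' (X j) w') :=
    sum_orthonormal_eq_sum_dual b hX
      ((innerₗ (V x)).compl₁₂ ((A u).flip w) ((B u').flip w'))
  have h1 (v v' w w') : ∑ j, inner ℝ (A (b j) v w) (B (b j) v' w') =
      ∑ j, inner ℝ (A (X' j) v w) (B (X j) v' w') :=
    sum_orthonormal_eq_sum_dual b hX
      ((innerₗ (V x)).compl₁₂ ((A.flip v).flip w) ((B.flip v').flip w'))
  calc formInner n x (fun u v w ↦ A u v w) (fun u v w ↦ B u v w)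
      = ∑ i, ∑ j, ∑ a, inner ℝ (A (b i) (b j) (e a)) (B (b i) (b j) (e a)) := rfl
    _ = ∑ i, ∑ j, ∑ a, inner ℝ (A (b i) (b j) (s' a)) (B (b i) (b j) (s a)) := by
      simp only [h3]
    _ = ∑ i, ∑ a, ∑ j, inner ℝ (A (b i) (b j) (s' a)) (B (b i) (b j) (s a)) :=
      Finset.sum_congr rfl fun i _ ↦ Finset.sum_comm
    _ = ∑ i, ∑ a, ∑ j, inner ℝ (A (b i) (X' j) (s' a)) (B (b i) (X j) (s a)) := by
      simp only [h2]
    _ = ∑ i, ∑ j, ∑ a, inner ℝ (A (b i) (X' j) (s' a)) (B (b i) (X j) (s a)) :=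
      Finset.sum_congr rfl fun i _ ↦ Finset.sum_comm
    _ = ∑ j, ∑ a, ∑ i, inner ℝ (A (b i) (X' j) (s' a)) (B (b i) (X j) (s a)) := by
      rw [Finset.sum_comm]
      exact Finset.sum_congr rfl fun j _ ↦ Finset.sum_comm
    _ = ∑ j, ∑ a, ∑ i, inner ℝ (A (X' i) (X' j) (s' a)) (B (X i) (X j) (s a)) := by
      simp only [h1]
    _ = ∑ i, ∑ j, ∑ a, inner ℝ (A (X' i) (X' j) (s' a)) (B (X i) (X j) (s a)) := by
      rw [Finset.sum_comm]
      conv_rhs => rw [Finset.sum_comm]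
      rw [Finset.sum_comm]
      exact Finset.sum_congr rfl fun j _ ↦ Finset.sum_comm

theorem oneInner_eq_sum {x : M} (A B : TangentSpace (𝓡 m) x →L[ℝ] V x →L[ℝ] V x)
    {κ ι : Type*} [Fintype κ] [Fintype ι]
    {X' X : κ → TangentSpace (𝓡 m) x} (hX : DualFrames X' X) {s' s : ι → V x}
    (hs : DualFrames s' s) :
    oneInner n x A B = ∑ i, ∑ a, inner ℝ (A (X' i) (s' a)) (B (X i) (s a)) := by
  have : FiniteDimensional ℝ (V x) := VectorBundle.finiteDimensional ℝ (Euc n) V x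
  have : FiniteDimensional ℝ (TangentSpace (𝓡 m) x) :=
    inferInstanceAs (FiniteDimensional ℝ (Euc m))
  let b := stdOrthonormalBasis ℝ (TangentSpace (𝓡 m) x)
  let e := stdOrthonormalBasis ℝ (V x)
  have h3 (u u') : ∑ a, inner ℝ (A u (e a)) (B u' (e a)) =
      ∑ a, inner ℝ (A u (s' a)) (B u' (s a)) :=
    sum_orthonormal_eq_sum_dual e hs ((innerₗ (V x)).compl₁₂ (A u).toLinearMap (B u').toLinearMap)
  have h2 (w w') : ∑ j, inner ℝ (A (b j) w) (B (b j) w') =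
      ∑ j, inner ℝ (A (X' j) w) (B (X j) w') :=
    sum_orthonormal_eq_sum_dual b hX
      ((innerₗ (V x)).compl₁₂ (A.flip w).toLinearMap (B.flip w').toLinearMap)
  calc oneInner n x A B
      = ∑ i, ∑ a, inner ℝ (A (b i) (e a)) (B (b i) (e a)) := rfl
    _ = ∑ i, ∑ a, inner ℝ (A (b i) (s' a)) (B (b i) (s a)) := by
      simp only [h3]
    _ = ∑ a, ∑ i, inner ℝ (A (b i) (s' a)) (B (b i) (s a)) := Finset.sum_comm
    _ = ∑ a, ∑ i, inner ℝ (A (X' i) (s' a)) (B (X i) (s a)) := by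
      simp only [h2]
    _ = _ := Finset.sum_comm

theorem oneInner_comm {x : M} (A B : TangentSpace (𝓡 m) x →L[ℝ] V x →L[ℝ] V x) :
    oneInner n x A B = oneInner n x B A := by
  simp only [oneInner]
  exact Finset.sum_congr rfl fun i _ ↦ Finset.sum_congr rfl fun a _ ↦ real_inner_comm _ _

theorem oneInner_sub_left {x : M} (A B C : TangentSpace (𝓡 m) x →L[ℝ] V x →L[ℝ] V x) :
    oneInner n x (A - B) C = oneInner n x A C - oneInner n x B C := by
  simp only [oneInner, ← Finset.sum_sub_distrib, ← inner_sub_left]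
  rfl

theorem oneInner_self_nonneg {x : M} (A : TangentSpace (𝓡 m) x →L[ℝ] V x →L[ℝ] V x) :
    0 ≤ oneInner n x A A :=
  Finset.sum_nonneg fun _ _ ↦ Finset.sum_nonneg fun _ _ ↦ real_inner_self_nonneg

theorem oneInner_zero_left {x : M} (A : TangentSpace (𝓡 m) x →L[ℝ] V x →L[ℝ] V x) :
    oneInner n x 0 A = 0 := by
  simp [oneInner]

theorem eq_zero_of_oneInner_self {x : M} {A : TangentSpace (𝓡 m) x →L[ℝ] V x →L[ℝ] V x}
    (h : oneInner n x A A = 0) : A = 0 := by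
  have : FiniteDimensional ℝ (V x) := VectorBundle.finiteDimensional ℝ (Euc n) V x
  have : FiniteDimensional ℝ (TangentSpace (𝓡 m) x) :=
    inferInstanceAs (FiniteDimensional ℝ (Euc m))
  let b := stdOrthonormalBasis ℝ (TangentSpace (𝓡 m) x)
  let e := stdOrthonormalBasis ℝ (V x)
  have h1 : ∑ i, ∑ a, inner ℝ (A (b i) (e a)) (A (b i) (e a)) = 0 := h
  have h2 : ∀ i a, A (b i) (e a) = 0 := by
    intro i a
    rw [Finset.sum_eq_zero_iff_of_nonneg
      fun _ _ ↦ Finset.sum_nonneg fun _ _ ↦ real_inner_self_nonneg] at h1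
    have h3 := h1 i (Finset.mem_univ i)
    rw [Finset.sum_eq_zero_iff_of_nonneg fun _ _ ↦ real_inner_self_nonneg] at h3
    exact inner_self_eq_zero.1 (h3 a (Finset.mem_univ a))
  ext u w
  rw [← b.sum_repr' u, ← e.sum_repr' w]
  simp [h2]

theorem formInner_comm {x : M} (A B : TangentSpace (𝓡 m) x → TangentSpace (𝓡 m) x → V x → V x) :
    formInner n x A B = formInner n x B A := by
  simp only [formInner]
  exact Finset.sum_congr rfl fun i _ ↦ Finset.sum_congr rfl fun j _ ↦
    Finset.sum_congr rfl fun a _ ↦ real_inner_comm _ _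

theorem formInner_add_right {x : M}
    (A B C : TangentSpace (𝓡 m) x → TangentSpace (𝓡 m) x → V x → V x) :
    formInner n x A (fun u v w ↦ B u v w + C u v w) = formInner n x A B + formInner n x A C := by
  simp only [formInner, inner_add_right, Finset.sum_add_distrib]

theorem formInner_smul_right {x : M} (c : ℝ)
    (A B : TangentSpace (𝓡 m) x → TangentSpace (𝓡 m) x → V x → V x) :
    formInner n x A (fun u v w ↦ c • B u v w) = c * formInner n x A B := by
  simp only [formInner, inner_smul_right, Finset.mul_sum]

theorem formInner_add_smul_add_smul {x : M} (t : ℝ)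
    (A B C : TangentSpace (𝓡 m) x → TangentSpace (𝓡 m) x → V x → V x) :
    formInner n x (fun u v w ↦ A u v w + t • B u v w + t ^ 2 • C u v w)
      (fun u v w ↦ A u v w + t • B u v w + t ^ 2 • C u v w) =
    formInner n x A A + t * (2 * formInner n x A B) +
      t ^ 2 * (formInner n x B B + 2 * formInner n x A C) + t ^ 3 * (2 * formInner n x B C) +
      t ^ 4 * formInner n x C C := by
  have h (S) : formInner n x S (fun u v w ↦ A u v w + t • B u v w + t ^ 2 • C u v w) =
      formInner n x S A + t * formInner n x S B + t ^ 2 * formInner n x S C := by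
    rw [formInner_add_right, formInner_add_right, formInner_smul_right, formInner_smul_right]
  rw [h, formInner_comm _ A, formInner_comm _ B, formInner_comm _ C, h, h, h,
    formInner_comm B A, formInner_comm C A, formInner_comm C B]
  ring

/-- Inner products of two-forms are preserved by isometries. -/
theorem formInner_map {x y : M} (f : TangentSpace (𝓡 m) x →ₗᵢ[ℝ] TangentSpace (𝓡 m) y)
    (l : V x →ₗᵢ[ℝ] V y) {A B : TangentSpace (𝓡 m) x → TangentSpace (𝓡 m) x → V x → V x}
    {A' B' : TangentSpace (𝓡 m) y → TangentSpace (𝓡 m) y → V y → V y}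
    (hA' : Trilinear A') (hB' : Trilinear B')
    (hA : ∀ u v w, A' (f u) (f v) (l w) = l (A u v w))
    (hB : ∀ u v w, B' (f u) (f v) (l w) = l (B u v w)) :
    formInner n y A' B' = formInner n x A B := by
  have hV : ∀ x, FiniteDimensional ℝ (V x) := fun x ↦
    VectorBundle.finiteDimensional ℝ (Euc n) V x
  have hT : ∀ x : M, FiniteDimensional ℝ (TangentSpace (𝓡 m) x) := fun x ↦
    inferInstanceAs (FiniteDimensional ℝ (Euc m))
  let b := stdOrthonormalBasis ℝ (TangentSpace (𝓡 m) x)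
  let e := stdOrthonormalBasis ℝ (V x)
  have hb := (OrthonormalBasis.dualFrames b).map (f.toLinearIsometryEquiv rfl)
  have he := (OrthonormalBasis.dualFrames e).map (l.toLinearIsometryEquiv
    (by rw [VectorBundle.finrank_eq ℝ (Euc n) V, VectorBundle.finrank_eq ℝ (Euc n) V]))
  rw [formInner_eq_sum hA' hB' hb he]
  exact Finset.sum_congr rfl fun i _ ↦ Finset.sum_congr rfl fun j _ ↦ Finset.sum_congr rfl fun a _ ↦
    (congrArg₂ (inner ℝ) (hA _ _ _) (hB _ _ _)).trans (l.inner_map_map _ _)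

/-- Inner products of one-forms are preserved by isometries. -/
theorem oneInner_map {x y : M} (f : TangentSpace (𝓡 m) x →ₗᵢ[ℝ] TangentSpace (𝓡 m) y)
    (l : V x →ₗᵢ[ℝ] V y) {A B : TangentSpace (𝓡 m) x →L[ℝ] V x →L[ℝ] V x}
    {A' B' : TangentSpace (𝓡 m) y →L[ℝ] V y →L[ℝ] V y}
    (hA : ∀ u w, A' (f u) (l w) = l (A u w)) (hB : ∀ u w, B' (f u) (l w) = l (B u w)) :
    oneInner n y A' B' = oneInner n x A B := by
  have hV : ∀ x, FiniteDimensional ℝ (V x) := fun x ↦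
    VectorBundle.finiteDimensional ℝ (Euc n) V x
  have hT : ∀ x : M, FiniteDimensional ℝ (TangentSpace (𝓡 m) x) := fun x ↦
    inferInstanceAs (FiniteDimensional ℝ (Euc m))
  let b := stdOrthonormalBasis ℝ (TangentSpace (𝓡 m) x)
  let e := stdOrthonormalBasis ℝ (V x)
  have hb := (OrthonormalBasis.dualFrames b).map (f.toLinearIsometryEquiv rfl)
  have he := (OrthonormalBasis.dualFrames e).map (l.toLinearIsometryEquiv
    (by rw [VectorBundle.finrank_eq ℝ (Euc n) V, VectorBundle.finrank_eq ℝ (Euc n) V]))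
  rw [oneInner_eq_sum _ _ hb he]
  exact Finset.sum_congr rfl fun i _ ↦ Finset.sum_congr rfl fun a _ ↦
    (congrArg₂ (inner ℝ) (hA _ _) (hB _ _)).trans (l.inner_map_map _ _)

end FormInner

/-! ### Smooth dual frames -/

section ExistsDual

open Filter Topology

variable {m : ℕ} {M : Type*} [TopologicalSpace M] [ChartedSpace (Euc m) M]
  [IsManifold (𝓡 m) ∞ M]
  {F : Type*} [NormedAddCommGroup F] [NormedSpace ℝ F]
  {W : M → Type*} [TopologicalSpace (TotalSpace F W)]
  [∀ x, NormedAddCommGroup (W x)] [∀ x, InnerProductSpace ℝ (W x)]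
  [FiberBundle F W] [VectorBundle ℝ F W] [ContMDiffVectorBundle ∞ F W (𝓡 m)]
  [IsContMDiffRiemannianBundle (𝓡 m) ∞ F W]

theorem SmoothNear.inner {σ τ : ∀ x, W x} {x : M} (hσ : SmoothNear m F σ x)
    (hτ : SmoothNear m F τ x) : SmoothFnNear m (fun y ↦ inner ℝ (σ y) (τ y)) x := by
  filter_upwards [hσ, hτ] with y h1 h2
  exact ContMDiffAt.inner_bundle h1 h2

theorem SmoothSec.inner {σ τ : ∀ x, W x} (hσ : SmoothSec m F σ) (hτ : SmoothSec m F τ) :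
    ContMDiff (𝓡 m) 𝓘(ℝ) ∞ (fun y ↦ inner ℝ (σ y) (τ y)) :=
  ContMDiff.inner_bundle hσ hτ

/-- A smooth local frame has a smooth dual frame. -/
theorem exists_dual_of_frame {d : ℕ} {s : Fin d → ∀ y, W y} {x : M}
    (hs : ∀ i, SmoothNear m F (s i) x)
    (hf : ∀ᶠ y in 𝓝 x, LinearIndependent ℝ (fun i ↦ s i y) ∧
      ⊤ ≤ Submodule.span ℝ (Set.range fun i ↦ s i y)) :
    ∃ s' : Fin d → ∀ y, W y, (∀ i, SmoothNear m F (s' i) x) ∧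
      ∀ᶠ y in 𝓝 x, DualFrames (fun i ↦ s' i y) fun i ↦ s i y := by
  classical
  -- The Gram operator of the frame. Its inverse, which is smooth because inversion of operators is,
  -- gives the coefficients of the dual frame.
  let g (y : M) : Euc d →L[ℝ] Euc d := LinearMap.toContinuousLinearMap
    (Matrix.toLpLin 2 2 (Matrix.of fun i j ↦ inner ℝ (s i y) (s j y)))
  have hg (y : M) (v : Euc d) (i : Fin d) : g y v i = inner ℝ (s i y) (∑ j, v j • s j y) := by
    simp only [g, LinearMap.coe_toContinuousLinearMap', Matrix.toLpLin_apply,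
      Matrix.mulVec, dotProduct, Matrix.of_apply, inner_sum, inner_smul_right]
    exact Finset.sum_congr rfl fun j _ ↦ mul_comm _ _
  have hgs : ∀ᶠ y in 𝓝 x, ContMDiffAt (𝓡 m) 𝓘(ℝ, Euc d →L[ℝ] Euc d) ∞ g y := by
    have : ∀ᶠ y in 𝓝 x, ∀ i, SmoothNear m F (s i) y :=
      eventually_all.2 fun i ↦ (hs i).eventually
    filter_upwards [this] with y hy
    refine contMDiffAt_clm fun v ↦ ?_
    have e : (fun z ↦ g z v) = fun z ↦ (EuclideanSpace.equiv (Fin d) ℝ).symm (fun i ↦ ∑ j, v j *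
        inner ℝ (s i z) (s j z)) := by
      ext z i
      rw [hg]
      simp [inner_sum, inner_smul_right]
    rw [e]
    refine (ContinuousLinearMap.contMDiff
      ((EuclideanSpace.equiv (Fin d) ℝ).symm : (Fin d → ℝ) →L[ℝ] Euc d)).contMDiffAt.comp y ?_
    refine contMDiffAt_pi_space.2 fun i ↦ ContMDiffAt.sum fun j _ ↦ ?_
    exact (contMDiff_const (c := v j)).contMDiffAt.mul (((hy i).inner (hy j)).self_of_nhds)
  have hinv : ∀ᶠ y in 𝓝 x, ∃ e : Euc d ≃L[ℝ] Euc d, (e : Euc d →L[ℝ] Euc d) = g y := by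
    filter_upwards [hf] with y hy
    have hinj : Function.Injective (g y).toLinearMap := by
      rw [← LinearMap.ker_eq_bot, LinearMap.ker_eq_bot']
      intro v hv
      have h0 : ∀ i, inner ℝ (s i y) (∑ j, v j • s j y) = 0 := fun i ↦ by
        rw [← hg]
        exact congrArg (fun w : Euc d ↦ w i) hv
      -- A kernel vector v of the Gram operator gives a combination of the frame that is orthogonal
      -- to itself.
      have h1 : inner ℝ (∑ j, v j • s j y) (∑ j, v j • s j y) = 0 := by
        conv_lhs => rw [sum_inner]
        simp only [inner_smul_left, h0, mul_zero, Finset.sum_const_zero]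
      ext i
      exact Fintype.linearIndependent_iff.1 hy.1 v (inner_self_eq_zero.1 h1) i
    exact ⟨(LinearEquiv.ofInjectiveEndo _ hinj).toContinuousLinearEquiv, by ext; rfl⟩
  refine ⟨fun i y ↦ ∑ j, (g y).inverse (EuclideanSpace.single i 1) j • s j y, fun i ↦ ?_, ?_⟩
  · refine SmoothNear.sum fun j _ ↦ SmoothNear.smul ?_ (hs j)
    filter_upwards [hgs, hinv] with y hy ⟨e, he⟩
    have h1 : ContMDiffAt (𝓡 m) 𝓘(ℝ, Euc d →L[ℝ] Euc d) ∞ (fun z ↦ (g z).inverse) y := by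
      have h := contDiffAt_map_inverse (n := ∞) e
      rw [he] at h
      exact h.contMDiffAt.comp y hy
    have h2 : ContMDiffAt (𝓡 m) 𝓘(ℝ, Euc d) ∞
        (fun z ↦ (g z).inverse (EuclideanSpace.single i 1)) y := h1.clm_apply contMDiffAt_const
    exact (EuclideanSpace.proj j : Euc d →L[ℝ] ℝ).contMDiff.contMDiffAt.comp y h2
  · filter_upwards [hf, hinv] with y hy ⟨e, he⟩ u
    have h1 (i k : Fin d) : inner ℝ (∑ j, (g y).inverse (EuclideanSpace.single i 1) j • s j y)
        (s k y) = (EuclideanSpace.single i (1 : ℝ) : Euc d) k := by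
      rw [real_inner_comm, ← hg, ← he, ContinuousLinearMap.inverse_equiv]
      simp
    obtain ⟨c, hc⟩ := (Submodule.mem_span_range_iff_exists_fun ℝ).1 (hy.2 (Submodule.mem_top (x := u)))
    conv_lhs => rw [← hc]
    refine Finset.sum_congr rfl fun i _ ↦ ?_
    rw [← hc, inner_sum]
    simp only [inner_smul_right, h1]
    simp

variable (W) in
theorem exists_dual_frames [T2Space M] [FiniteDimensional ℝ F] (x : M) :
    ∃ s' s : Fin (Module.finrank ℝ F) → ∀ y, W y, (∀ i, SmoothSec m F (s' i)) ∧
      (∀ i, SmoothSec m F (s i)) ∧ ∀ᶠ y in 𝓝 x, DualFrames (fun i ↦ s' i y) fun i ↦ s i y := by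
  let e := trivializationAt F W x
  let b := Module.finBasis ℝ F
  have hx : x ∈ e.baseSet := FiberBundle.mem_baseSet_trivializationAt F W x
  have hs (i) : SmoothNear m F (e.localFrame b i) x := by
    filter_upwards [e.open_baseSet.mem_nhds hx] with y hy
    exact contMDiffAt_localFrame_of_mem ∞ e b i hy
  have hL := e.isLocalFrameOn_localFrame_baseSet (𝓡 m) ∞ b
  obtain ⟨s', hs', hd⟩ := exists_dual_of_frame hs
    (by filter_upwards [e.open_baseSet.mem_nhds hx] with y hy
        exact ⟨hL.linearIndependent hy, hL.generating hy⟩)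
  choose t' ht' he' using fun i ↦ exists_global_section (hs' i)
  choose t ht he using fun i ↦ exists_global_section (hs i)
  refine ⟨t', t, ht', ht, ?_⟩
  filter_upwards [hd, eventually_all.2 he, eventually_all.2 he'] with y h1 h2 h3
  simpa only [h2, h3] using h1

end ExistsDual

/-! ### Coordinate vector fields -/

section Coordinates

open Filter Topology VectorField

variable {m : ℕ} {M : Type*} [TopologicalSpace M] [ChartedSpace (Euc m) M]
  [IsManifold (𝓡 m) ∞ M]

/-- The coordinate vector field `∂ᵢ` of the chart around `x`, as a vector field on `M`. -/
def coordField (x : M) (i : Fin m) : ∀ y : M, TangentSpace (𝓡 m) y :=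
  mpullback (𝓡 m) 𝓘(ℝ, Euc m) (extChartAt (𝓡 m) x) fun _ ↦ EuclideanSpace.single i (1 : ℝ)

theorem coordField_eq {x y : M} {E : TangentSpace (𝓡 m) y ≃L[ℝ] Euc m}
    (hE : (E : TangentSpace (𝓡 m) y →L[ℝ] Euc m) = mvfderiv (𝓡 m) (extChartAt (𝓡 m) x) y)
    (i : Fin m) : coordField x i y = E.symm (EuclideanSpace.single i 1) := by
  have h : (E : TangentSpace (𝓡 m) y →L[ℝ] Euc m).inverse = E.symm :=
    ContinuousLinearMap.inverse_equiv E
  rw [hE] at h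
  exact congrArg (fun T : Euc m →L[ℝ] TangentSpace (𝓡 m) y ↦ T (EuclideanSpace.single i (1 : ℝ))) h

theorem exists_chart_equiv {x y : M} (hy : y ∈ (extChartAt (𝓡 m) x).source) :
    ∃ E : TangentSpace (𝓡 m) y ≃L[ℝ] Euc m,
      (E : TangentSpace (𝓡 m) y →L[ℝ] Euc m) = mvfderiv (𝓡 m) (extChartAt (𝓡 m) x) y :=
  isInvertible_mfderiv_extChartAt hy

theorem mvfderiv_chart_coordField {x y : M} (hy : y ∈ (extChartAt (𝓡 m) x).source) (i : Fin m) :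
    mvfderiv (𝓡 m) (extChartAt (𝓡 m) x) y (coordField x i y) = EuclideanSpace.single i 1 := by
  obtain ⟨E, hE⟩ := exists_chart_equiv hy
  rw [coordField_eq hE, ← hE]
  simp

theorem eventually_mem_extChartAt_source {x y : M} (hy : y ∈ (extChartAt (𝓡 m) x).source) :
    ∀ᶠ z in 𝓝 y, z ∈ (extChartAt (𝓡 m) x).source :=
  (isOpen_extChartAt_source (I := 𝓡 m) x).mem_nhds hy

theorem contMDiffAt_const_field (v z : Euc m) :
    ContMDiffAt 𝓘(ℝ, Euc m) (𝓘(ℝ, Euc m).prod 𝓘(ℝ, Euc m)) ∞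
      (fun w ↦ TotalSpace.mk' (Euc m) (E := TangentSpace 𝓘(ℝ, Euc m)) w v) z :=
  contMDiffAt_vectorSpace_iff_contDiffAt.2 (contDiffAt_const (c := v))

theorem coordField_smoothNear {x y : M} (hy : y ∈ (extChartAt (𝓡 m) x).source) (i : Fin m) :
    SmoothNear m (Euc m) (coordField x i) y := by
  filter_upwards [eventually_mem_extChartAt_source hy] with z hz
  refine ContMDiffAt.mpullback_vectorField_preimage (n := ∞) ?_
    (contMDiffAt_extChartAt' (by rwa [← extChartAt_source (I := 𝓡 m)]))
    (isInvertible_mfderiv_extChartAt hz) (by simp)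
  exact contMDiffAt_const_field _ _

/-- Pullback commutes with brackets, and constant fields on Euclidean space commute. -/
theorem coordField_bracket {x y : M} (hy : y ∈ (extChartAt (𝓡 m) x).source) (i j : Fin m) :
    mlieBracket (𝓡 m) (coordField x i) (coordField x j) y = 0 := by
  have hc (k : Fin m) (z : Euc m) : MDifferentiableAt 𝓘(ℝ, Euc m) (𝓘(ℝ, Euc m).prod 𝓘(ℝ, Euc m))
      (fun w ↦ TotalSpace.mk' (Euc m) (E := TangentSpace 𝓘(ℝ, Euc m)) w
        (EuclideanSpace.single k (1 : ℝ))) z :=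
    (contMDiffAt_const_field _ _).mdifferentiableAt (by simp)
  have : IsManifold (𝓡 m) (minSmoothness ℝ 3) M :=
    IsManifold.of_le (n := ∞) (by simpa using ENat.LEInfty.out)
  have h := mpullback_mlieBracket (I := 𝓡 m) (I' := 𝓘(ℝ, Euc m)) (n := ∞) (x₀ := y)
    (hc i (extChartAt (𝓡 m) x y)) (hc j (extChartAt (𝓡 m) x y))
    (contMDiffAt_extChartAt' (by rwa [← extChartAt_source (I := 𝓡 m)]))
    (by simpa using ENat.LEInfty.out)
  have h0 (V W : ∀ z : Euc m, TangentSpace 𝓘(ℝ, Euc m) z) (z : Euc m)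
      (h : lieBracket ℝ V W z = 0) : mlieBracket 𝓘(ℝ, Euc m) V W z = 0 := by
    rw [← mlieBracketWithin_univ, mlieBracketWithin_eq_lieBracketWithin]
    exact (congrFun (lieBracketWithin_univ (V := V)) z).trans h
  refine h.symm.trans ?_
  refine (congrArg (mfderiv (𝓡 m) 𝓘(ℝ, Euc m) (extChartAt (𝓡 m) x) y).inverse
    (h0 _ _ _ ?_)).trans (map_zero _)
  change fderiv ℝ (fun _ : Euc m ↦ (EuclideanSpace.single j (1 : ℝ) : Euc m)) _ _ -
    fderiv ℝ (fun _ : Euc m ↦ (EuclideanSpace.single i (1 : ℝ) : Euc m)) _ _ = 0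
  simp

theorem coordField_frame {x y : M} (hy : y ∈ (extChartAt (𝓡 m) x).source) :
    LinearIndependent ℝ (fun i : Fin m ↦ coordField x i y) ∧
      ⊤ ≤ Submodule.span ℝ (Set.range fun i : Fin m ↦ coordField x i y) := by
  obtain ⟨E, hE⟩ := exists_chart_equiv hy
  let b := (EuclideanSpace.basisFun (Fin m) ℝ).toBasis.map E.symm.toLinearEquiv
  have hb : (fun i : Fin m ↦ coordField x i y) = b := by
    ext1 i
    rw [coordField_eq hE]
    simp [b]
  rw [hb]
  exact ⟨b.linearIndependent, b.span_eq.ge⟩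

theorem mvfderiv_coordField {F : Type*} [NormedAddCommGroup F] [NormedSpace ℝ F]
    {f : M → F} {x y : M} (hy : y ∈ (extChartAt (𝓡 m) x).source)
    (hf : MDifferentiableAt (𝓡 m) 𝓘(ℝ, F) f y) (i : Fin m) :
    mvfderiv (𝓡 m) f y (coordField x i y) =
      fderiv ℝ (f ∘ (extChartAt (𝓡 m) x).symm) (extChartAt (𝓡 m) x y)
        (EuclideanSpace.single i 1) := by
  rw [mvfderiv_eq_fderiv_chart hy hf, mvfderiv_chart_coordField hy]

theorem mfderiv_chart_symm {x y : M} (hy : y ∈ (extChartAt (𝓡 m) x).source)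
    {E : TangentSpace (𝓡 m) y ≃L[ℝ] Euc m}
    (hE : (E : TangentSpace (𝓡 m) y →L[ℝ] Euc m) = mvfderiv (𝓡 m) (extChartAt (𝓡 m) x) y)
    (v : Euc m) :
    (mfderiv 𝓘(ℝ, Euc m) (𝓡 m) (extChartAt (𝓡 m) x).symm (extChartAt (𝓡 m) x y) v : Euc m) =
      (E.symm v : TangentSpace (𝓡 m) y) := by
  set φ := extChartAt (𝓡 m) x with hφ
  have h1 := mfderivWithin_extChartAt_symm_comp_mfderiv_extChartAt' (I := 𝓡 m) hy
  rw [ModelWithCorners.range_eq_univ, mfderivWithin_univ] at h1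
  have h2 := congrArg (fun T : TangentSpace (𝓡 m) y →L[ℝ] TangentSpace (𝓡 m) y ↦ T (E.symm v)) h1
  have h3 : mvfderiv (𝓡 m) φ y (E.symm v) = v := by rw [← hE]; simp
  refine Eq.trans ?_ h2
  exact congrArg (fun w : Euc m ↦ (mfderiv 𝓘(ℝ, Euc m) (𝓡 m) φ.symm (φ y) w : Euc m)) h3.symm

theorem coordVec_eq {x : M} {z : Euc m} (hz : z ∈ (extChartAt (𝓡 m) x).target) (i : Fin m) :
    coordVec x z i = coordField x i ((extChartAt (𝓡 m) x).symm z) := by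
  have hy := (extChartAt (𝓡 m) x).map_target hz
  obtain ⟨E, hE⟩ := exists_chart_equiv hy
  rw [coordField_eq hE, ← mfderiv_chart_symm hy hE]
  exact congrArg (fun w : Euc m ↦ (mfderiv 𝓘(ℝ, Euc m) (𝓡 m) (extChartAt (𝓡 m) x).symm w
    (EuclideanSpace.single i (1 : ℝ)) : Euc m)) ((extChartAt (𝓡 m) x).right_inv hz).symm

variable [RiemannianBundle (fun x : M ↦ TangentSpace (𝓡 m) x)]

variable (m) in
/-- `√(det (gᵢⱼ))` in the chart around `x`, as a function on `M`. -/
def coordDensity (x y : M) : ℝ :=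
  √(Matrix.gram ℝ fun i : Fin m ↦ coordField x i y).det

theorem chartDensity_eq {x : M} {z : Euc m} (hz : z ∈ (extChartAt (𝓡 m) x).target) :
    chartDensity x z = coordDensity m x ((extChartAt (𝓡 m) x).symm z) := by
  simp only [chartDensity, coordDensity, coordVec_eq hz]
  rfl

theorem gram_det_pos {x y : M} (hy : y ∈ (extChartAt (𝓡 m) x).source) :
    0 < (Matrix.gram ℝ fun i : Fin m ↦ coordField x i y).det :=
  (Matrix.posDef_gram_of_linearIndependent (coordField_frame hy).1).det_pos

theorem coordDensity_pos {x y : M} (hy : y ∈ (extChartAt (𝓡 m) x).source) :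
    0 < coordDensity m x y :=
  Real.sqrt_pos.2 (gram_det_pos hy)

theorem coordDensity_smoothNear
    [IsContMDiffRiemannianBundle (𝓡 m) ∞ (Euc m) (fun x : M ↦ TangentSpace (𝓡 m) x)]
    {x y : M} (hy : y ∈ (extChartAt (𝓡 m) x).source) : SmoothFnNear m (coordDensity m x) y := by
  filter_upwards [eventually_mem_extChartAt_source hy] with z hz
  have h1 : ContMDiffAt (𝓡 m) 𝓘(ℝ) ∞
      (fun y ↦ (Matrix.gram ℝ fun i : Fin m ↦ coordField x i y).det) z := by
    simp only [Matrix.det_apply]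
    refine ContMDiffAt.sum fun σ _ ↦ ?_
    simp only [Units.smul_def, zsmul_eq_mul]
    refine contMDiffAt_const.mul (contMDiffAt_finsetProd fun i _ ↦ ?_)
    exact ((coordField_smoothNear hz (σ i)).inner (coordField_smoothNear hz i)).self_of_nhds
  exact (Real.contDiffAt_sqrt (gram_det_pos hz).ne').contMDiffAt.comp z h1

/-- How the Gram determinant of coordinate fields transforms. -/
theorem coordDensity_image {x y p q : M} (hp : p ∈ (extChartAt (𝓡 m) x).source)
    (hq : q ∈ (extChartAt (𝓡 m) y).source)
    (A : TangentSpace (𝓡 m) p →L[ℝ] TangentSpace (𝓡 m) q) (hA : ∀ u, ‖A u‖ = ‖u‖)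
    (B : Euc m →L[ℝ] Euc m)
    (hB : ∀ u, B (mvfderiv (𝓡 m) (extChartAt (𝓡 m) x) p u) =
      mvfderiv (𝓡 m) (extChartAt (𝓡 m) y) q (A u)) :
    coordDensity m x p = |B.det| * coordDensity m y q := by
  obtain ⟨E, hE⟩ := exists_chart_equiv hp
  obtain ⟨E', hE'⟩ := exists_chart_equiv hq
  let b := (EuclideanSpace.basisFun (Fin m) ℝ).toBasis
  let N := LinearMap.toMatrix b b B.toLinearMap
  have hN : B.det = N.det := (LinearMap.det_toMatrix b B.toLinearMap).symm
  have h1 (i : Fin m) : A (coordField x i p) = ∑ k, N k i • coordField y k q := by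
    have h2 := hB (coordField x i p)
    rw [mvfderiv_chart_coordField hp, ← hE'] at h2
    have h3 : A (coordField x i p) = E'.symm (B (EuclideanSpace.single i 1)) := by
      rw [h2]; simp
    have h4 : B (EuclideanSpace.single i 1) = ∑ k, N k i • EuclideanSpace.single k (1 : ℝ) := by
      ext k
      simp [N, LinearMap.toMatrix_apply, b, Finset.sum_apply, Pi.single_apply]
    rw [h3, h4, map_sum]
    refine Finset.sum_congr rfl fun k _ ↦ ?_
    rw [map_smul, coordField_eq hE']
  -- Since A preserves inner products, the Gram matrices are congruent by the matrix of B; taking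
  -- determinants and square roots leaves |det B|.
  have h5 : (Matrix.gram ℝ fun i : Fin m ↦ coordField x i p) =
      N.transpose * (Matrix.gram ℝ fun i : Fin m ↦ coordField y i q) * N := by
    let L : TangentSpace (𝓡 m) p →ₗᵢ[ℝ] TangentSpace (𝓡 m) q := ⟨A.toLinearMap, hA⟩
    ext i j
    have h6 : inner ℝ (coordField x i p) (coordField x j p) =
        inner ℝ (A (coordField x i p)) (A (coordField x j p)) := (L.inner_map_map _ _).symm
    rw [Matrix.gram_apply, h6, h1, h1]
    simp only [Matrix.mul_apply, Matrix.transpose_apply, Matrix.gram_apply, sum_inner, inner_sum,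
      inner_smul_left, inner_smul_right, Finset.sum_mul]
    refine Finset.sum_congr rfl fun k _ ↦ ?_
    rw [Finset.mul_sum]
    refine Finset.sum_congr rfl fun l _ ↦ ?_
    simp only [conj_trivial]
    ring
  rw [coordDensity, h5, Matrix.det_mul, Matrix.det_mul, Matrix.det_transpose, hN, coordDensity,
    ← Real.sqrt_sq_eq_abs, ← Real.sqrt_mul (sq_nonneg _)]
  congr 1
  ring

end Coordinates

/-! ### The Riemannian measure -/

section Volume

open Filter Topology Set
open scoped ENNReal

variable {m : ℕ} {M : Type*} [TopologicalSpace M] [ChartedSpace (Euc m) M]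
  [IsManifold (𝓡 m) ∞ M] [RiemannianBundle (fun x : M ↦ TangentSpace (𝓡 m) x)]
  [IsContMDiffRiemannianBundle (𝓡 m) ∞ (Euc m) (fun x : M ↦ TangentSpace (𝓡 m) x)]

theorem measurableSet_chart_target (x : M) : MeasurableSet (extChartAt (𝓡 m) x).target :=
  (isOpen_extChartAt_target x).measurableSet

theorem continuousOn_chart_symm (x : M) :
    ContinuousOn (extChartAt (𝓡 m) x).symm (extChartAt (𝓡 m) x).target :=
  continuousOn_extChartAt_symm x

theorem contMDiffAt_chart_symm {x : M} {z : Euc m} (hz : z ∈ (extChartAt (𝓡 m) x).target) :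
    ContMDiffAt 𝓘(ℝ, Euc m) (𝓡 m) ∞ (extChartAt (𝓡 m) x).symm z :=
  (contMDiffOn_extChartAt_symm x).contMDiffAt ((isOpen_extChartAt_target x).mem_nhds hz)

theorem contDiffAt_comp_chart_symm {F : Type*} [NormedAddCommGroup F] [NormedSpace ℝ F]
    {f : M → F} {x : M} {z : Euc m} (hz : z ∈ (extChartAt (𝓡 m) x).target)
    (hf : ContMDiffAt (𝓡 m) 𝓘(ℝ, F) ∞ f ((extChartAt (𝓡 m) x).symm z)) :
    ContDiffAt ℝ ∞ (f ∘ (extChartAt (𝓡 m) x).symm) z :=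
  (hf.comp z (contMDiffAt_chart_symm hz)).contDiffAt

theorem continuousOn_chartDensity (x : M) :
    ContinuousOn (chartDensity (m := m) x) (extChartAt (𝓡 m) x).target := by
  have h : ContinuousOn (coordDensity m x ∘ (extChartAt (𝓡 m) x).symm)
      (extChartAt (𝓡 m) x).target := fun z hz ↦
    ((contDiffAt_comp_chart_symm hz (coordDensity_smoothNear
      ((extChartAt (𝓡 m) x).map_target hz)).self_of_nhds).continuousAt).continuousWithinAt
  exact h.congr fun z hz ↦ chartDensity_eq hz

variable [MeasurableSpace M] [BorelSpace M]

theorem aemeasurable_chartDensity (x : M) :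
    AEMeasurable (fun z : Euc m ↦ ENNReal.ofReal (chartDensity x z))
      ((volume : Measure (Euc m)).restrict (extChartAt (𝓡 m) x).target) :=
  ((continuousOn_chartDensity x).aemeasurable (measurableSet_chart_target x)).ennreal_ofReal

theorem aemeasurable_chart_symm (x : M) : AEMeasurable (extChartAt (𝓡 m) x).symm
    ((volume : Measure (Euc m)).restrict (extChartAt (𝓡 m) x).target) :=
  (continuousOn_chart_symm x).aemeasurable (measurableSet_chart_target x)

theorem measurableSet_chart_image {x : M} {A : Set M} (hA : MeasurableSet A)
    (hAx : A ⊆ (extChartAt (𝓡 m) x).source) : MeasurableSet (extChartAt (𝓡 m) x '' A) := by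
  rw [(extChartAt (𝓡 m) x).image_eq_target_inter_inv_preimage hAx]
  have h := (continuousOn_iff_continuous_domRestrict.1 (continuousOn_chart_symm (m := m) x)).measurable hA
  rw [← Subtype.image_preimage_coe]
  exact (measurableSet_chart_target x).subtype_image h

theorem chartVol_apply {x : M} {A : Set M} (hA : MeasurableSet A)
    (hAx : A ⊆ (extChartAt (𝓡 m) x).source) :
    chartVol m x A = ∫⁻ z in extChartAt (𝓡 m) x '' A,
      ENNReal.ofReal (coordDensity m x ((extChartAt (𝓡 m) x).symm z)) := by
  have hT := measurableSet_chart_target (m := m) x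
  have hI := measurableSet_chart_image hA hAx
  have hsub : extChartAt (𝓡 m) x '' A ⊆ (extChartAt (𝓡 m) x).target :=
    (image_mono hAx).trans (extChartAt (𝓡 m) x).image_source_eq_target.subset
  have he := (extChartAt (𝓡 m) x).image_eq_target_inter_inv_preimage hAx
  rw [chartVol, Measure.map_apply_of_aemeasurable
    ((aemeasurable_chart_symm x).mono_ac (withDensity_absolutelyContinuous _ _)) hA]
  -- Outside the chart target the values of φ⁻¹ carry no information, so the two sets agree only up
  -- to a set that is null for the restricted measure.
  have hae : (extChartAt (𝓡 m) x).symm ⁻¹' A =ᵐ[((volume : Measure (Euc m)).restrict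
      (extChartAt (𝓡 m) x).target).withDensity fun z ↦ ENNReal.ofReal (chartDensity x z)]
      (extChartAt (𝓡 m) x '' A : Set (Euc m)) := by
    refine (withDensity_absolutelyContinuous _ _).ae_eq ?_
    filter_upwards [ae_restrict_mem hT] with z hz
    rw [he]
    exact propext ⟨fun h ↦ ⟨hz, h⟩, fun h ↦ h.2⟩
  rw [measure_congr hae, withDensity_apply _ hI, Measure.restrict_restrict hI,
    inter_eq_left.2 hsub]
  exact setLIntegral_congr_fun hI fun z hz ↦ by rw [chartDensity_eq (hsub hz)]

theorem chartVol_compl_source (x : M) : chartVol m x (extChartAt (𝓡 m) x).sourceᶜ = 0 := by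
  rw [chartVol, Measure.map_apply_of_aemeasurable
    ((aemeasurable_chart_symm x).mono_ac (withDensity_absolutelyContinuous _ _))
    (isOpen_extChartAt_source x).measurableSet.compl]
  refine (withDensity_absolutelyContinuous _ _) ?_
  rw [Measure.restrict_apply' (measurableSet_chart_target x)]
  convert! measure_empty (μ := (volume : Measure (Euc m)))
  ext z
  simp only [mem_inter_iff, mem_preimage, mem_compl_iff, mem_empty_iff_false, iff_false, not_and]
  intro h hz
  exact h ((extChartAt (𝓡 m) x).map_target hz)

/-- The chart measures correspond to each other under isometries. -/
theorem chartVol_image {Φ : M → M} (hΦ : ContMDiff (𝓡 m) (𝓡 m) ∞ Φ) (hinj : Function.Injective Φ)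
    (hiso : ∀ x (u : TangentSpace (𝓡 m) x), ‖mfderiv (𝓡 m) (𝓡 m) Φ x u‖ = ‖u‖) {x y : M}
    {A : Set M} (hA : MeasurableSet A) (hAx : A ⊆ (extChartAt (𝓡 m) x).source)
    (hΦA : MeasurableSet (Φ '' A)) (hAy : Φ '' A ⊆ (extChartAt (𝓡 m) y).source) :
    chartVol m y (Φ '' A) = chartVol m x A := by
  set φ := extChartAt (𝓡 m) x with hφ
  set φ' := extChartAt (𝓡 m) y with hφ'
  -- Φ in coordinates. The change of variables formula for ψ brings in |det Dψ|, which
  -- `coordDensity_image` matches with the ratio of the two densities.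
  let ψ : Euc m → Euc m := (φ' ∘ Φ) ∘ φ.symm
  have hmem : ∀ p ∈ A, Φ p ∈ φ'.source := fun p hp ↦ hAy (mem_image_of_mem Φ hp)
  have hψ : ∀ p ∈ A, ψ (φ p) = φ' (Φ p) := fun p hp ↦
    congrArg (φ' ∘ Φ) (φ.left_inv (hAx hp))
  have himg : φ' '' (Φ '' A) = ψ '' (φ '' A) := by
    rw [image_image, image_image]
    exact (image_congr hψ).symm
  have hsm : ∀ p ∈ A, ContMDiffAt (𝓡 m) 𝓘(ℝ, Euc m) ∞ (φ' ∘ Φ) p := fun p hp ↦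
    ContMDiffAt.comp p (contMDiffAt_extChartAt' (by
      rw [← extChartAt_source (I := 𝓡 m)]; exact hmem p hp)) (hΦ p)
  have hder : ∀ z ∈ φ '' A, HasFDerivWithinAt ψ (fderiv ℝ ψ z) (φ '' A) z := by
    rintro z ⟨p, hp, rfl⟩
    have hz : φ p ∈ φ.target := φ.map_source (hAx hp)
    have := contDiffAt_comp_chart_symm (f := φ' ∘ Φ) hz (by
      rw [← hφ, φ.left_inv (hAx hp)]; exact hsm p hp)
    exact (this.differentiableAt (by simp)).hasFDerivAt.hasFDerivWithinAt
  have hinjψ : InjOn ψ (φ '' A) := by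
    rintro _ ⟨p, hp, rfl⟩ _ ⟨q, hq, rfl⟩ h
    rw [hψ p hp, hψ q hq] at h
    rw [hinj (φ'.injOn (hmem p hp) (hmem q hq) h)]
  rw [chartVol_apply hA hAx, chartVol_apply hΦA hAy, ← hφ', himg,
    lintegral_image_eq_lintegral_abs_det_fderiv_mul _ (measurableSet_chart_image hA hAx) hder
      hinjψ]
  refine setLIntegral_congr_fun (measurableSet_chart_image hA hAx) ?_
  rintro _ ⟨p, hp, rfl⟩
  dsimp only
  rw [hψ p hp, φ'.left_inv (hmem p hp), ← hφ, φ.left_inv (hAx hp),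
    ← ENNReal.ofReal_mul (abs_nonneg _)]
  congr 1
  refine (coordDensity_image (hAx hp) (hmem p hp) _ (hiso p) _ fun u ↦ ?_).symm
  have h1 := mvfderiv_eq_fderiv_chart (hAx hp) ((hsm p hp).mdifferentiableAt (by simp)) u
  refine h1.symm.trans ?_
  have h2 : MDifferentiableAt (𝓡 m) 𝓘(ℝ, Euc m) φ' (Φ p) := mdifferentiableAt_extChartAt
    (by rw [← extChartAt_source (I := 𝓡 m)]; exact hmem p hp)
  have h3 := mfderiv_comp p h2 ((hΦ p).mdifferentiableAt (by simp))
  exact congrArg (fun T : TangentSpace (𝓡 m) p →L[ℝ] Euc m ↦ T u) h3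

/-- A supremum of measures is not computed setwise, so it is bounded by a measure ν that is
`chartVol` of the chart plus infinite mass at every point outside its domain S. A set that leaves S
has infinite ν-measure; inside S any two chart measures agree. -/
theorem riemVol_apply {x : M} {A : Set M} (hA : MeasurableSet A)
    (hAx : A ⊆ (extChartAt (𝓡 m) x).source) : riemVol m M A = chartVol m x A := by
  refine le_antisymm ?_ (le_iSup (fun x ↦ chartVol m x) x A)
  set S := (extChartAt (𝓡 m) x).source
  have hS : MeasurableSet S := (isOpen_extChartAt_source x).measurableSet
  let ν : Measure M := chartVol m x + ((⊤ : ℝ≥0∞) • Measure.count).restrict Sᶜ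
  have hν : riemVol m M ≤ ν := by
    refine iSup_le fun y ↦ Measure.le_iff.2 fun B hB ↦ ?_
    rcases (B ∩ Sᶜ).eq_empty_or_nonempty with h | h
    · have hBS : B ⊆ S := by rwa [← sdiff_eq, sdiff_eq_empty] at h
      set S' := (extChartAt (𝓡 m) y).source
      have h1 : chartVol m y B = chartVol m y (B ∩ S') := by
        refine le_antisymm ?_ (measure_mono inter_subset_left)
        calc chartVol m y B ≤ chartVol m y ((B ∩ S') ∪ S'ᶜ) := by
              refine measure_mono fun z hz ↦ ?_
              by_cases hz' : z ∈ S'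
              · exact Or.inl ⟨hz, hz'⟩
              · exact Or.inr hz'
          _ ≤ chartVol m y (B ∩ S') + chartVol m y S'ᶜ := measure_union_le _ _
          _ = _ := by rw [chartVol_compl_source, add_zero]
      have hB' : MeasurableSet (B ∩ S') := hB.inter (isOpen_extChartAt_source y).measurableSet
      -- Change of charts is the case of the identity as an isometry.
      have h2 := chartVol_image (m := m) (Φ := (id : M → M)) contMDiff_id Function.injective_id
        (fun p u ↦ by rw [mfderiv_id]; rfl) (x := y) (y := x) hB' inter_subset_right
        (by rwa [image_id]) (by rw [image_id]; exact inter_subset_left.trans hBS)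
      rw [image_id] at h2
      rw [h1, ← h2]
      refine (measure_mono inter_subset_left).trans ?_
      rw [Measure.add_apply]
      exact le_self_add
    · have h1 : ν B = ⊤ := by
        rw [Measure.add_apply, Measure.restrict_apply hB, Measure.smul_apply, smul_eq_mul,
          ENNReal.top_mul, add_top]
        rw [Ne, Measure.count_eq_zero_iff]
        exact h.ne_empty
      rw [h1]
      exact le_top
  refine (hν A).trans ?_
  rw [Measure.add_apply, Measure.restrict_apply hA]
  have : A ∩ Sᶜ = ∅ := by rw [← sdiff_eq, sdiff_eq_empty]; exact hAx
  simp [this]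

/-- By continuity the density is bounded on a coordinate ball. -/
theorem riemVol_isLocallyFinite : IsLocallyFiniteMeasure (riemVol m M) := by
  refine ⟨fun x ↦ ?_⟩
  set φ := extChartAt (𝓡 m) x with hφ
  have hx : x ∈ φ.source := mem_extChartAt_source x
  have hz : φ x ∈ φ.target := φ.map_source hx
  have hc : ContinuousAt (chartDensity (m := m) x) (φ x) :=
    (continuousOn_chartDensity x).continuousAt ((isOpen_extChartAt_target x).mem_nhds hz)
  have h1 : ∀ᶠ z in 𝓝 (φ x), chartDensity x z < chartDensity x (φ x) + 1 :=
    hc.eventually (gt_mem_nhds (by linarith))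
  obtain ⟨r, hr, hball⟩ := Metric.eventually_nhds_iff_ball.1
    (h1.and ((isOpen_extChartAt_target x).mem_nhds hz))
  let A : Set M := φ.source ∩ φ ⁻¹' Metric.ball (φ x) r
  have hA : IsOpen A := isOpen_extChartAt_preimage' x Metric.isOpen_ball
  have hAx : A ⊆ φ.source := inter_subset_left
  refine ⟨A, hA.mem_nhds ⟨hx, Metric.mem_ball_self hr⟩, ?_⟩
  rw [riemVol_apply hA.measurableSet hAx, chartVol_apply hA.measurableSet hAx]
  have hsub : φ '' A ⊆ Metric.ball (φ x) r := by
    rintro _ ⟨p, hp, rfl⟩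
    exact hp.2
  calc ∫⁻ z in φ '' A, ENNReal.ofReal (coordDensity m x (φ.symm z))
      ≤ ∫⁻ z in φ '' A, ENNReal.ofReal (chartDensity x (φ x) + 1) := by
        refine setLIntegral_mono' (measurableSet_chart_image hA.measurableSet hAx) fun z hz' ↦ ?_
        obtain ⟨h2, h3⟩ := hball z (hsub hz')
        rw [chartDensity_eq h3] at h2
        exact ENNReal.ofReal_le_ofReal h2.le
    _ = ENNReal.ofReal (chartDensity x (φ x) + 1) * volume (φ '' A) := setLIntegral_const _ _
    _ < ⊤ := ENNReal.mul_lt_top ENNReal.ofReal_lt_top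
      ((measure_mono hsub).trans_lt Metric.isBounded_ball.measure_lt_top)

/-- The density is continuous and positive at x, hence at least half that value on a small
coordinate ball. This later turns a vanishing L² norm into pointwise vanishing. -/
theorem riemVol_isOpenPos : (riemVol m M).IsOpenPosMeasure := by
  refine ⟨fun U hU ⟨x, hxU⟩ h0 ↦ ?_⟩
  set φ := extChartAt (𝓡 m) x with hφ
  have hx : x ∈ φ.source := mem_extChartAt_source x
  have hz : φ x ∈ φ.target := φ.map_source hx
  have hc : ContinuousAt (chartDensity (m := m) x) (φ x) :=
    (continuousOn_chartDensity x).continuousAt ((isOpen_extChartAt_target x).mem_nhds hz)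
  have hpos : 0 < chartDensity x (φ x) := by
    rw [chartDensity_eq hz, ← hφ, φ.left_inv hx]
    exact coordDensity_pos hx
  have h1 : ∀ᶠ z in 𝓝 (φ x), chartDensity x (φ x) / 2 < chartDensity x z :=
    hc.eventually (lt_mem_nhds (by linarith))
  have h2 : ∀ᶠ z in 𝓝 (φ x), φ.symm z ∈ U := by
    have := (continuousAt_extChartAt_symm (I := 𝓡 m) x).tendsto
    rw [← hφ, φ.left_inv hx] at this
    exact this.eventually (hU.mem_nhds hxU)
  obtain ⟨r, hr, hball⟩ := Metric.eventually_nhds_iff_ball.1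
    ((h1.and h2).and ((isOpen_extChartAt_target x).mem_nhds hz))
  let A : Set M := φ.source ∩ φ ⁻¹' Metric.ball (φ x) r
  have hA : IsOpen A := isOpen_extChartAt_preimage' x Metric.isOpen_ball
  have hAx : A ⊆ φ.source := inter_subset_left
  have himg : φ '' A = Metric.ball (φ x) r := by
    refine Subset.antisymm ?_ fun z hz' ↦ ?_
    · rintro _ ⟨p, hp, rfl⟩
      exact hp.2
    · have h3 := (hball z hz').2
      refine ⟨φ.symm z, ⟨φ.map_target h3, ?_⟩, φ.right_inv h3⟩
      rw [mem_preimage, φ.right_inv h3]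
      exact hz'
  have hAU : A ⊆ U := fun p hp ↦ by
    have := (hball (φ p) hp.2).1.2
    rwa [φ.left_inv hp.1] at this
  have hA0 : riemVol m M A = 0 := measure_mono_null hAU h0
  rw [riemVol_apply hA.measurableSet hAx, chartVol_apply hA.measurableSet hAx, ← hφ, himg] at hA0
  have h4 : ∫⁻ z in Metric.ball (φ x) r, ENNReal.ofReal (chartDensity x (φ x) / 2) ≤
      ∫⁻ z in Metric.ball (φ x) r, ENNReal.ofReal (coordDensity m x (φ.symm z)) := by
    refine setLIntegral_mono' measurableSet_ball fun z hz' ↦ ?_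
    obtain ⟨⟨h5, -⟩, h6⟩ := hball z hz'
    rw [chartDensity_eq h6] at h5
    exact ENNReal.ofReal_le_ofReal h5.le
  rw [hA0, setLIntegral_const, nonpos_iff_eq_zero, mul_eq_zero, ENNReal.ofReal_eq_zero] at h4
  rcases h4 with h4 | h4
  · linarith
  · exact (Metric.measure_ball_pos volume (φ x) hr).ne' h4

/-- It suffices to compare the measures on the pieces of a countable cover, where `chartVol_image`
applies. -/
theorem riemVol_map [T2Space M] [CompactSpace M] (Φ : M ≃ₜ M)
    (hΦ : ContMDiff (𝓡 m) (𝓡 m) ∞ Φ)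
    (hiso : ∀ x (u : TangentSpace (𝓡 m) x), ‖mfderiv (𝓡 m) (𝓡 m) Φ x u‖ = ‖u‖) :
    (riemVol m M).map Φ = riemVol m M := by
  have : SecondCountableTopology M := ChartedSpace.secondCountable_of_sigmaCompact (Euc m) M
  -- Small enough that S z and its preimage under Φ each lie in a single chart domain.
  let S (z : M) : Set M := (extChartAt (𝓡 m) z).source ∩
    Φ.symm ⁻¹' (extChartAt (𝓡 m) (Φ.symm z)).source
  have hSo (z : M) : IsOpen (S z) := (isOpen_extChartAt_source z).inter
    ((isOpen_extChartAt_source _).preimage Φ.symm.continuous)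
  obtain ⟨t, ht, hcov⟩ := TopologicalSpace.countable_cover_nhds fun z ↦ (hSo z).mem_nhds
    ⟨mem_extChartAt_source z, mem_extChartAt_source (I := 𝓡 m) (Φ.symm z)⟩
  have := ht.to_subtype
  rw [Measure.ext_iff_of_iUnion_eq_univ (s := fun z : t ↦ S z) (by rw [← hcov, biUnion_eq_iUnion])]
  rintro ⟨z, -⟩
  ext B hB
  rw [Measure.restrict_apply hB, Measure.restrict_apply hB]
  have hBS := hB.inter (hSo z).measurableSet
  set B' := B ∩ S z
  have hB' : MeasurableSet (Φ ⁻¹' B') := Φ.continuous.measurable hBS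
  have himg : Φ '' (Φ ⁻¹' B') = B' := image_preimage_eq _ Φ.surjective
  have h1 : Φ ⁻¹' B' ⊆ (extChartAt (𝓡 m) (Φ.symm z)).source := fun p hp ↦ by
    simpa using hp.2.2
  have h2 : B' ⊆ (extChartAt (𝓡 m) z).source := fun p hp ↦ hp.2.1
  rw [Measure.map_apply Φ.continuous.measurable hBS, riemVol_apply hB' h1, riemVol_apply hBS h2]
  have h3 := chartVol_image hΦ Φ.injective hiso hB' h1 (by rwa [himg]) (by rwa [himg])
  rw [himg] at h3
  exact h3.symm

end Volume

/-! ### The divergence theorem for coordinate vector fields -/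

section Divergence

open Filter Topology Set

variable {m : ℕ} {M : Type*} [TopologicalSpace M] [ChartedSpace (Euc m) M]
  [IsManifold (𝓡 m) ∞ M] [RiemannianBundle (fun x : M ↦ TangentSpace (𝓡 m) x)]

theorem coordDensity_mdiff
    [IsContMDiffRiemannianBundle (𝓡 m) ∞ (Euc m) (fun x : M ↦ TangentSpace (𝓡 m) x)]
    {x y : M} (hy : y ∈ (extChartAt (𝓡 m) x).source) :
    MDifferentiableAt (𝓡 m) 𝓘(ℝ) (coordDensity m x) y := (coordDensity_smoothNear hy).mdiff

/-- The divergence of a coordinate vector field. -/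
def coordDiv (x : M) (i : Fin m) (y : M) : ℝ :=
  mvfderiv (𝓡 m) (coordDensity m x) y (coordField x i y) / coordDensity m x y

variable [IsContMDiffRiemannianBundle (𝓡 m) ∞ (Euc m) (fun x : M ↦ TangentSpace (𝓡 m) x)]

theorem coordDiv_smoothNear [T2Space M] {x y : M} (hy : y ∈ (extChartAt (𝓡 m) x).source)
    (i : Fin m) : SmoothFnNear m (coordDiv x i) y := by
  have h1 := (coordDensity_smoothNear hy).mvfderiv_apply (coordField_smoothNear hy i)
  filter_upwards [h1, coordDensity_smoothNear hy, eventually_mem_extChartAt_source hy]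
    with z hz hz' hzs
  exact hz.div₀ hz' (coordDensity_pos hzs).ne'

variable [MeasurableSpace M] [BorelSpace M]

theorem integral_riemVol_eq {x : M} {g : M → ℝ} (hg : Continuous g)
    (hs : ∀ y, y ∉ (extChartAt (𝓡 m) x).source → g y = 0) :
    ∫ y, g y ∂riemVol m M = ∫ z in (extChartAt (𝓡 m) x).target,
      chartDensity x z * g ((extChartAt (𝓡 m) x).symm z) := by
  have hr : (riemVol m M).restrict (extChartAt (𝓡 m) x).source = chartVol m x := by
    ext A hA
    have hS : MeasurableSet (extChartAt (𝓡 m) x).source :=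
      (isOpen_extChartAt_source x).measurableSet
    rw [Measure.restrict_apply hA, riemVol_apply (hA.inter hS) inter_subset_right]
    exact measure_inter_conull (chartVol_compl_source x)
  rw [← setIntegral_eq_integral_of_forall_compl_eq_zero hs, hr, chartVol,
    integral_map ((aemeasurable_chart_symm x).mono_ac (withDensity_absolutelyContinuous _ _))
      hg.aestronglyMeasurable, integral_withDensity_eq_integral_toReal_smul₀
      (aemeasurable_chartDensity x) (by simp)]
  refine integral_congr_ae (Eventually.of_forall fun z ↦ ?_)
  simp only [smul_eq_mul]
  rw [ENNReal.toReal_ofReal (show 0 ≤ chartDensity x z from Real.sqrt_nonneg _)]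

/-- Integration by parts against the constant function 1. -/
theorem integral_fderiv_eq_zero_of_compact {h : Euc m → ℝ} (hh : ContDiff ℝ ∞ h)
    (hc : HasCompactSupport h) (v : Euc m) : ∫ z, fderiv ℝ h z v = 0 := by
  have h1 : Continuous fun z ↦ fderiv ℝ h z v :=
    (hh.continuous_fderiv (by simp)).clm_apply continuous_const
  have h2 : HasCompactSupport fun z ↦ fderiv ℝ h z v := hc.fderiv_apply (𝕜 := ℝ) v
  have := integral_mul_fderiv_eq_neg_fderiv_mul_of_integrable (μ := (volume : Measure (Euc m)))
    (f := fun _ ↦ (1 : ℝ)) (g := h) (v := v) (by simp)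
    (by simpa using h1.integrable_of_hasCompactSupport h2)
    (by simpa using hh.continuous.integrable_of_hasCompactSupport hc)
    (fun _ _ ↦ differentiableAt_const _) fun z _ ↦ hh.differentiable (by simp) z
  simpa using this

/-- The divergence theorem for coordinate vector fields. -/
theorem integral_coordField_add [T2Space M] [CompactSpace M] {f : M → ℝ}
    (hf : ContMDiff (𝓡 m) 𝓘(ℝ) ∞ f) {x : M} (ht : tsupport f ⊆ (extChartAt (𝓡 m) x).source)
    (i : Fin m) :
    ∫ y, (mvfderiv (𝓡 m) f y (coordField x i y) + coordDiv x i y * f y) ∂riemVol m M = 0 := by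
  set φ := extChartAt (𝓡 m) x with hφ
  have hout : ∀ y, y ∉ tsupport f →
      mvfderiv (𝓡 m) f y (coordField x i y) + coordDiv x i y * f y = 0 := by
    intro y hy
    have h0 : f =ᶠ[𝓝 y] fun _ ↦ (0 : ℝ) := notMem_tsupport_iff_eventuallyEq.1 hy
    rw [mvfderiv_congr h0, h0.self_of_nhds]
    simp [mvfderiv, mfderiv_const]
  have hcont : Continuous fun y ↦
      mvfderiv (𝓡 m) f y (coordField x i y) + coordDiv x i y * f y := by
    refine continuous_iff_continuousAt.2 fun y ↦ ?_
    by_cases hy : y ∈ tsupport f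
    · have h1 := SmoothFnNear.mvfderiv_apply (x := y) (Eventually.of_forall hf)
        (coordField_smoothNear (ht hy) i)
      exact h1.self_of_nhds.continuousAt.add
        ((coordDiv_smoothNear (ht hy) i).self_of_nhds.continuousAt.mul hf.continuous.continuousAt)
    · refine ContinuousAt.congr (f := fun _ ↦ (0 : ℝ)) continuousAt_const ?_
      filter_upwards [(isClosed_tsupport f).isOpen_compl.mem_nhds hy] with z hz
      exact (hout z hz).symm
  rw [integral_riemVol_eq hcont fun y hy ↦ hout y fun h ↦ hy (ht h)]
  -- With ρ the density, h is ρf in coordinates, extended by zero; it is smooth because f has its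
  -- support inside the chart. Then ∂ᵢh = ρ (∂ᵢf + (∂ᵢρ/ρ) f) is the given integrand times ρ.
  let h : Euc m → ℝ := φ.target.indicator fun z ↦ coordDensity m x (φ.symm z) * f (φ.symm z)
  have hK : IsCompact (φ '' tsupport f) :=
    (isClosed_tsupport f).isCompact.image_of_continuousOn ((continuousOn_extChartAt x).mono ht)
  have hKc : ∀ z, z ∉ φ '' tsupport f → h z = 0 := by
    intro z hz
    by_cases hzt : z ∈ φ.target
    · have : φ.symm z ∉ tsupport f := fun hm ↦ hz ⟨_, hm, φ.right_inv hzt⟩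
      simp only [h, indicator_of_mem hzt, image_eq_zero_of_notMem_tsupport this, mul_zero]
    · exact indicator_of_notMem hzt _
  have hloc : ∀ z ∈ φ.target, h =ᶠ[𝓝 z] (fun y ↦ coordDensity m x y * f y) ∘ φ.symm := by
    intro z hz
    filter_upwards [(isOpen_extChartAt_target x).mem_nhds hz] with w hw
    exact indicator_of_mem hw _
  have hsm : ∀ y ∈ φ.source, ContMDiffAt (𝓡 m) 𝓘(ℝ) ∞ (fun y ↦ coordDensity m x y * f y) y :=
    fun y hy ↦ (coordDensity_smoothNear hy).self_of_nhds.mul (hf y)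
  have hh : ContDiff ℝ ∞ h := by
    refine contDiff_iff_contDiffAt.2 fun z ↦ ?_
    by_cases hz : z ∈ φ '' tsupport f
    · obtain ⟨y, hy, rfl⟩ := hz
      have hzt := φ.map_source (ht hy)
      exact (contDiffAt_comp_chart_symm hzt (hsm _ (φ.map_target hzt))).congr_of_eventuallyEq
        (hloc _ hzt)
    · refine ContDiffAt.congr_of_eventuallyEq (contDiffAt_const (c := (0 : ℝ))) ?_
      filter_upwards [hK.isClosed.isOpen_compl.mem_nhds hz] with w hw
      exact hKc w hw
  have hhc : HasCompactSupport h := HasCompactSupport.intro hK hKc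
  rw [← integral_fderiv_eq_zero_of_compact hh hhc (EuclideanSpace.single i 1)]
  refine Eq.trans ?_ (setIntegral_eq_integral_of_forall_compl_eq_zero (s := φ.target)
    (f := fun z ↦ fderiv ℝ h z (EuclideanSpace.single i 1)) ?_)
  · refine setIntegral_congr_fun (measurableSet_chart_target (m := m) x) fun z hz ↦ ?_
    have hy := φ.map_target hz
    have h1 := mvfderiv_coordField (F := ℝ) hy ((hsm _ hy).mdifferentiableAt (by simp)) i
    rw [← hφ, φ.right_inv hz] at h1
    rw [(hloc z hz).fderiv_eq, ← h1, chartDensity_eq hz, ← hφ]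
    have h2 : mvfderiv (𝓡 m) (fun y ↦ coordDensity m x y * f y) (φ.symm z)
        (coordField x i (φ.symm z)) =
        coordDensity m x (φ.symm z) * mvfderiv (𝓡 m) f (φ.symm z) (coordField x i (φ.symm z)) +
        f (φ.symm z) * mvfderiv (𝓡 m) (coordDensity m x) (φ.symm z)
          (coordField x i (φ.symm z)) := by
      have h3 := mvfderiv_mul (coordDensity_mdiff hy)
        ((hf (φ.symm z)).mdifferentiableAt (by simp))
      exact congrArg (fun T : TangentSpace (𝓡 m) (φ.symm z) →L[ℝ] ℝ ↦
        T (coordField x i (φ.symm z))) h3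
    rw [h2, coordDiv]
    have := (coordDensity_pos hy).ne'
    field_simp
  · intro z hz
    have : z ∉ tsupport h := fun hm ↦ by
      have h4 : tsupport h ⊆ φ '' tsupport f :=
        closure_minimal (fun w hw ↦ by_contra fun h' ↦ hw (hKc w h')) hK.isClosed
      obtain ⟨y, hy, rfl⟩ := h4 hm
      exact hz (φ.map_source (ht hy))
    rw [fderiv_of_notMem_tsupport ℝ this]
    rfl

end Divergence

/-! ### Sections of the endomorphism bundle and `G`-connections -/

theorem mvfderiv_clm_comp {m : ℕ} {M : Type*} [TopologicalSpace M] [ChartedSpace (Euc m) M]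
    [IsManifold (𝓡 m) ∞ M] {F F' : Type*} [NormedAddCommGroup F] [NormedSpace ℝ F]
    [NormedAddCommGroup F'] [NormedSpace ℝ F'] (l : F →L[ℝ] F') {f : M → F} {x : M}
    (hf : MDifferentiableAt (𝓡 m) 𝓘(ℝ, F) f x) (u : TangentSpace (𝓡 m) x) :
    mvfderiv (𝓡 m) (fun y ↦ l (f y)) x u = l (mvfderiv (𝓡 m) f x u) := by
  have hl : MDifferentiableAt 𝓘(ℝ, F) 𝓘(ℝ, F') l (f x) := l.differentiableAt.mdifferentiableAt
  refine (mfderiv_comp_apply (I'' := 𝓘(ℝ, F')) x hl hf u).trans ?_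
  exact congrArg (fun T : F →L[ℝ] F' ↦ T (mvfderiv (𝓡 m) f x u))
    (mfderiv_eq_fderiv.trans l.fderiv)

/-- Otherwise a linear functional that vanishes on S would be nonzero on the derivative, although
its composition with f vanishes near x. -/
theorem mvfderiv_mem {m : ℕ} {M : Type*} [TopologicalSpace M] [ChartedSpace (Euc m) M]
    [IsManifold (𝓡 m) ∞ M] {F : Type*} [NormedAddCommGroup F] [NormedSpace ℝ F]
    [FiniteDimensional ℝ F] (S : Submodule ℝ F) {f : M → F} {x : M}
    (hf : MDifferentiableAt (𝓡 m) 𝓘(ℝ, F) f x) (h : ∀ᶠ y in nhds x, f y ∈ S)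
    (u : TangentSpace (𝓡 m) x) : mvfderiv (𝓡 m) f x u ∈ S := by
  by_contra hu
  obtain ⟨l, hl, hS⟩ := Submodule.exists_le_ker_of_notMem hu
  let l' : F →L[ℝ] ℝ := LinearMap.toContinuousLinearMap l
  have h0 : (fun y ↦ l' (f y)) =ᶠ[nhds x] fun _ ↦ (0 : ℝ) := h.mono fun y hy ↦ hS hy
  have h1 := mvfderiv_clm_comp l' hf u
  rw [mvfderiv_congr h0, mvfderiv_const] at h1
  exact hl h1.symm

section EndSections

open Filter Topology

variable {m n : ℕ} {M : Type*} [TopologicalSpace M] [T2Space M] [ChartedSpace (Euc m) M]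
  [IsManifold (𝓡 m) ∞ M]
  {V : M → Type*} [TopologicalSpace (TotalSpace (Euc n) V)]
  [∀ x, NormedAddCommGroup (V x)] [∀ x, InnerProductSpace ℝ (V x)]
  [FiberBundle (Euc n) V] [VectorBundle ℝ (Euc n) V] [ContMDiffVectorBundle ∞ (Euc n) V (𝓡 m)]
  {D : CovariantDerivative (𝓡 m) (Euc n) V}

variable (m n) in
/-- Smoothness of a section of the endomorphism bundle. -/
def SmoothEnd (S : ∀ x, V x →L[ℝ] V x) : Prop :=
  ∀ σ : ∀ x, V x, SmoothSec m (Euc n) σ → SmoothSec m (Euc n) fun x ↦ S x (σ x)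

theorem SmoothEnd.near {S : ∀ x, V x →L[ℝ] V x} (hS : SmoothEnd m n S) {σ : ∀ x, V x} {x : M}
    (hσ : SmoothNear m (Euc n) σ x) : SmoothNear m (Euc n) (fun x ↦ S x (σ x)) x := by
  obtain ⟨τ, hτ, e⟩ := exists_global_section hσ
  exact ((hS τ hτ).near x).congr (e.mono fun y hy ↦ by rw [hy])

theorem SmoothEndForm.smoothEnd {φ : EndForm m V} (hφ : SmoothEndForm n φ)
    {X : ∀ x : M, TangentSpace (𝓡 m) x} (hX : SmoothSec m (Euc m) X) :
    SmoothEnd m n fun x ↦ φ x (X x) := fun σ hσ ↦ smoothEndForm_iff.1 hφ X σ hX hσ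

/-- The covariant derivative of a section of the endomorphism bundle. -/
theorem exists_covEndo (hD : CovariantDerivative.ContMDiffCovariantDerivative D ∞)
    {S : ∀ x, V x →L[ℝ] V x} (hS : SmoothEnd m n S) {X : ∀ x : M, TangentSpace (𝓡 m) x}
    (hX : SmoothSec m (Euc m) X) :
    ∃ T : ∀ x, V x →L[ℝ] V x, SmoothEnd m n T ∧ ∀ x, ∀ σ : ∀ x, V x, SmoothNear m (Euc n) σ x →
      T x (σ x) = D (fun y ↦ S y (σ y)) x (X x) - S x (D σ x (X x)) := by
  let Φ (x : M) (σ : ∀ x, V x) : V x := D (fun y ↦ S y (σ y)) x (X x) - S x (D σ x (X x))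
  have hΦ (x : M) : Tensorial m (Euc n) (Φ x) x :=
    { add := fun {σ τ} hσ hτ ↦ by
        have e : (fun y ↦ S y ((σ + τ) y)) = (fun y ↦ S y (σ y)) + fun y ↦ S y (τ y) := by
          ext y; simp
        simp only [Φ, e]
        rw [cov_add (hS.near hσ) (hS.near hτ), cov_add hσ hτ]
        simp only [_root_.add_apply, map_add]
        abel
      smul := fun {f σ} hf hσ ↦ by
        have e : (fun y ↦ S y ((f • σ) y)) = f • (fun y ↦ S y (σ y)) := by
          ext y; simp
        simp only [Φ, e]
        rw [cov_smul hf (hS.near hσ), cov_smul hf hσ]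
        simp only [map_smul, map_add]
        module }
  have hV (x : M) : FiniteDimensional ℝ (V x) := VectorBundle.finiteDimensional ℝ (Euc n) V x
  let T (x : M) : V x →L[ℝ] V x := LinearMap.toContinuousLinearMap
    ⟨⟨fun w ↦ Φ x (FiberBundle.extend (Euc n) w), (hΦ x).map_extend_add⟩,
      (hΦ x).map_extend_smul⟩
  have hT (x : M) (σ : ∀ x, V x) (hσ : SmoothNear m (Euc n) σ x) : T x (σ x) = Φ x σ :=
    (hΦ x).pointwise (smoothNear_extend _ _) hσ (by simp)
  refine ⟨T, fun σ hσ ↦ ?_, hT⟩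
  have e : (fun x ↦ T x (σ x)) = fun x ↦ Φ x σ := by
    ext x; exact hT x σ (hσ.near x)
  rw [e]
  exact ContMDiff.sub_section (cov_smooth hD (hS σ hσ) hX) (hS _ (cov_smooth hD hσ hX))

/-- The curvature as a section of the endomorphism bundle. -/
theorem exists_curvEndo (hD : CovariantDerivative.ContMDiffCovariantDerivative D ∞)
    {X Y : ∀ x : M, TangentSpace (𝓡 m) x} (hX : SmoothSec m (Euc m) X)
    (hY : SmoothSec m (Euc m) Y) :
    ∃ H : ∀ x, V x →L[ℝ] V x, SmoothEnd m n H ∧ ∀ x w, H x w = curv D x (X x) (Y x) w := by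
  have hV (x : M) : FiniteDimensional ℝ (V x) := VectorBundle.finiteDimensional ℝ (Euc n) V x
  choose B hB using curv_trilinear (D := D) hD
  refine ⟨fun x ↦ LinearMap.toContinuousLinearMap (B x (X x) (Y x)), fun σ hσ ↦ ?_, fun x w ↦ ?_⟩
  · have := curv_smooth hD hX hY hσ
    simp only [hB] at this
    exact this
  · rw [hB]; rfl

section GStructure

variable {G : Subgroup (Euc n ≃ₗᵢ[ℝ] Euc n)} {P : GStructure m n V G}

/-- Local frames adapted to a `G`-connection. -/
theorem exists_adapted_frame (hDG : IsGConnection P D) (x : M) :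
    ∃ U : Set M, IsOpen U ∧ x ∈ U ∧ ∃ s : ∀ y, Euc n ≃ₗᵢ[ℝ] V y, ∀ y ∈ U,
      s y ∈ P.frames y ∧ (∀ w, SmoothNear m (Euc n) (fun z ↦ s z w) y) ∧
      ∀ u : TangentSpace (𝓡 m) y, ∃ ξ ∈ lieAlg G, ∀ w, D (fun z ↦ s z w) y u = s y (ξ w) := by
  obtain ⟨U, hU, hx, s, hs, hsm⟩ := P.exists_local x
  refine ⟨U, hU, hx, s, fun y hy ↦ ⟨hs y hy, fun w ↦ ?_, hDG U s hU hs hsm y hy⟩⟩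
  filter_upwards [hU.mem_nhds hy] with z hz
  exact (hsm w).contMDiffAt (hU.mem_nhds hz)

theorem frame_eq_sum {y : M} (s : Euc n ≃ₗᵢ[ℝ] V y) (w : Euc n) :
    s w = ∑ a, w a • s (EuclideanSpace.single a 1) := by
  conv_lhs => rw [← (EuclideanSpace.basisFun (Fin n) ℝ).sum_repr w, map_sum]
  simp

/-- Leibniz rule on the components of f: in an adapted frame the connection is d + ξ. -/
theorem cov_frame {s : ∀ y, Euc n ≃ₗᵢ[ℝ] V y} {x : M}
    (hs : ∀ w, SmoothNear m (Euc n) (fun z ↦ s z w) x) {f : M → Euc n} (hf : SmoothFnNear m f x)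
    {u : TangentSpace (𝓡 m) x} {ξ : Euc n →L[ℝ] Euc n}
    (hξ : ∀ w, D (fun z ↦ s z w) x u = s x (ξ w)) :
    D (fun y ↦ s y (f y)) x u = s x (mvfderiv (𝓡 m) f x u + ξ (f x)) := by
  have hfa (a : Fin n) : SmoothFnNear m (fun y ↦ f y a) x := hf.mono fun y hy ↦
    (EuclideanSpace.proj a : Euc n →L[ℝ] ℝ).contMDiff.contMDiffAt.comp y hy
  have hd (a : Fin n) : mvfderiv (𝓡 m) (fun y ↦ f y a) x u = mvfderiv (𝓡 m) f x u a :=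
    mvfderiv_clm_comp (EuclideanSpace.proj a : Euc n →L[ℝ] ℝ) hf.mdiff u
  have e : (fun y ↦ s y (f y)) =
      fun y ↦ ∑ a, ((fun z ↦ f z a) • fun z ↦ s z (EuclideanSpace.single a 1)) y := by
    ext y; exact frame_eq_sum (s y) (f y)
  have h1 : ξ (f x) = ∑ a, f x a • ξ (EuclideanSpace.single a 1) := by
    conv_lhs => rw [← (EuclideanSpace.basisFun (Fin n) ℝ).sum_repr (f x), map_sum]
    simp
  rw [e, cov_sum fun a _ ↦ SmoothNear.smul (hfa a) (hs _), _root_.sum_apply, map_add,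
    frame_eq_sum (s x) (mvfderiv (𝓡 m) f x u), h1, map_sum, ← Finset.sum_add_distrib]
  refine Finset.sum_congr rfl fun a _ ↦ ?_
  rw [cov_smul (hfa a) (hs _), hξ, hd, map_smul, add_comm]

/-- A connection that preserves a metric in adapted frames is compatible with it. -/
theorem mvfderiv_inner [IsContMDiffRiemannianBundle (𝓡 m) ∞ (Euc n) V]
    (hDG : IsGConnection P D) {σ τ : ∀ x, V x} {x : M}
    (hσ : SmoothNear m (Euc n) σ x) (hτ : SmoothNear m (Euc n) τ x) (u : TangentSpace (𝓡 m) x) :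
    mvfderiv (𝓡 m) (fun y ↦ inner ℝ (σ y) (τ y)) x u =
      inner ℝ (D σ x u) (τ x) + inner ℝ (σ x) (D τ x u) := by
  have : ContMDiffVectorBundle 1 (Euc n) V (𝓡 m) := ContMDiffVectorBundle.of_le (n := ∞) (by simp)
  have : IsContMDiffRiemannianBundle (𝓡 m) 1 (Euc n) V :=
    IsContMDiffRiemannianBundle.of_le (n := ∞) (by simp)
  -- The failure of metric compatibility is tensorial, so it may be evaluated on frame sections with
  -- the same values at x. Their inner products are constant, and skewness of ξ gives zero.
  have key {σ τ : ∀ x, V x} (hσ : SmoothNear m (Euc n) σ x) (hτ : SmoothNear m (Euc n) τ x) :=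
    D.derivMetricTensor_apply (X := FiberBundle.extend (Euc m) u) x hσ.mdiff hτ.mdiff
  obtain ⟨U, -, hx, s, hs⟩ := exists_adapted_frame hDG x
  obtain ⟨-, hsm, hξ⟩ := hs x hx
  obtain ⟨ξ, hξ, hD⟩ := hξ u
  have h0 := key (hsm ((s x).symm (σ x))) (hsm ((s x).symm (τ x)))
  have hc : (fun y ↦ inner ℝ (s y ((s x).symm (σ x))) (s y ((s x).symm (τ x)))) =
      fun _ ↦ inner ℝ ((s x).symm (σ x)) ((s x).symm (τ x)) := by
    ext y; exact (s y).inner_map_map _ _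
  have h1 := key hσ hτ
  simp only [LinearIsometryEquiv.apply_symm_apply] at h0
  rw [h1, hc, mvfderiv_const] at h0
  simp only [FiberBundle.extend_apply_self, hD] at h0
  have h2 := lieAlg_skew hξ ((s x).symm (σ x)) ((s x).symm (τ x))
  rw [← (s x).inner_map_map, ← (s x).inner_map_map ((s x).symm (σ x))] at h2
  simp only [LinearIsometryEquiv.apply_symm_apply, _root_.zero_apply] at h0 h2
  linarith

/-- The matrix of an endomorphism field in a local frame. -/
theorem smoothFnNear_matrix [IsContMDiffRiemannianBundle (𝓡 m) ∞ (Euc n) V]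
    {s : ∀ y, Euc n ≃ₗᵢ[ℝ] V y} {x : M} (hs : ∀ w, SmoothNear m (Euc n) (fun z ↦ s z w) x)
    {A : M → Euc n →L[ℝ] Euc n}
    (hA : ∀ w, SmoothNear m (Euc n) (fun y ↦ s y (A y w)) x) : SmoothFnNear m A x := by
  have h : ∀ᶠ y in 𝓝 x, ∀ a b, SmoothFnNear m (fun z ↦ inner ℝ
      (s z (EuclideanSpace.single b 1)) (s z (A z (EuclideanSpace.single a 1)))) y :=
    eventually_all.2 fun a ↦ eventually_all.2 fun b ↦
      eventually_eventually_nhds.2 ((hs _).inner (hA _))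
  filter_upwards [h] with y hy
  refine contMDiffAt_clm fun v ↦ ?_
  have e : (fun z ↦ A z v) = fun z ↦ ∑ a, v a • ∑ b, inner ℝ
      (s z (EuclideanSpace.single b 1)) (s z (A z (EuclideanSpace.single a 1))) •
      (EuclideanSpace.single b (1 : ℝ) : Euc n) := by
    ext1 z
    conv_lhs => rw [← (EuclideanSpace.basisFun (Fin n) ℝ).sum_repr v, map_sum]
    refine Finset.sum_congr rfl fun a _ ↦ ?_
    simp only [LinearIsometryEquiv.inner_map_map, map_smul]
    congr 1
    conv_lhs => rw [← (EuclideanSpace.basisFun (Fin n) ℝ).sum_repr'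
      (A z (EuclideanSpace.basisFun (Fin n) ℝ a))]
    simp
  rw [e]
  refine ContMDiffAt.sum fun a _ ↦ ?_
  have hc : ContMDiffAt (𝓡 m) 𝓘(ℝ) ∞ (fun _ : M ↦ (v a : ℝ)) y := contMDiffAt_const
  refine hc.smul (ContMDiffAt.sum fun b _ ↦ ?_)
  exact (hy a b).self_of_nhds.smul contMDiffAt_const

/-- If A is the matrix of S in an adapted frame, that of the covariant derivative is dA(u) + [ξ, A].
The first term is a derivative of a Lie algebra valued function, the second a bracket. -/
theorem covEndo_mem_adP [IsContMDiffRiemannianBundle (𝓡 m) ∞ (Euc n) V]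
    (hDG : IsGConnection P D) {S : ∀ x, V x →L[ℝ] V x} (hS : SmoothEnd m n S) {x : M}
    (hP : ∀ᶠ y in 𝓝 x, S y ∈ adP P y) {u : TangentSpace (𝓡 m) x} {T : V x →L[ℝ] V x}
    (hT : ∀ σ : ∀ x, V x, SmoothNear m (Euc n) σ x →
      T (σ x) = D (fun y ↦ S y (σ y)) x u - S x (D σ x u)) : T ∈ adP P x := by
  obtain ⟨U, hU, hx, s, hs⟩ := exists_adapted_frame hDG x
  obtain ⟨hsP, hsm, hξ⟩ := hs x hx
  obtain ⟨ξ, hξ, hD⟩ := hξ u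
  let A (y : M) : Euc n →L[ℝ] Euc n := (((s y).symm.toContinuousLinearEquiv :
    V y →L[ℝ] Euc n).comp (S y)).comp ((s y).toContinuousLinearEquiv : Euc n →L[ℝ] V y)
  have hA (y : M) (w : Euc n) : s y (A y w) = S y (s y w) := by simp [A]
  have hAs : SmoothFnNear m A x := smoothFnNear_matrix hsm fun w ↦ by
    simp only [hA]; exact hS.near (hsm w)
  have hAg : ∀ᶠ y in 𝓝 x, A y ∈ lieAlg G := by
    filter_upwards [hP, hU.mem_nhds hx] with y hy hyU
    obtain ⟨η, hη, h⟩ := (mem_adP_iff (hs y hyU).1 _).1 hy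
    have : A y = η := by
      ext1 w
      apply (s y).injective
      rw [hA, h]
    rwa [this]
  have hdA := mvfderiv_mem (lieAlg G) hAs.mdiff hAg u
  refine (mem_adP_iff hsP _).2 ⟨mvfderiv (𝓡 m) A x u + (ξ * A x - A x * ξ),
    (lieAlg G).add_mem hdA (lieAlg_bracket hξ hAg.self_of_nhds), fun w ↦ ?_⟩
  have hAw : SmoothFnNear m (fun y ↦ A y w) x := hAs.mono fun y hy ↦ hy.clm_apply contMDiffAt_const
  have h1 := hT _ (hsm w)
  simp only [← hA] at h1
  rw [cov_frame hsm hAw hD, hD, ← hA] at h1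
  rw [h1, ← map_sub]
  have h2 : mvfderiv (𝓡 m) (fun y ↦ A y w) x u = mvfderiv (𝓡 m) A x u w :=
    mvfderiv_clm_comp (ContinuousLinearMap.apply ℝ (Euc n) w) hAs.mdiff u
  rw [h2]
  congr 1
  simp only [_root_.add_apply, _root_.sub_apply, mul_apply_eq_comp]
  abel

/-- With connection matrices A, B, C along X, Y and [X, Y], the curvature matrix is X(B) − Y(A) +
[A, B] − C, each term of which lies in the Lie algebra. -/
theorem curv_mem_adP [IsContMDiffRiemannianBundle (𝓡 m) ∞ (Euc n) V]
    (hD : CovariantDerivative.ContMDiffCovariantDerivative D ∞)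
    (hDG : IsGConnection P D) {x : M} {u v : TangentSpace (𝓡 m) x} {T : V x →L[ℝ] V x}
    (hT : ∀ w, T w = curv D x u v w) : T ∈ adP P x := by
  obtain ⟨U, hU, hx, s, hs⟩ := exists_adapted_frame hDG x
  obtain ⟨hsP, hsm, -⟩ := hs x hx
  let X := FiberBundle.extend (Euc m) u
  let Y := FiberBundle.extend (Euc m) v
  have hX : SmoothNear m (Euc m) X x := smoothNear_extend (m := m) (Euc m) u
  have hY : SmoothNear m (Euc m) Y x := smoothNear_extend (m := m) (Euc m) v
  have hc (Z : ∀ y : M, TangentSpace (𝓡 m) y) : ∃ A : M → Euc n →L[ℝ] Euc n, ∀ y ∈ U,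
      A y ∈ lieAlg G ∧ ∀ w, D (fun z ↦ s z w) y (Z y) = s y (A y w) := by
    choose! A hA using fun y hy ↦ (hs y hy).2.2 (Z y)
    exact ⟨A, hA⟩
  have hsmooth (Z : ∀ y : M, TangentSpace (𝓡 m) y) (hZ : SmoothNear m (Euc m) Z x)
      (A : M → Euc n →L[ℝ] Euc n) (hA : ∀ y ∈ U,
        A y ∈ lieAlg G ∧ ∀ w, D (fun z ↦ s z w) y (Z y) = s y (A y w)) : SmoothFnNear m A x :=
    smoothFnNear_matrix hsm fun w ↦ (cov_near hD (hsm w) hZ).congr <| by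
      filter_upwards [hU.mem_nhds hx] with y hy
      exact (hA y hy).2 w
  obtain ⟨A, hA⟩ := hc X
  obtain ⟨B, hB⟩ := hc Y
  obtain ⟨C, hC⟩ := hc (VectorField.mlieBracket (𝓡 m) X Y)
  have hAs := hsmooth X hX A hA
  have hBs := hsmooth Y hY B hB
  have hdA (Z : TangentSpace (𝓡 m) x) := mvfderiv_mem (lieAlg G) hAs.mdiff
    (by filter_upwards [hU.mem_nhds hx] with y hy using (hA y hy).1) Z
  have hdB (Z : TangentSpace (𝓡 m) x) := mvfderiv_mem (lieAlg G) hBs.mdiff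
    (by filter_upwards [hU.mem_nhds hx] with y hy using (hB y hy).1) Z
  refine (mem_adP_iff hsP _).2 ⟨mvfderiv (𝓡 m) B x (X x) - mvfderiv (𝓡 m) A x (Y x) +
    (A x * B x - B x * A x) - C x, (lieAlg G).sub_mem ((lieAlg G).add_mem
      ((lieAlg G).sub_mem (hdB _) (hdA _)) (lieAlg_bracket (hA x hx).1 (hB x hx).1))
      (hC x hx).1, fun w ↦ ?_⟩
  have h1 := curvFields_eq_curv hD hX hY (hsm w)
  have hXx : X x = u := FiberBundle.extend_apply_self _ _
  have hYx : Y x = v := FiberBundle.extend_apply_self _ _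
  rw [hT]
  conv_lhs => rw [← hXx, ← hYx]
  rw [← h1, curvFields]
  have key (Z Z' : ∀ y : M, TangentSpace (𝓡 m) y) (hZ : SmoothNear m (Euc m) Z x)
      (A A' : M → Euc n →L[ℝ] Euc n) (hAs : SmoothFnNear m A x) (hA : ∀ y ∈ U,
        A y ∈ lieAlg G ∧ ∀ w, D (fun z ↦ s z w) y (Z y) = s y (A y w))
      (hA' : ∀ y ∈ U, A' y ∈ lieAlg G ∧ ∀ w, D (fun z ↦ s z w) y (Z' y) = s y (A' y w)) :
      D (fun y ↦ D (fun z ↦ s z w) y (Z y)) x (Z' x) =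
        s x (mvfderiv (𝓡 m) A x (Z' x) w + A' x (A x w)) := by
    have hAw : SmoothFnNear m (fun y ↦ A y w) x :=
      hAs.mono fun y hy ↦ hy.clm_apply contMDiffAt_const
    have h2 : mvfderiv (𝓡 m) (fun y ↦ A y w) x (Z' x) = mvfderiv (𝓡 m) A x (Z' x) w :=
      mvfderiv_clm_comp (ContinuousLinearMap.apply ℝ (Euc n) w) hAs.mdiff _
    rw [← h2, ← cov_frame hsm hAw (hA' x hx).2, cov_congr (cov_near hD (hsm w) hZ)]
    filter_upwards [hU.mem_nhds hx] with y hy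
    exact (hA y hy).2 w
  rw [key Y X hY B A hBs hB hA, key X Y hX A B hAs hA hB, (hC x hx).2, ← map_sub, ← map_sub]
  congr 1
  simp only [_root_.add_apply, _root_.sub_apply, mul_apply_eq_comp]
  abel

end GStructure

end EndSections

/-! ### The codifferential of the curvature -/

theorem mvfderiv_sum {m : ℕ} {M : Type*} [TopologicalSpace M] [ChartedSpace (Euc m) M]
    [IsManifold (𝓡 m) ∞ M] {ι : Type*} (t : Finset ι) {f : ι → M → ℝ} {x : M}
    (hf : ∀ i, SmoothFnNear m (f i) x) (u : TangentSpace (𝓡 m) x) :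
    mvfderiv (𝓡 m) (fun y ↦ ∑ i ∈ t, f i y) x u = ∑ i ∈ t, mvfderiv (𝓡 m) (f i) x u := by
  classical
  induction t using Finset.induction_on with
  | empty => simp [mvfderiv_const]
  | insert a t ha ih =>
    have h : ContMDiffAt (𝓡 m) 𝓘(ℝ) ∞ (fun y ↦ ∑ i ∈ t, f i y) x :=
      ContMDiffAt.sum fun i _ ↦ (hf i).self_of_nhds
    simp only [Finset.sum_insert ha]
    rw [mvfderiv_fun_add (hf a).mdiff (h.mdifferentiableAt (by simp)), _root_.add_apply, ih]

/-! ### Inner products of endomorphism fields and commuting frames -/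

section Smoothness

open Filter Topology

variable {m n : ℕ} {M : Type*} [TopologicalSpace M] [T2Space M] [ChartedSpace (Euc m) M]
  [IsManifold (𝓡 m) ∞ M]
  {V : M → Type*} [TopologicalSpace (TotalSpace (Euc n) V)]
  [∀ x, NormedAddCommGroup (V x)] [∀ x, InnerProductSpace ℝ (V x)]
  [FiberBundle (Euc n) V] [VectorBundle ℝ (Euc n) V] [ContMDiffVectorBundle ∞ (Euc n) V (𝓡 m)]
  [IsContMDiffRiemannianBundle (𝓡 m) ∞ (Euc n) V]

variable (n) in
/-- The inner product of endomorphisms of `Vₓ`. -/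
def endInner (x : M) (S T : V x →L[ℝ] V x) : ℝ :=
  have : FiniteDimensional ℝ (V x) := VectorBundle.finiteDimensional ℝ (Euc n) V x
  let e := stdOrthonormalBasis ℝ (V x)
  ∑ a, inner ℝ (S (e a)) (T (e a))

theorem endInner_eq_sum {x : M} (S T : V x →L[ℝ] V x) {ι : Type*} [Fintype ι] {s' s : ι → V x}
    (hs : DualFrames s' s) : endInner n x S T = ∑ a, inner ℝ (S (s' a)) (T (s a)) :=
  have : FiniteDimensional ℝ (V x) := VectorBundle.finiteDimensional ℝ (Euc n) V x
  sum_orthonormal_eq_sum_dual (stdOrthonormalBasis ℝ (V x)) hs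
    ((innerₗ (V x)).compl₁₂ S.toLinearMap T.toLinearMap)

theorem endInner_add_left {x : M} (S S' T : V x →L[ℝ] V x) :
    endInner n x (S + S') T = endInner n x S T + endInner n x S' T := by
  simp only [endInner, _root_.add_apply, inner_add_left, Finset.sum_add_distrib]

theorem endInner_smul_left {x : M} (c : ℝ) (S T : V x →L[ℝ] V x) :
    endInner n x (c • S) T = c * endInner n x S T := by
  simp only [endInner, _root_.smul_apply, inner_smul_left, Finset.mul_sum, conj_trivial]

theorem endInner_sum_left {x : M} {ι : Type*} (t : Finset ι) (S : ι → V x →L[ℝ] V x)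
    (T : V x →L[ℝ] V x) : endInner n x (∑ i ∈ t, S i) T = ∑ i ∈ t, endInner n x (S i) T := by
  simp only [endInner, _root_.sum_apply, sum_inner]
  exact Finset.sum_comm

theorem endInner_zero_right {x : M} (S : V x →L[ℝ] V x) : endInner n x S 0 = 0 := by
  simp [endInner]

theorem endInner_smooth {S T : ∀ x, V x →L[ℝ] V x} (hS : SmoothEnd m n S)
    (hT : SmoothEnd m n T) : ContMDiff (𝓡 m) 𝓘(ℝ) ∞ fun x ↦ endInner n x (S x) (T x) := by
  intro x
  obtain ⟨s', s, hs', hs, hd⟩ := exists_dual_frames (m := m) (F := Euc n) V x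
  have h : ContMDiffAt (𝓡 m) 𝓘(ℝ) ∞
      (fun y ↦ ∑ a, inner ℝ (S y (s' a y)) (T y (s a y))) x :=
    ContMDiffAt.sum fun a _ ↦ SmoothSec.inner (hS _ (hs' a)) (hT _ (hs a)) x
  exact h.congr_of_eventuallyEq (hd.mono fun y hy ↦ endInner_eq_sum _ _ hy)

theorem dualFrames_frame {y : M} (s : Euc n ≃ₗᵢ[ℝ] V y) :
    DualFrames (fun a ↦ s (EuclideanSpace.single a 1)) fun a ↦ s (EuclideanSpace.single a 1) := by
  simpa using (OrthonormalBasis.dualFrames (EuclideanSpace.basisFun (Fin n) ℝ)).map s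

/-- Differentiate the trace in an adapted orthonormal frame. Metric compatibility gives the two
stated terms and a remainder from the derivatives of the frame. -/
theorem mvfderiv_endInner {G : Subgroup (Euc n ≃ₗᵢ[ℝ] Euc n)} {P : GStructure m n V G}
    {D : CovariantDerivative (𝓡 m) (Euc n) V} (hDG : IsGConnection P D)
    {S T : ∀ x, V x →L[ℝ] V x} (hS : SmoothEnd m n S) (hT : SmoothEnd m n T) {x : M}
    {u : TangentSpace (𝓡 m) x} {S' T' : V x →L[ℝ] V x}
    (hS' : ∀ σ : ∀ x, V x, SmoothNear m (Euc n) σ x →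
      S' (σ x) = D (fun y ↦ S y (σ y)) x u - S x (D σ x u))
    (hT' : ∀ σ : ∀ x, V x, SmoothNear m (Euc n) σ x →
      T' (σ x) = D (fun y ↦ T y (σ y)) x u - T x (D σ x u)) :
    mvfderiv (𝓡 m) (fun y ↦ endInner n y (S y) (T y)) x u =
      endInner n x S' (T x) + endInner n x (S x) T' := by
  obtain ⟨U, hU, hx, s, hs⟩ := exists_adapted_frame hDG x
  obtain ⟨-, hsm, hξ⟩ := hs x hx
  obtain ⟨ξ, hξ, hD⟩ := hξ u
  let e (a : Fin n) : Euc n := EuclideanSpace.single a 1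
  have h1 : (fun y ↦ endInner n y (S y) (T y)) =
      fun y ↦ ∑ a, inner ℝ (S y (s y (e a))) (T y (s y (e a))) := by
    ext y; exact endInner_eq_sum _ _ (dualFrames_frame (s y))
  have h2 : mvfderiv (𝓡 m) (fun y ↦ ∑ a, inner ℝ (S y (s y (e a))) (T y (s y (e a)))) x u =
      ∑ a, mvfderiv (𝓡 m) (fun y ↦ inner ℝ (S y (s y (e a))) (T y (s y (e a)))) x u := by
    exact mvfderiv_sum _ (fun a ↦ (hS.near (hsm _)).inner (hT.near (hsm _))) u
  have h4 (a : Fin n) : mvfderiv (𝓡 m) (fun y ↦ inner ℝ (S y (s y (e a))) (T y (s y (e a)))) x u =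
      inner ℝ (S' (s x (e a))) (T x (s x (e a))) + inner ℝ (S x (s x (e a))) (T' (s x (e a))) +
      (inner ℝ (S x (s x (ξ (e a)))) (T x (s x (e a))) +
        inner ℝ (S x (s x (e a))) (T x (s x (ξ (e a))))) := by
    rw [mvfderiv_inner hDG (hS.near (hsm _)) (hT.near (hsm _)), hS' _ (hsm _), hT' _ (hsm _), hD]
    simp only [inner_sub_left, inner_sub_right]
    ring
  -- The remainder vanishes: expanding ξ(eₐ) in the basis leaves coefficients that are antisymmetric
  -- in a and b.
  have h5 : ∑ a, (inner ℝ (S x (s x (ξ (e a)))) (T x (s x (e a))) +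
        inner ℝ (S x (s x (e a))) (T x (s x (ξ (e a))))) = 0 := by
    let f : Euc n →ₗ[ℝ] Euc n →ₗ[ℝ] ℝ := (innerₗ (V x)).compl₁₂
      (S x ∘L ((s x).toContinuousLinearEquiv : Euc n →L[ℝ] V x)).toLinearMap
      (T x ∘L ((s x).toContinuousLinearEquiv : Euc n →L[ℝ] V x)).toLinearMap
    have hf : ∀ w w', inner ℝ (S x (s x w)) (T x (s x w')) = f w w' := fun _ _ ↦ rfl
    simp only [hf]
    have hexp (w : Euc n) : w = ∑ b, inner ℝ (e b) w • e b := by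
      simpa [e] using ((EuclideanSpace.basisFun (Fin n) ℝ).sum_repr' w).symm
    have h6 : ∑ a, f (ξ (e a)) (e a) = ∑ a, ∑ b, inner ℝ (e b) (ξ (e a)) * f (e b) (e a) := by
      refine Finset.sum_congr rfl fun a _ ↦ ?_
      conv_lhs => rw [hexp (ξ (e a))]
      simp
    have h7 : ∑ a, f (e a) (ξ (e a)) = ∑ a, ∑ b, inner ℝ (e b) (ξ (e a)) * f (e a) (e b) := by
      refine Finset.sum_congr rfl fun a _ ↦ ?_
      conv_lhs => rw [hexp (ξ (e a))]
      simp
    rw [Finset.sum_add_distrib, h6, h7, Finset.sum_comm (f := fun a b ↦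
      inner ℝ (e b) (ξ (e a)) * f (e a) (e b)), ← Finset.sum_add_distrib]
    refine Finset.sum_eq_zero fun a _ ↦ ?_
    rw [← Finset.sum_add_distrib]
    refine Finset.sum_eq_zero fun b _ ↦ ?_
    have h8 := lieAlg_skew hξ (e a) (e b)
    rw [real_inner_comm] at h8
    rw [← add_mul, h8, zero_mul]
  rw [h1, h2]
  simp only [h4]
  rw [Finset.sum_add_distrib, h5, add_zero, Finset.sum_add_distrib,
    endInner_eq_sum _ _ (dualFrames_frame (s x)), endInner_eq_sum _ _ (dualFrames_frame (s x))]

variable [RiemannianBundle (fun x : M ↦ TangentSpace (𝓡 m) x)]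
  [IsContMDiffRiemannianBundle (𝓡 m) ∞ (Euc m) (fun x : M ↦ TangentSpace (𝓡 m) x)]

theorem oneInner_smooth {φ ψ : EndForm m V} (hφ : SmoothEndForm n φ) (hψ : SmoothEndForm n ψ) :
    ContMDiff (𝓡 m) 𝓘(ℝ) ∞ fun x ↦ oneInner n x (φ x) (ψ x) := by
  intro x
  obtain ⟨s', s, hs', hs, hd⟩ := exists_dual_frames (m := m) (F := Euc n) V x
  obtain ⟨X', X, hX', hX, hd'⟩ := exists_dual_frames (m := m) (F := Euc m)
    (fun x : M ↦ TangentSpace (𝓡 m) x) x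
  have h : ContMDiffAt (𝓡 m) 𝓘(ℝ) ∞
      (fun y ↦ ∑ i, ∑ a, inner ℝ (φ y (X' i y) (s' a y)) (ψ y (X i y) (s a y))) x :=
    ContMDiffAt.sum fun i _ ↦ ContMDiffAt.sum fun a _ ↦
      SmoothSec.inner (smoothEndForm_iff.1 hφ _ _ (hX' i) (hs' a))
        (smoothEndForm_iff.1 hψ _ _ (hX i) (hs a)) x
  refine h.congr_of_eventuallyEq ?_
  filter_upwards [hd, hd'] with y hy hy'
  exact oneInner_eq_sum _ _ hy' hy

theorem formInner_smooth
    {A B : ∀ x : M, TangentSpace (𝓡 m) x → TangentSpace (𝓡 m) x → V x → V x}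
    (hA : ∀ x, Trilinear (A x)) (hB : ∀ x, Trilinear (B x))
    (hAs : ∀ (X Y : ∀ x : M, TangentSpace (𝓡 m) x) (σ : ∀ x, V x), SmoothSec m (Euc m) X →
      SmoothSec m (Euc m) Y → SmoothSec m (Euc n) σ →
      SmoothSec m (Euc n) fun x ↦ A x (X x) (Y x) (σ x))
    (hBs : ∀ (X Y : ∀ x : M, TangentSpace (𝓡 m) x) (σ : ∀ x, V x), SmoothSec m (Euc m) X →
      SmoothSec m (Euc m) Y → SmoothSec m (Euc n) σ →
      SmoothSec m (Euc n) fun x ↦ B x (X x) (Y x) (σ x)) :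
    ContMDiff (𝓡 m) 𝓘(ℝ) ∞ fun x ↦ formInner n x (A x) (B x) := by
  intro x
  obtain ⟨s', s, hs', hs, hd⟩ := exists_dual_frames (m := m) (F := Euc n) V x
  obtain ⟨X', X, hX', hX, hd'⟩ := exists_dual_frames (m := m) (F := Euc m)
    (fun x : M ↦ TangentSpace (𝓡 m) x) x
  have h : ContMDiffAt (𝓡 m) 𝓘(ℝ) ∞ (fun y ↦ ∑ i, ∑ j, ∑ a,
      inner ℝ (A y (X' i y) (X' j y) (s' a y)) (B y (X i y) (X j y) (s a y))) x :=
    ContMDiffAt.sum fun i _ ↦ ContMDiffAt.sum fun j _ ↦ ContMDiffAt.sum fun a _ ↦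
      SmoothSec.inner (hAs _ _ _ (hX' i) (hX' j) (hs' a)) (hBs _ _ _ (hX i) (hX j) (hs a)) x
  refine h.congr_of_eventuallyEq ?_
  filter_upwards [hd, hd'] with y hy hy'
  exact formInner_eq_sum (hA y) (hB y) hy' hy

variable [MeasurableSpace M] [BorelSpace M] [CompactSpace M]

theorem integrable_of_smooth {f : M → ℝ} (hf : ContMDiff (𝓡 m) 𝓘(ℝ) ∞ f) :
    Integrable f (riemVol m M) :=
  have : IsLocallyFiniteMeasure (riemVol m M) := riemVol_isLocallyFinite
  hf.continuous.integrable_of_hasCompactSupport (HasCompactSupport.of_compactSpace f)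

/-- Around every point there are a frame of commuting vector fields and a dual frame, and the
divergence theorem holds for the fields of the frame. -/
theorem exists_divergence_frame (x : M) :
    ∃ (U : Set M) (X' X : Fin m → ∀ y : M, TangentSpace (𝓡 m) y) (θ : Fin m → M → ℝ),
      IsOpen U ∧ x ∈ U ∧ (∀ i, SmoothSec m (Euc m) (X' i)) ∧ (∀ i, SmoothSec m (Euc m) (X i)) ∧
      (∀ i, ContMDiff (𝓡 m) 𝓘(ℝ) ∞ (θ i)) ∧
      (∀ y ∈ U, DualFrames (fun i ↦ X' i y) fun i ↦ X i y) ∧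
      (∀ y ∈ U, ∀ i j, VectorField.mlieBracket (𝓡 m) (X i) (X j) y = 0) ∧
      ∀ i, ∀ f : M → ℝ, ContMDiff (𝓡 m) 𝓘(ℝ) ∞ f → tsupport f ⊆ U →
        ∫ y, (mvfderiv (𝓡 m) f y (X i y) + θ i y * f y) ∂riemVol m M = 0 := by
  have hx : x ∈ (extChartAt (𝓡 m) x).source := mem_extChartAt_source x
  have hc (i : Fin m) := coordField_smoothNear hx i
  obtain ⟨Y, hY, hd⟩ := exists_dual_of_frame hc
    ((eventually_mem_extChartAt_source hx).mono fun y hy ↦ coordField_frame hy)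
  choose X hX hXe using fun i ↦ exists_global_section (hc i)
  choose X' hX' hXe' using fun i ↦ exists_global_section (hY i)
  choose θ hθ hθe using fun i ↦ exists_global_fn (coordDiv_smoothNear hx i)
  -- U is chosen so that the globally smooth replacements coincide on it with the coordinate fields,
  -- the dual frame and the divergences.
  obtain ⟨U, hU, hUo, hxU⟩ := eventually_nhds_iff.1 ((((eventually_all.2 hXe).and
    (eventually_all.2 hXe')).and (eventually_all.2 hθe)).and
    (hd.and (eventually_mem_extChartAt_source hx)))
  refine ⟨U, X', X, θ, hUo, hxU, hX', hX, hθ, fun y hy ↦ ?_, fun y hy i j ↦ ?_, fun i f hf ht ↦ ?_⟩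
  · obtain ⟨⟨⟨h1, h2⟩, -⟩, h3, -⟩ := hU y hy
    simpa only [h1, h2] using h3
  · have h (i) : X i =ᶠ[𝓝 y] coordField x i := by
      filter_upwards [hUo.mem_nhds hy] with z hz
      exact (hU z hz).1.1.1 i
    rw [(h i).mlieBracket_vectorField_eq (h j)]
    exact coordField_bracket (hU y hy).2.2 i j
  · rw [← integral_coordField_add hf (fun y hy ↦ (hU y (ht hy)).2.2) i]
    refine integral_congr_ae (Eventually.of_forall fun y ↦ ?_)
    dsimp only
    by_cases hy : y ∈ tsupport f
    · rw [(hU y (ht hy)).1.1.1 i, (hU y (ht hy)).1.2 i]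
    · have h0 : f =ᶠ[𝓝 y] fun _ ↦ (0 : ℝ) := notMem_tsupport_iff_eventuallyEq.1 hy
      rw [mvfderiv_congr h0, h0.self_of_nhds, mvfderiv_const]
      simp

end Smoothness

section Codifferential

open Filter Topology

variable {m n : ℕ} {M : Type*} [TopologicalSpace M] [T2Space M] [ChartedSpace (Euc m) M]
  [IsManifold (𝓡 m) ∞ M]
  {V : M → Type*} [TopologicalSpace (TotalSpace (Euc n) V)]
  [∀ x, NormedAddCommGroup (V x)] [∀ x, InnerProductSpace ℝ (V x)]
  [FiberBundle (Euc n) V] [VectorBundle ℝ (Euc n) V] [ContMDiffVectorBundle ∞ (Euc n) V (𝓡 m)]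
  {D : CovariantDerivative (𝓡 m) (Euc n) V}

theorem endInner_comm {x : M} (S T : V x →L[ℝ] V x) : endInner n x S T = endInner n x T S := by
  simp only [endInner]
  exact Finset.sum_congr rfl fun a _ ↦ real_inner_comm _ _

theorem endInner_sub_right {x : M} (S T T' : V x →L[ℝ] V x) :
    endInner n x S (T - T') = endInner n x S T - endInner n x S T' := by
  simp only [endInner, _root_.sub_apply, inner_sub_right, Finset.sum_sub_distrib]

theorem endInner_neg_left {x : M} (S T : V x →L[ℝ] V x) :
    endInner n x (-S) T = -endInner n x S T := by
  simp only [endInner, _root_.neg_apply, inner_neg_left, Finset.sum_neg_distrib]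

theorem SmoothEnd.add {S T : ∀ x, V x →L[ℝ] V x} (hS : SmoothEnd m n S) (hT : SmoothEnd m n T) :
    SmoothEnd m n fun x ↦ S x + T x :=
  fun σ hσ ↦ ContMDiff.add_section (hS σ hσ) (hT σ hσ)

theorem SmoothEnd.smul {f : M → ℝ} (hf : ContMDiff (𝓡 m) 𝓘(ℝ) ∞ f) {S : ∀ x, V x →L[ℝ] V x}
    (hS : SmoothEnd m n S) : SmoothEnd m n fun x ↦ f x • S x :=
  fun σ hσ ↦ ContMDiff.smul_section hf (hS σ hσ)

theorem SmoothEnd.sum {ι : Type*} (t : Finset ι) {S : ι → ∀ x, V x →L[ℝ] V x}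
    (hS : ∀ i, SmoothEnd m n (S i)) : SmoothEnd m n fun x ↦ ∑ i ∈ t, S i x := fun σ hσ ↦ by
  simp only [_root_.sum_apply]
  exact ContMDiff.sum_section fun i _ ↦ hS i σ hσ

theorem SmoothEndForm.smul {f : M → ℝ} (hf : ContMDiff (𝓡 m) 𝓘(ℝ) ∞ f) {φ : EndForm m V}
    (hφ : SmoothEndForm n φ) : SmoothEndForm n (f • φ) :=
  smoothEndForm_iff.2 fun X σ hX hσ ↦
    ContMDiff.smul_section hf (smoothEndForm_iff.1 hφ X σ hX hσ)

theorem SmoothEndForm.sum {ι : Type*} (t : Finset ι) {φ : ι → EndForm m V}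
    (hφ : ∀ i, SmoothEndForm n (φ i)) : SmoothEndForm n (∑ i ∈ t, φ i) :=
  smoothEndForm_iff.2 fun X σ hX hσ ↦ by
    simp only [Finset.sum_apply, _root_.sum_apply]
    exact ContMDiff.sum_section fun i _ ↦ smoothEndForm_iff.1 (hφ i) X σ hX hσ

theorem extCov_add {φ ψ : EndForm m V} (hφ : SmoothEndForm n φ) (hψ : SmoothEndForm n ψ) (x : M)
    (u v : TangentSpace (𝓡 m) x) (w : V x) :
    extCov D (φ + ψ) x u v w = extCov D φ x u v w + extCov D ψ x u v w := by
  have hu := smoothNear_extend (m := m) (Euc m) u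
  have hv := smoothNear_extend (m := m) (Euc m) v
  have hw := smoothNear_extend (m := m) (Euc n) w
  have key {X : ∀ x : M, TangentSpace (𝓡 m) x} (hX : SmoothNear m (Euc m) X x) :
      D (fun y ↦ (φ + ψ) y (X y) (FiberBundle.extend (Euc n) w y)) x =
        D (fun y ↦ φ y (X y) (FiberBundle.extend (Euc n) w y)) x +
          D (fun y ↦ ψ y (X y) (FiberBundle.extend (Euc n) w y)) x :=
    cov_add (hφ.near hX hw) (hψ.near hX hw)
  simp only [extCov, extCovFields, covEnd]
  rw [key hu, key hv]
  simp only [Pi.add_apply, _root_.add_apply]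
  abel

theorem extCov_eq_zero {φ : EndForm m V} {x : M} (h : ∀ᶠ y in 𝓝 x, φ y = 0)
    (u v : TangentSpace (𝓡 m) x) (w : V x) : extCov D φ x u v w = 0 := by
  have h0 : SmoothNear m (Euc n) (0 : ∀ y, V y) x :=
    Eventually.of_forall (contMDiff_zeroSection ℝ V)
  have key (X : ∀ x : M, TangentSpace (𝓡 m) x) (σ : ∀ x, V x) :
      D (fun y ↦ φ y (X y) (σ y)) x = 0 := by
    rw [← cov_congr h0 (h.mono fun y hy ↦ by rw [hy]; rfl)]
    exact D.isCovariantDerivativeOnUniv.zero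
  simp only [extCov, extCovFields, covEnd]
  rw [key, key, h.self_of_nhds]
  simp

variable [RiemannianBundle (fun x : M ↦ TangentSpace (𝓡 m) x)]

theorem oneInner_sum_left {x : M} {ι : Type*} (t : Finset ι)
    (A : ι → TangentSpace (𝓡 m) x →L[ℝ] V x →L[ℝ] V x)
    (B : TangentSpace (𝓡 m) x →L[ℝ] V x →L[ℝ] V x) :
    oneInner n x (∑ i ∈ t, A i) B = ∑ i ∈ t, oneInner n x (A i) B := by
  simp only [oneInner, _root_.sum_apply, sum_inner]
  rw [Finset.sum_comm]
  conv_rhs => rw [Finset.sum_comm]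
  rw [Finset.sum_comm]
  exact Finset.sum_congr rfl fun _ _ ↦ Finset.sum_comm

theorem oneInner_smul_left {x : M} (c : ℝ)
    (A B : TangentSpace (𝓡 m) x →L[ℝ] V x →L[ℝ] V x) :
    oneInner n x (c • A) B = c * oneInner n x A B := by
  simp only [oneInner, _root_.smul_apply, inner_smul_left, Finset.mul_sum, conj_trivial]

theorem oneInner_eq_sum_endInner {x : M} (A B : TangentSpace (𝓡 m) x →L[ℝ] V x →L[ℝ] V x)
    {κ : Type*} [Fintype κ] {X' X : κ → TangentSpace (𝓡 m) x} (hX : DualFrames X' X) :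
    oneInner n x A B = ∑ i, endInner n x (A (X' i)) (B (X i)) :=
  have : FiniteDimensional ℝ (V x) := VectorBundle.finiteDimensional ℝ (Euc n) V x
  oneInner_eq_sum A B hX (OrthonormalBasis.dualFrames (stdOrthonormalBasis ℝ (V x)))

theorem formInner_eq_sum_endInner {x : M}
    {A B : TangentSpace (𝓡 m) x → TangentSpace (𝓡 m) x → V x → V x}
    (hA : Trilinear A) (hB : Trilinear B) {κ : Type*} [Fintype κ]
    {X' X : κ → TangentSpace (𝓡 m) x} (hX : DualFrames X' X) {S T : κ → κ → V x →L[ℝ] V x}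
    (hS : ∀ i j w, S i j w = A (X' i) (X' j) w) (hT : ∀ i j w, T i j w = B (X i) (X j) w) :
    formInner n x A B = ∑ i, ∑ j, endInner n x (S i j) (T i j) := by
  have : FiniteDimensional ℝ (V x) := VectorBundle.finiteDimensional ℝ (Euc n) V x
  rw [formInner_eq_sum hA hB hX (OrthonormalBasis.dualFrames (stdOrthonormalBasis ℝ (V x)))]
  simp only [← hS, ← hT]
  rfl

variable [IsContMDiffRiemannianBundle (𝓡 m) ∞ (Euc n) V]
  [IsContMDiffRiemannianBundle (𝓡 m) ∞ (Euc m) (fun x : M ↦ TangentSpace (𝓡 m) x)]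
  [MeasurableSpace M] [BorelSpace M] [CompactSpace M]
  {G : Subgroup (Euc n ≃ₗᵢ[ℝ] Euc n)} {P : GStructure m n V G}

theorem formInner_curv_extCov_smooth (hD : CovariantDerivative.ContMDiffCovariantDerivative D ∞)
    {φ : EndForm m V} (hφ : SmoothEndForm n φ) :
    ContMDiff (𝓡 m) 𝓘(ℝ) ∞ fun x ↦ formInner n x (curv D x) (extCov D φ x) :=
  formInner_smooth (curv_trilinear hD) (extCov_trilinear hD hφ)
    (fun _ _ _ ↦ curv_smooth hD) fun _ _ _ ↦ extCov_smooth hD hφ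

theorem firstVariation_add (hD : CovariantDerivative.ContMDiffCovariantDerivative D ∞)
    {φ ψ : EndForm m V} (hφ : SmoothEndForm n φ) (hψ : SmoothEndForm n ψ) :
    firstVariation D (φ + ψ) = firstVariation D φ + firstVariation D ψ := by
  rw [firstVariation, firstVariation, firstVariation,
    ← integral_add (integrable_of_smooth (formInner_curv_extCov_smooth hD hφ))
      (integrable_of_smooth (formInner_curv_extCov_smooth hD hψ))]
  refine integral_congr_ae (Eventually.of_forall fun x ↦ ?_)
  dsimp only
  rw [← formInner_add_right]
  congr 1
  ext u v w
  exact extCov_add hφ hψ x u v w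

theorem firstVariation_sum (hD : CovariantDerivative.ContMDiffCovariantDerivative D ∞)
    {ι : Type*} (t : Finset ι) {φ : ι → EndForm m V} (hφ : ∀ i, SmoothEndForm n (φ i)) :
    firstVariation D (∑ i ∈ t, φ i) = ∑ i ∈ t, firstVariation D (φ i) := by
  classical
  induction t using Finset.induction_on with
  | empty =>
    simp only [Finset.sum_empty, firstVariation]
    refine integral_eq_zero_of_ae (Eventually.of_forall fun x ↦ ?_)
    have h (u v w) : extCov D (0 : EndForm m V) x u v w = 0 :=
      extCov_eq_zero (Eventually.of_forall fun _ ↦ rfl) u v w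
    simp [formInner, h]
  | insert a t ha ih =>
    rw [Finset.sum_insert ha, Finset.sum_insert ha, ← ih,
      firstVariation_add hD (hφ a) (SmoothEndForm.sum t hφ)]

/-- The codifferential of the curvature near a point. -/
theorem exists_local_codifferential (hD : CovariantDerivative.ContMDiffCovariantDerivative D ∞)
    (hDG : IsGConnection P D) (x : M) :
    ∃ U : Set M, IsOpen U ∧ x ∈ U ∧ ∃ J : EndForm m V, SmoothEndForm n J ∧
      (∀ y u, J y u ∈ adP P y) ∧ ∀ ψ : EndForm m V, SmoothEndForm n ψ → ∀ C : Set M, IsClosed C →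
        C ⊆ U → (∀ y ∉ C, ψ y = 0) →
        firstVariation D ψ = ∫ y, oneInner n y (J y) (ψ y) ∂riemVol m M := by
  obtain ⟨U, X', X, θ, hU, hxU, hX', hX, hθ, hdual, hbr, hdiv⟩ :=
    exists_divergence_frame (m := m) x
  choose H hHs hH using fun i j ↦ exists_curvEndo hD (hX' i) (hX' j)
  choose T hTs hT using fun i j ↦ exists_covEndo hD (hHs i j) (hX i)
  -- Minus the divergence of F in the frame: Tᵢⱼ is the covariant derivative of Hᵢⱼ = F(X'ᵢ, X'ⱼ)
  -- along Xᵢ, and θᵢ is the divergence of Xᵢ. The factor 2 arises because `formInner` sums over all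
  -- ordered pairs.
  let c (j : Fin m) (y : M) : V y →L[ℝ] V y :=
    (-2 : ℝ) • ∑ i, (T i j y + θ i y • H i j y)
  have hcs (j) : SmoothEnd m n (c j) := SmoothEnd.smul contMDiff_const
    (SmoothEnd.sum _ fun i ↦ (hTs i j).add (SmoothEnd.smul (hθ i) (hHs i j)))
  have hHad (i j y) : H i j y ∈ adSub P y := curv_mem_adP hD hDG (hH i j y)
  have hTad (i j y) : T i j y ∈ adSub P y := covEndo_mem_adP hDG (hHs i j)
    (Eventually.of_forall (hHad i j)) (hT i j y)
  have hcad (j y) : c j y ∈ adSub P y := Submodule.smul_mem _ _ <| Submodule.sum_mem _ fun i _ ↦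
    Submodule.add_mem _ (hTad i j y) (Submodule.smul_mem _ _ (hHad i j y))
  let J : EndForm m V := fun y ↦ ∑ j, (innerSL ℝ (X j y)).smulRight (c j y)
  have hJ (y : M) (u : TangentSpace (𝓡 m) y) : J y u = ∑ j, inner ℝ (X j y) u • c j y := by
    simp only [J, _root_.sum_apply]
    rfl
  have hJs : SmoothEndForm n J := smoothEndForm_iff.2 fun Y σ hY hσ ↦ by
    simp only [hJ, _root_.sum_apply, _root_.smul_apply]
    exact ContMDiff.sum_section fun j _ ↦
      ContMDiff.smul_section (SmoothSec.inner (hX j) hY) (hcs j σ hσ)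
  refine ⟨U, hU, hxU, J, hJs, fun y u ↦ ?_, fun ψ hψ C hC hCU hψC ↦ ?_⟩
  · rw [hJ]
    exact Submodule.sum_mem (adSub P y) fun j _ ↦ Submodule.smul_mem _ _ (hcad j y)
  have hψX (j) := hψ.smoothEnd (hX j)
  choose Q hQs hQ using fun i j ↦ exists_covEndo hD (hψX j) (hX i)
  -- The functions fed to the divergence theorem. Their derivative along Xᵢ splits into a term with
  -- the derivative of F, which builds J, and a term with the derivative of ψ, which builds Dψ.
  let f (i j : Fin m) (y : M) : ℝ := endInner n y (H i j y) (ψ y (X j y))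
  have hf (i j) : ContMDiff (𝓡 m) 𝓘(ℝ) ∞ (f i j) := endInner_smooth (hHs i j) (hψX j)
  have hf0 (i j y) (hy : y ∉ C) : f i j y = 0 := by
    simp only [f, hψC y hy, _root_.zero_apply, endInner_zero_right]
  have hft (i j) : tsupport (f i j) ⊆ U := by
    have hsub : Function.support (f i j) ⊆ C := fun y hy ↦ by_contra fun h ↦ hy (hf0 i j y h)
    exact (closure_minimal hsub hC).trans hCU
  let d (i j : Fin m) (y : M) : ℝ := mvfderiv (𝓡 m) (f i j) y (X i y) + θ i y * f i j y
  have hds (i j) : ContMDiff (𝓡 m) 𝓘(ℝ) ∞ (d i j) :=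
    (contMDiff_mvfderiv_apply (hf i j) (hX i)).add ((hθ i).mul (hf i j))
  have hd0 (i j) : ∫ y, d i j y ∂riemVol m M = 0 := hdiv i _ (hf i j) (hft i j)
  -- Integration by parts in pointwise form: the two integrands differ by divergences. Off C every
  -- term is zero.
  have key (y : M) : formInner n y (curv D y) (extCov D ψ y) - oneInner n y (J y) (ψ y) =
      2 * ∑ i, ∑ j, d i j y := by
    by_cases hy : y ∈ C
    · have hyU := hCU hy
      -- The frame fields commute on U, so the bracket term of Dψ is absent.
      have hE (i j w) : (Q i j y - Q j i y) w = extCov D ψ y (X i y) (X j y) w := by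
        have hw := smoothNear_extend (m := m) (Euc n) w
        have h1 := extCovFields_eq_extCov hD hψ ((hX i).near y) ((hX j).near y) hw
        rw [FiberBundle.extend_apply_self] at h1
        have h2 := hQ i j y _ hw
        have h3 := hQ j i y _ hw
        rw [FiberBundle.extend_apply_self] at h2 h3
        rw [← h1, extCovFields, covEnd, covEnd, _root_.sub_apply, h2, h3, hbr y hyU i j]
        simp
      have hskew (i j) : H j i y = -H i j y := by
        ext w
        rw [_root_.neg_apply, hH, hH, curv_swap]
      -- Skewness of F in i, j makes both halves of Qᵢⱼ − Qⱼᵢ contribute equally.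
      have h1 : formInner n y (curv D y) (extCov D ψ y) =
          2 * ∑ i, ∑ j, endInner n y (H i j y) (Q i j y) := by
        rw [formInner_eq_sum_endInner (curv_trilinear hD y) (extCov_trilinear hD hψ y)
          (hdual y hyU) (fun i j ↦ hH i j y) hE]
        simp only [endInner_sub_right, Finset.sum_sub_distrib]
        rw [Finset.sum_comm (f := fun i j ↦ endInner n y (H i j y) (Q j i y))]
        have h0 (i j : Fin m) : endInner n y (H j i y) (Q i j y) = -endInner n y (H i j y) (Q i j y) := by
          rw [hskew, endInner_neg_left]
        simp only [h0, Finset.sum_neg_distrib]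
        ring
      have h2 : oneInner n y (J y) (ψ y) = ∑ j, endInner n y (c j y) (ψ y (X j y)) := by
        rw [oneInner_eq_sum_endInner _ _ (hdual y hyU)]
        simp only [hJ, endInner_sum_left, endInner_smul_left]
        rw [Finset.sum_comm]
        refine Finset.sum_congr rfl fun j _ ↦ ?_
        generalize c j y = a
        conv_rhs => rw [hdual y hyU (X j y), map_sum, endInner_comm, endInner_sum_left]
        refine Finset.sum_congr rfl fun k _ ↦ ?_
        rw [map_smul, endInner_smul_left, endInner_comm a, real_inner_comm]
      have h3 (j) : endInner n y (c j y) (ψ y (X j y)) =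
          -2 * ∑ i, (endInner n y (T i j y) (ψ y (X j y)) + θ i y * f i j y) := by
        simp only [c, endInner_smul_left, endInner_sum_left, endInner_add_left, f]
      have h4 (i j) : d i j y = endInner n y (T i j y) (ψ y (X j y)) +
          endInner n y (H i j y) (Q i j y) + θ i y * f i j y := by
        simp only [d, f]
        rw [mvfderiv_endInner hDG (hHs i j) (hψX j) (hT i j y) (hQ i j y)]
      rw [h1, h2]
      simp only [h3, h4]
      rw [← Finset.mul_sum, Finset.sum_comm (f := fun j i ↦
        endInner n y (T i j y) (ψ y (X j y)) + θ i y * f i j y)]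
      simp only [Finset.sum_add_distrib]
      ring
    · have hev : ∀ᶠ z in 𝓝 y, z ∉ C := hC.isOpen_compl.mem_nhds hy
      have h1 (u v w) : extCov D ψ y u v w = 0 := extCov_eq_zero (hev.mono hψC) u v w
      have h2 (i j) : d i j y = 0 := by
        have h3 : f i j =ᶠ[𝓝 y] fun _ ↦ (0 : ℝ) := hev.mono (hf0 i j)
        simp only [d]
        rw [mvfderiv_congr h3, mvfderiv_const, hf0 i j y hy]
        simp
      have h3 : oneInner n y (J y) (ψ y) = 0 := by
        rw [hψC y hy, oneInner_comm, oneInner_zero_left]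
      rw [h3]
      simp [formInner, h1, h2]
  rw [← sub_eq_zero, firstVariation, ← integral_sub
    (integrable_of_smooth (formInner_curv_extCov_smooth hD hψ))
    (integrable_of_smooth (oneInner_smooth hJs hψ))]
  simp only [key]
  rw [integral_const_mul, integral_finsetSum _ fun i _ ↦
    integrable_finsetSum _ fun j _ ↦ integrable_of_smooth (hds i j)]
  simp only [integral_finsetSum _ fun j _ ↦ integrable_of_smooth (hds _ j), hd0]
  simp

/-- The codifferential of the curvature of a `G`-connection: it represents the first variation and
has values in `ad P`. -/
theorem exists_codifferential (hD : CovariantDerivative.ContMDiffCovariantDerivative D ∞)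
    (hDG : IsGConnection P D) :
    ∃ J : EndForm m V, IsAdForm P J ∧ ∀ φ : EndForm m V, SmoothEndForm n φ →
      firstVariation D φ = ∫ y, oneInner n y (J y) (φ y) ∂riemVol m M := by
  choose U hU hxU J hJs hJad hJ using exists_local_codifferential (n := n) hD hDG
  obtain ⟨t, ht⟩ := isCompact_univ.elim_finite_subcover U hU
    fun x _ ↦ Set.mem_iUnion.2 ⟨x, hxU x⟩
  obtain ⟨ρ, hρ⟩ := SmoothPartitionOfUnity.exists_isSubordinate (𝓡 m) isClosed_univ
    (fun x : t ↦ U x) (fun x ↦ hU x) fun y _ ↦ by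
      obtain ⟨x, hx, hy⟩ := Set.mem_iUnion₂.1 (ht (Set.mem_univ y))
      exact Set.mem_iUnion.2 ⟨⟨x, hx⟩, hy⟩
  have hsum (y : M) : ∑ i, ρ i y = 1 := by
    rw [← finsum_eq_sum_of_fintype]
    exact ρ.sum_eq_one (Set.mem_univ y)
  let J' : EndForm m V := ∑ i : t, (ρ i : M → ℝ) • J i
  have hρs (i) : ContMDiff (𝓡 m) 𝓘(ℝ) ∞ (ρ i) := (ρ i).contMDiff
  have hJs' : SmoothEndForm n J' := SmoothEndForm.sum _ fun i ↦ SmoothEndForm.smul (hρs i) (hJs i)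
  refine ⟨J', ⟨hJs', fun y u ↦ ?_⟩, fun φ hφ ↦ ?_⟩
  · have : J' y u = ∑ i : t, ρ i y • J i y u := by
      simp only [J', Finset.sum_apply, _root_.sum_apply]
      rfl
    rw [this]
    exact Submodule.sum_mem (adSub P y) fun i _ ↦ Submodule.smul_mem _ _ (hJad i y u)
  -- Each piece ρᵢφ is supported in the domain of its own local representative; by symmetry of the
  -- pairing ρᵢ can be moved onto Jᵢ.
  have hφsum : φ = ∑ i : t, (ρ i : M → ℝ) • φ := by
    ext1 y
    rw [Finset.sum_apply]
    simp only [Pi.smul_apply']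
    rw [← Finset.sum_smul, hsum, one_smul]
  conv_lhs => rw [hφsum, firstVariation_sum hD _ fun i ↦ SmoothEndForm.smul (hρs i) hφ]
  have h1 (i : t) : firstVariation D ((ρ i : M → ℝ) • φ) =
      ∫ y, ρ i y * oneInner n y (J i y) (φ y) ∂riemVol m M := by
    rw [hJ i _ (SmoothEndForm.smul (hρs i) hφ) (tsupport (ρ i)) (isClosed_tsupport _) (hρ i)
      fun y hy ↦ by
        rw [Pi.smul_apply', image_eq_zero_of_notMem_tsupport hy]
        exact zero_smul ℝ (φ y)]
    refine integral_congr_ae (Eventually.of_forall fun y ↦ ?_)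
    dsimp only
    rw [oneInner_comm, Pi.smul_apply', oneInner_smul_left, oneInner_comm]
  have h2 (y : M) : oneInner n y (J' y) (φ y) = ∑ i, ρ i y * oneInner n y (J i y) (φ y) := by
    simp only [J', Finset.sum_apply, oneInner_sum_left, Pi.smul_apply', oneInner_smul_left]
  simp only [h1, h2]
  have hint (i : t) : Integrable (fun y ↦ ρ i y * oneInner n y (J i y) (φ y)) (riemVol m M) :=
    integrable_of_smooth ((hρs i).mul (oneInner_smooth (hJs i) hφ))
  rw [integral_finsetSum _ fun i _ ↦ hint i]

end Codifferential


/-! ### The derivative of the Yang-Mills functional -/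

section Variation

theorem integral_quartic {α : Type*} [MeasurableSpace α] {μ : Measure α} {f₀ f₁ f₂ f₃ f₄ : α → ℝ}
    (h₀ : Integrable f₀ μ) (h₁ : Integrable f₁ μ) (h₂ : Integrable f₂ μ) (h₃ : Integrable f₃ μ)
    (h₄ : Integrable f₄ μ) (t : ℝ) :
    ∫ x, f₀ x + t * f₁ x + t ^ 2 * f₂ x + t ^ 3 * f₃ x + t ^ 4 * f₄ x ∂μ =
      ∫ x, f₀ x ∂μ + t * ∫ x, f₁ x ∂μ + t ^ 2 * ∫ x, f₂ x ∂μ + t ^ 3 * ∫ x, f₃ x ∂μ +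
        t ^ 4 * ∫ x, f₄ x ∂μ := by
  have k₁ := h₁.const_mul t
  have k₂ := h₂.const_mul (t ^ 2)
  have k₃ := h₃.const_mul (t ^ 3)
  have k₄ := h₄.const_mul (t ^ 4)
  have s₁ : Integrable (fun x ↦ f₀ x + t * f₁ x) μ := h₀.add k₁
  have s₂ : Integrable (fun x ↦ f₀ x + t * f₁ x + t ^ 2 * f₂ x) μ := s₁.add k₂
  have s₃ : Integrable (fun x ↦ f₀ x + t * f₁ x + t ^ 2 * f₂ x + t ^ 3 * f₃ x) μ := s₂.add k₃
  rw [integral_add s₃ k₄, integral_add s₂ k₃, integral_add s₁ k₂, integral_add h₀ k₁]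
  simp only [integral_const_mul]

open Filter Topology

variable {m n : ℕ} {M : Type*} [TopologicalSpace M] [T2Space M] [CompactSpace M]
  [ChartedSpace (Euc m) M] [IsManifold (𝓡 m) ∞ M] [MeasurableSpace M] [BorelSpace M]
  [RiemannianBundle (fun x : M ↦ TangentSpace (𝓡 m) x)]
  [IsContMDiffRiemannianBundle (𝓡 m) ∞ (Euc m) (fun x : M ↦ TangentSpace (𝓡 m) x)]
  {V : M → Type*} [TopologicalSpace (TotalSpace (Euc n) V)]
  [∀ x, NormedAddCommGroup (V x)] [∀ x, InnerProductSpace ℝ (V x)]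
  [FiberBundle (Euc n) V] [VectorBundle ℝ (Euc n) V] [ContMDiffVectorBundle ∞ (Euc n) V (𝓡 m)]
  [IsContMDiffRiemannianBundle (𝓡 m) ∞ (Euc n) V]
  {D : CovariantDerivative (𝓡 m) (Euc n) V}

/-- By `curv_vary` the integrand is a polynomial of degree four in t with smooth, hence integrable,
coefficients. So no differentiation under the integral sign is needed. -/
theorem YM_vary (hD : CovariantDerivative.ContMDiffCovariantDerivative D ∞)
    {φ : EndForm m V} (hφ : SmoothEndForm n φ) : ∃ a b c : ℝ, ∀ t : ℝ,
    YM (vary D φ t) = YM D + t * firstVariation D φ + t ^ 2 * a + t ^ 3 * b + t ^ 4 * c := by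
  have hF := curv_trilinear (D := D) hD
  have hF' (X Y : ∀ x : M, TangentSpace (𝓡 m) x) (σ : ∀ x, V x) (hX : SmoothSec m (Euc m) X)
    (hY : SmoothSec m (Euc m) Y) (hσ : SmoothSec m (Euc n) σ) := curv_smooth hD hX hY hσ
  have hE := extCov_trilinear (D := D) hD hφ
  have hE' (X Y : ∀ x : M, TangentSpace (𝓡 m) x) (σ : ∀ x, V x) (hX : SmoothSec m (Euc m) X)
    (hY : SmoothSec m (Euc m) Y) (hσ : SmoothSec m (Euc n) σ) := extCov_smooth hD hφ hX hY hσ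
  have hW := wedgeSq_trilinear φ
  have hW' (X Y : ∀ x : M, TangentSpace (𝓡 m) x) (σ : ∀ x, V x) (hX : SmoothSec m (Euc m) X)
    (hY : SmoothSec m (Euc m) Y) (hσ : SmoothSec m (Euc n) σ) := wedgeSq_smooth hφ hX hY hσ
  have iFF := integrable_of_smooth (formInner_smooth hF hF hF' hF')
  have iFE := integrable_of_smooth (formInner_smooth hF hE hF' hE')
  have iEE := integrable_of_smooth (formInner_smooth hE hE hE' hE')
  have iFW := integrable_of_smooth (formInner_smooth hF hW hF' hW')
  have iEW := integrable_of_smooth (formInner_smooth hE hW hE' hW')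
  have iWW := integrable_of_smooth (formInner_smooth hW hW hW' hW')
  have iE2 : Integrable (fun x ↦ formInner n x (extCov D φ x) (extCov D φ x) +
      2 * formInner n x (curv D x) (wedgeSq φ x)) (riemVol m M) := iEE.add (iFW.const_mul 2)
  have h (t : ℝ) (x : M) : formInner n x (curv (vary D φ t) x) (curv (vary D φ t) x) =
      formInner n x (curv D x) (curv D x) + t * (2 * formInner n x (curv D x) (extCov D φ x)) +
      t ^ 2 * (formInner n x (extCov D φ x) (extCov D φ x) +
        2 * formInner n x (curv D x) (wedgeSq φ x)) +
      t ^ 3 * (2 * formInner n x (extCov D φ x) (wedgeSq φ x)) +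
      t ^ 4 * formInner n x (wedgeSq φ x) (wedgeSq φ x) := by
    rw [← formInner_add_smul_add_smul]
    have e : curv (vary D φ t) x = fun u v w ↦
        curv D x u v w + t • extCov D φ x u v w + t ^ 2 • wedgeSq φ x u v w := by
      ext u v w
      exact curv_vary hD hφ t x u v w
    rw [e]
  refine ⟨1 / 2 * ∫ x, (formInner n x (extCov D φ x) (extCov D φ x) +
        2 * formInner n x (curv D x) (wedgeSq φ x)) ∂riemVol m M,
      ∫ x, formInner n x (extCov D φ x) (wedgeSq φ x) ∂riemVol m M,
      1 / 2 * ∫ x, formInner n x (wedgeSq φ x) (wedgeSq φ x) ∂riemVol m M, fun t ↦ ?_⟩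
  rw [YM, YM, firstVariation]
  simp only [h]
  rw [integral_quartic iFF (iFE.const_mul 2) iE2 (iEW.const_mul 2) iWW]
  simp only [integral_const_mul]
  ring

/-- `d/dt YM(D + tφ) = ∫ ⟨F, Dφ⟩` at `t = 0`. -/
theorem hasDerivAt_YM_vary (hD : CovariantDerivative.ContMDiffCovariantDerivative D ∞)
    {φ : EndForm m V} (hφ : SmoothEndForm n φ) :
    HasDerivAt (fun t : ℝ ↦ YM (vary D φ t)) (firstVariation D φ) 0 := by
  obtain ⟨a, b, c, h⟩ := YM_vary hD hφ
  have e : (fun t : ℝ ↦ YM (vary D φ t)) = fun t : ℝ ↦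
      YM D + t * firstVariation D φ + t ^ 2 * a + t ^ 3 * b + t ^ 4 * c := funext h
  rw [e]
  have hp (k : ℕ) := hasDerivAt_pow k (0 : ℝ)
  have hd := (((((hasDerivAt_id (0 : ℝ)).mul_const (firstVariation D φ)).const_add (YM D)).add
    ((hp 2).mul_const a)).add ((hp 3).mul_const b)).add ((hp 4).mul_const c)
  exact hd.congr_deriv (by simp)

end Variation

/-! ### Group actions -/

section Tangent

open Filter Topology VectorField

variable {m : ℕ} {M : Type*} [TopologicalSpace M] [ChartedSpace (Euc m) M]
  [IsManifold (𝓡 m) ∞ M] {K : Type*} [Group K] [MulAction K M]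

theorem push_push_inv (hs : ∀ k : K, ContMDiff (𝓡 m) (𝓡 m) ∞ fun x : M ↦ k • x) (k : K) (x : M)
    (u : TangentSpace (𝓡 m) x) :
    mfderiv (𝓡 m) (𝓡 m) (fun y : M ↦ k⁻¹ • y) (k • x)
      (mfderiv (𝓡 m) (𝓡 m) (fun y : M ↦ k • y) x u) = u := by
  have h1 := (hs k).mdifferentiable (by simp) x
  have h2 := (hs k⁻¹).mdifferentiable (by simp) (k • x)
  have h := mfderiv_comp_apply x h2 h1 u
  have e : (fun y : M ↦ k⁻¹ • y) ∘ (fun y : M ↦ k • y) = id := by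
    ext y
    simp
  rw [e, mfderiv_id] at h
  exact h.symm

theorem mfderiv_action_isInvertible (hs : ∀ k : K, ContMDiff (𝓡 m) (𝓡 m) ∞ fun x : M ↦ k • x)
    (k : K) (x : M) : (mfderiv (𝓡 m) (𝓡 m) (fun y : M ↦ k • y) x).IsInvertible := by
  let A : Euc m →L[ℝ] Euc m := mfderiv (𝓡 m) (𝓡 m) (fun y : M ↦ k • y) x
  let B : Euc m →L[ℝ] Euc m := mfderiv (𝓡 m) (𝓡 m) (fun y : M ↦ k⁻¹ • y) (k • x)
  have hBA (u) : B (A u) = u := push_push_inv hs k x u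
  have hl : (B : Euc m →ₗ[ℝ] Euc m) ∘ₗ (A : Euc m →ₗ[ℝ] Euc m) = LinearMap.id :=
    LinearMap.ext hBA
  have hr := (LinearMap.comp_eq_id_comm ..).1 hl
  exact ⟨ContinuousLinearEquiv.equivOfInverse A B hBA fun u ↦ LinearMap.congr_fun hr u, rfl⟩

/-- The vector field related to `X` by the action of `k`. -/
theorem exists_related (hs : ∀ k : K, ContMDiff (𝓡 m) (𝓡 m) ∞ fun x : M ↦ k • x) (k : K)
    {X : ∀ x : M, TangentSpace (𝓡 m) x} (hX : SmoothSec m (Euc m) X) :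
    ∃ X' : ∀ x : M, TangentSpace (𝓡 m) x, SmoothSec m (Euc m) X' ∧
      ∀ x, X' (k • x) = mfderiv (𝓡 m) (𝓡 m) (fun y : M ↦ k • y) x (X x) := by
  have : IsManifold (𝓡 m) 1 M := IsManifold.of_le (n := ∞) (by simp)
  refine ⟨mpullback (𝓡 m) (𝓡 m) (fun y : M ↦ k⁻¹ • y) X,
    ContMDiff.mpullback_vectorField hX (hs k⁻¹) (mfderiv_action_isInvertible hs k⁻¹) (by simp),
    fun x ↦ ?_⟩
  have hinv := mfderiv_action_isInvertible hs k⁻¹ (k • x)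
  have h : ∀ y, y = x → (mfderiv (𝓡 m) (𝓡 m) (fun y : M ↦ k⁻¹ • y) (k • x)).inverse
      (show Euc m from X y) = mfderiv (𝓡 m) (𝓡 m) (fun y : M ↦ k • y) x (X x) := by
    intro y hy
    subst hy
    obtain ⟨e, he⟩ := hinv
    rw [← he, ContinuousLinearMap.inverse_equiv]
    refine (e.symm_apply_eq).2 ?_
    have h1 := push_push_inv hs k _ (X y)
    exact h1.symm.trans (congrArg (fun T : Euc m →L[ℝ] Euc m ↦ T _) he).symm
  exact h _ (inv_smul_smul k x)

/-- X and Y are the pullbacks of X' and Y' by a diffeomorphism, and brackets are natural under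
pullback. -/
theorem mlieBracket_related (hs : ∀ k : K, ContMDiff (𝓡 m) (𝓡 m) ∞ fun x : M ↦ k • x) (k : K)
    {X Y X' Y' : ∀ x : M, TangentSpace (𝓡 m) x} (hX' : SmoothSec m (Euc m) X')
    (hY' : SmoothSec m (Euc m) Y')
    (hX : ∀ x, X' (k • x) = mfderiv (𝓡 m) (𝓡 m) (fun y : M ↦ k • y) x (X x))
    (hY : ∀ x, Y' (k • x) = mfderiv (𝓡 m) (𝓡 m) (fun y : M ↦ k • y) x (Y x)) (x : M) :
    mlieBracket (𝓡 m) X' Y' (k • x) =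
      mfderiv (𝓡 m) (𝓡 m) (fun y : M ↦ k • y) x (mlieBracket (𝓡 m) X Y x) := by
  have : IsManifold (𝓡 m) (minSmoothness ℝ 3) M :=
    IsManifold.of_le (n := ∞) (by simpa using ENat.LEInfty.out)
  have hinv := mfderiv_action_isInvertible (m := m) hs k
  have e {Z Z' : ∀ x : M, TangentSpace (𝓡 m) x}
      (h : ∀ x, Z' (k • x) = mfderiv (𝓡 m) (𝓡 m) (fun y : M ↦ k • y) x (Z x)) :
      mpullback (𝓡 m) (𝓡 m) (fun y : M ↦ k • y) Z' = Z := by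
    ext1 y
    rw [mpullback_apply, h]
    obtain ⟨e, he⟩ := hinv y
    rw [← he, ContinuousLinearMap.inverse_equiv]
    exact e.symm_apply_apply _
  have h := mpullback_mlieBracket (I := 𝓡 m) (I' := 𝓡 m) (f := fun y : M ↦ k • y) (x₀ := x)
    (hX'.near (k • x)).mdiff (hY'.near (k • x)).mdiff (hs k x) (by simpa using ENat.LEInfty.out)
  rw [e hX, e hY] at h
  rw [← h, mpullback_apply]
  obtain ⟨e, he⟩ := hinv x
  rw [← he, ContinuousLinearMap.inverse_equiv]
  exact (e.apply_symm_apply _).symm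

end Tangent

/-! ### Equivariant connections -/

section Equivariance

open Filter Topology VectorField

variable {m n : ℕ} {M : Type*} [TopologicalSpace M] [ChartedSpace (Euc m) M]
  [IsManifold (𝓡 m) ∞ M]
  {V : M → Type*} [TopologicalSpace (TotalSpace (Euc n) V)]
  [∀ x, NormedAddCommGroup (V x)] [∀ x, InnerProductSpace ℝ (V x)]
  [FiberBundle (Euc n) V] [VectorBundle ℝ (Euc n) V]
  {EK : Type*} [NormedAddCommGroup EK] [NormedSpace ℝ EK] {HK : Type*} [TopologicalSpace HK]
  {IK : ModelWithCorners ℝ EK HK}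
  {K : Type*} [Group K] [TopologicalSpace K] [ChartedSpace HK K] [MulAction K M]
  (L : IsometricLift m n V K IK)

/-- Fibres over x and k • k⁻¹ • x are different types, so the comparison is made in the total space:
at points k • y first, then transported. -/
theorem tau_mk (k : K) (σ : ∀ x, V x) (x : M) :
    TotalSpace.mk' (Euc n) x (tau L k σ x) =
      TotalSpace.mk' (Euc n) (k • k⁻¹ • x) (L.lam k (k⁻¹ • x) (σ (k⁻¹ • x))) := by
  have h (y : M) : TotalSpace.mk' (Euc n) (k • y) (tau L k σ (k • y)) =
      TotalSpace.mk' (Euc n) (k • k⁻¹ • k • y) (L.lam k (k⁻¹ • k • y) (σ (k⁻¹ • k • y))) := by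
    rw [tau_smul]
    exact (congrArg (fun z ↦ TotalSpace.mk' (Euc n) (k • z) (L.lam k z (σ z)))
      (inv_smul_smul k y)).symm
  have := h (k⁻¹ • x)
  rwa [smul_inv_smul] at this

theorem tau_smooth (hs : ∀ k : K, ContMDiff (𝓡 m) (𝓡 m) ∞ fun x : M ↦ k • x) (k : K)
    {σ : ∀ x, V x} (hσ : SmoothSec m (Euc n) σ) : SmoothSec m (Euc n) (tau L k σ) := by
  have h1 : ContMDiff (𝓡 m) ((𝓡 m).prod 𝓘(ℝ, Euc n)) ∞
      fun x : M ↦ TotalSpace.mk' (Euc n) (k⁻¹ • x) (σ (k⁻¹ • x)) :=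
    ContMDiff.comp (g := fun x : M ↦ TotalSpace.mk' (Euc n) x (σ x)) hσ (hs k⁻¹)
  have h2 := L.smooth.comp ((contMDiff_const (I := 𝓡 m) (c := k)).prodMk h1)
  refine ContMDiff.congr h2 fun x ↦ ?_
  exact tau_mk L k σ x

/-- λ_k λ_{k⁻¹} is the identity, by the action laws of `IsometricLift` on the total space. -/
theorem tau_inv_apply (k : K) (σ : ∀ x, V x) (x : M) :
    L.lam k x (tau L k⁻¹ σ x) = σ (k • x) := by
  have h (y : M) : TotalSpace.mk' (Euc n) (k • k⁻¹ • y)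
      (L.lam k (k⁻¹ • y) (tau L k⁻¹ σ (k⁻¹ • y))) = TotalSpace.mk' (Euc n) y (σ y) := by
    rw [tau_smul, ← L.mul_act]
    exact (congrArg (fun l : K ↦ TotalSpace.mk' (Euc n) (l • y) (L.lam l y (σ y)))
      (mul_inv_cancel k)).trans (L.one_act y (σ y))
  have h1 := h (k • x)
  have h2 := congrArg (fun z ↦ TotalSpace.mk' (Euc n) (k • z) (L.lam k z (tau L k⁻¹ σ z)))
      (inv_smul_smul k x)
  have h3 := h2.symm.trans h1
  exact eq_of_heq (by simpa using h3)

/-- `λ_k` as an isometric isomorphism of fibres. -/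
def lamEquiv (k : K) (x : M) : V x ≃ₗᵢ[ℝ] V (k • x) :=
  haveI := VectorBundle.finiteDimensional ℝ (Euc n) V x
  haveI := VectorBundle.finiteDimensional ℝ (Euc n) V (k • x)
  (L.lam k x).toLinearIsometryEquiv
    (by rw [VectorBundle.finrank_eq ℝ (Euc n) V, VectorBundle.finrank_eq ℝ (Euc n) V])

/-- The pullback `λ_k⁻¹ φ_{k_* u}(kx) λ_k`. -/
def pullForm (k : K) (φ : EndForm m V) : EndForm m V := fun x ↦
  (((lamEquiv L k x).symm.toContinuousLinearEquiv.toContinuousLinearMap).postcomp (V x)) ∘L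
    (((lamEquiv L k x).toContinuousLinearEquiv.toContinuousLinearMap).precomp (V (k • x))) ∘L
      φ (k • x) ∘L push m k x

theorem lam_pullForm (k : K) (φ : EndForm m V) (x : M) (u : TangentSpace (𝓡 m) x) (w : V x) :
    L.lam k x (pullForm L k φ x u w) = φ (k • x) (push m k x u) (L.lam k x w) :=
  (lamEquiv L k x).apply_symm_apply _

variable [T2Space M] [ContMDiffVectorBundle ∞ (Euc n) V (𝓡 m)]

/-- On smooth X and σ the pullback is τ_{k⁻¹}(φ_{X'}(τ_k σ)) with X' related to X, and each
operation preserves smoothness. -/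
theorem pullForm_smooth (hs : ∀ k : K, ContMDiff (𝓡 m) (𝓡 m) ∞ fun x : M ↦ k • x) (k : K)
    {φ : EndForm m V} (hφ : SmoothEndForm n φ) : SmoothEndForm n (pullForm L k φ) := by
  refine smoothEndForm_iff.2 fun X σ hX hσ ↦ ?_
  obtain ⟨X', hX', h⟩ := exists_related hs k hX
  have h1 := tau_smooth L hs k⁻¹ (smoothEndForm_iff.1 hφ X' _ hX' (tau_smooth L hs k hσ))
  convert h1 using 2 with x
  refine (L.lam k x).injective ?_
  rw [lam_pullForm, tau_inv_apply, tau_smul, h]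
  rfl

variable {L} {D : CovariantDerivative (𝓡 m) (Euc n) V}

/-- Equivariance phrased for any σ' related to σ, so that it can be iterated: a covariant derivative
of related data is again related. -/
theorem cov_tau (hDK : IsEquivariantConnection L D) (k : K) {σ σ' : ∀ x, V x}
    (hσ : SmoothSec m (Euc n) σ) (hσ' : ∀ x, σ' (k • x) = L.lam k x (σ x))
    {X X' : ∀ x : M, TangentSpace (𝓡 m) x} (h : ∀ x, X' (k • x) = push m k x (X x)) (x : M) :
    D σ' (k • x) (X' (k • x)) = L.lam k x (D σ x (X x)) := by
  have e : σ' = tau L k σ := by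
    ext y
    have h1 (y) : σ' (k • y) = tau L k σ (k • y) := by rw [hσ', tau_smul]
    have := h1 (k⁻¹ • y)
    rwa [smul_inv_smul] at this
  rw [e, h]
  exact hDK k σ hσ x (X x)

/-- Extend the three vectors to global smooth fields, as the equivariance hypothesis demands. All
three terms of the curvature are then built from related data. -/
theorem curv_equivariant (hD : CovariantDerivative.ContMDiffCovariantDerivative D ∞)
    (hs : ∀ k : K, ContMDiff (𝓡 m) (𝓡 m) ∞ fun x : M ↦ k • x)
    (hDK : IsEquivariantConnection L D) (k : K) (x : M) (u v : TangentSpace (𝓡 m) x) (w : V x) :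
    curv D (k • x) (push m k x u) (push m k x v) (L.lam k x w) = L.lam k x (curv D x u v w) := by
  obtain ⟨X, hX, rfl⟩ := exists_global_section_eq (m := m) (F := Euc m) u
  obtain ⟨Y, hY, rfl⟩ := exists_global_section_eq (m := m) (F := Euc m) v
  obtain ⟨σ, hσ, rfl⟩ := exists_global_section_eq (m := m) (F := Euc n) w
  obtain ⟨X', hX', eX⟩ := exists_related hs k hX
  obtain ⟨Y', hY', eY⟩ := exists_related hs k hY
  have hσ' := tau_smooth L hs k hσ
  rw [← curvFields_eq_curv hD (hX.near x) (hY.near x) (hσ.near x), ← tau_smul L k σ x]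
  refine (congrArg₂ (fun u v ↦ curv D (k • x) u v _) (eX x) (eY x)).symm.trans ?_
  rw [← curvFields_eq_curv hD (hX'.near _) (hY'.near _) (hσ'.near _), curvFields, curvFields]
  rw [cov_tau hDK k (cov_smooth hD hσ hY) (cov_tau hDK k hσ (tau_smul L k σ) eY) eX,
    cov_tau hDK k (cov_smooth hD hσ hX) (cov_tau hDK k hσ (tau_smul L k σ) eX) eY,
    cov_tau hDK k hσ (tau_smul L k σ) (mlieBracket_related hs k hX' hY' eX eY), map_sub, map_sub]

theorem covEnd_tau (hDK : IsEquivariantConnection L D) (k : K) {φ : EndForm m V}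
    (hs : ∀ k : K, ContMDiff (𝓡 m) (𝓡 m) ∞ fun x : M ↦ k • x) (hφ : SmoothEndForm n φ)
    {σ : ∀ x, V x} (hσ : SmoothSec m (Euc n) σ)
    {X X' Y Y' : ∀ x : M, TangentSpace (𝓡 m) x} (hX : ∀ x, X' (k • x) = push m k x (X x))
    (hYs : SmoothSec m (Euc m) Y) (hY : ∀ x, Y' (k • x) = push m k x (Y x)) (x : M) :
    covEnd D φ X' Y' (tau L k σ) (k • x) = L.lam k x (covEnd D (pullForm L k φ) X Y σ x) := by
  have h1 := smoothEndForm_iff.1 (pullForm_smooth L hs k hφ) Y σ hYs hσ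
  rw [covEnd, covEnd, map_sub, lam_pullForm, ← hY, ← cov_tau hDK k hσ (tau_smul L k σ) hX,
    cov_tau hDK k h1 (fun y ↦ by rw [lam_pullForm, tau_smul, hY]) hX]

theorem extCov_equivariant (hD : CovariantDerivative.ContMDiffCovariantDerivative D ∞)
    (hs : ∀ k : K, ContMDiff (𝓡 m) (𝓡 m) ∞ fun x : M ↦ k • x)
    (hDK : IsEquivariantConnection L D) (k : K) {φ : EndForm m V} (hφ : SmoothEndForm n φ) (x : M)
    (u v : TangentSpace (𝓡 m) x) (w : V x) :
    extCov D φ (k • x) (push m k x u) (push m k x v) (L.lam k x w) =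
      L.lam k x (extCov D (pullForm L k φ) x u v w) := by
  obtain ⟨X, hX, rfl⟩ := exists_global_section_eq (m := m) (F := Euc m) u
  obtain ⟨Y, hY, rfl⟩ := exists_global_section_eq (m := m) (F := Euc m) v
  obtain ⟨σ, hσ, rfl⟩ := exists_global_section_eq (m := m) (F := Euc n) w
  obtain ⟨X', hX', eX⟩ := exists_related hs k hX
  obtain ⟨Y', hY', eY⟩ := exists_related hs k hY
  have hσ' := tau_smooth L hs k hσ
  rw [← extCovFields_eq_extCov hD (pullForm_smooth L hs k hφ) (hX.near x) (hY.near x) (hσ.near x),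
    ← tau_smul L k σ x]
  refine (congrArg₂ (fun u v ↦ extCov D φ (k • x) u v _) (eX x) (eY x)).symm.trans ?_
  rw [← extCovFields_eq_extCov hD hφ (hX'.near _) (hY'.near _) (hσ'.near _), extCovFields,
    extCovFields, covEnd_tau hDK k hs hφ hσ eX hY eY, covEnd_tau hDK k hs hφ hσ eY hX eX,
    map_sub, map_sub, lam_pullForm, tau_smul, mlieBracket_related hs k hX' hY' eX eY]
  rfl

end Equivariance

/-! ### Invariance of the codifferential -/

section Invariance

open Filter Topology

variable {m n : ℕ} {M : Type*} [TopologicalSpace M] [T2Space M] [CompactSpace M]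
  [ChartedSpace (Euc m) M] [IsManifold (𝓡 m) ∞ M] [MeasurableSpace M] [BorelSpace M]
  [RiemannianBundle (fun x : M ↦ TangentSpace (𝓡 m) x)]
  [IsContMDiffRiemannianBundle (𝓡 m) ∞ (Euc m) (fun x : M ↦ TangentSpace (𝓡 m) x)]
  {V : M → Type*} [TopologicalSpace (TotalSpace (Euc n) V)]
  [∀ x, NormedAddCommGroup (V x)] [∀ x, InnerProductSpace ℝ (V x)]
  [FiberBundle (Euc n) V] [VectorBundle ℝ (Euc n) V] [ContMDiffVectorBundle ∞ (Euc n) V (𝓡 m)]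
  [IsContMDiffRiemannianBundle (𝓡 m) ∞ (Euc n) V]
  {EK : Type*} [NormedAddCommGroup EK] [NormedSpace ℝ EK] {HK : Type*} [TopologicalSpace HK]
  {IK : ModelWithCorners ℝ EK HK}
  {K : Type*} [Group K] [TopologicalSpace K] [ChartedSpace HK K] [MulAction K M]
  {L : IsometricLift m n V K IK} {D : CovariantDerivative (𝓡 m) (Euc n) V}

/-- The differential of an isometry. -/
def pushIsometry (hK : ActsByIsometries m M K) (k : K) (x : M) :
    TangentSpace (𝓡 m) x →ₗᵢ[ℝ] TangentSpace (𝓡 m) (k • x) where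
  toLinearMap := (push m k x).toLinearMap
  norm_map' := hK k x

theorem integral_action (hs : ∀ k : K, ContMDiff (𝓡 m) (𝓡 m) ∞ fun x : M ↦ k • x)
    (hK : ActsByIsometries m M K) (k : K) (f : M → ℝ) :
    ∫ x, f (k • x) ∂riemVol m M = ∫ x, f x ∂riemVol m M := by
  have : ContinuousConstSMul K M := ⟨fun k ↦ (hs k).continuous⟩
  have h := riemVol_map (m := m) (Homeomorph.smul k : M ≃ₜ M) (hs k) (hK k)
  conv_rhs => rw [← h]
  exact (integral_map_equiv (Homeomorph.smul k : M ≃ₜ M).toMeasurableEquiv f).symm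

/-- The integrand of the pulled-back form at x is that of φ at kx, and the measure is invariant
under k. -/
theorem firstVariation_pullForm (hD : CovariantDerivative.ContMDiffCovariantDerivative D ∞)
    (hs : ∀ k : K, ContMDiff (𝓡 m) (𝓡 m) ∞ fun x : M ↦ k • x)
    (hK : ActsByIsometries m M K) (hDK : IsEquivariantConnection L D) (k : K) {φ : EndForm m V}
    (hφ : SmoothEndForm n φ) : firstVariation D (pullForm L k φ) = firstVariation D φ := by
  rw [firstVariation, firstVariation,
    ← integral_action hs hK k fun x ↦ formInner n x (curv D x) (extCov D φ x)]
  refine integral_congr_ae (Eventually.of_forall fun x ↦ ?_)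
  exact (formInner_map (n := n) (pushIsometry hK k x) (L.lam k x) (curv_trilinear hD _)
    (extCov_trilinear hD hφ _) (curv_equivariant hD hs hDK k x)
    (extCov_equivariant hD hs hDK k hφ x)).symm

theorem integral_oneInner_pullForm (hs : ∀ k : K, ContMDiff (𝓡 m) (𝓡 m) ∞ fun x : M ↦ k • x)
    (hK : ActsByIsometries m M K) (L : IsometricLift m n V K IK) (k : K) (φ ψ : EndForm m V) :
    ∫ x, oneInner n x (pullForm L k φ x) (pullForm L k ψ x) ∂riemVol m M =
      ∫ x, oneInner n x (φ x) (ψ x) ∂riemVol m M := by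
  rw [← integral_action hs hK k fun x ↦ oneInner n x (φ x) (ψ x)]
  refine integral_congr_ae (Eventually.of_forall fun x ↦ ?_)
  exact (oneInner_map (n := n) (pushIsometry hK k x) (L.lam k x)
    (fun u w ↦ (lam_pullForm L k φ x u w).symm) fun u w ↦ (lam_pullForm L k ψ x u w).symm).symm

/-- A continuous nonnegative function with zero integral vanishes, as nonempty open sets have
positive measure. -/
theorem eq_zero_of_integral_oneInner {φ : EndForm m V} (hφ : SmoothEndForm n φ)
    (h : ∫ x, oneInner n x (φ x) (φ x) ∂riemVol m M = 0) (x : M) : φ x = 0 := by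
  have : (riemVol m M).IsOpenPosMeasure := riemVol_isOpenPos
  have hs := oneInner_smooth hφ hφ
  have h1 := (integral_eq_zero_iff_of_nonneg (fun x ↦ oneInner_self_nonneg _)
    (integrable_of_smooth hs)).1 h
  have h2 := hs.continuous.ae_eq_iff_eq (riemVol m M) continuous_const |>.1 h1
  exact eq_zero_of_oneInner_self (congrFun h2 x)

/-- The form representing the first variation is invariant. -/
theorem pullForm_eq_self (hD : CovariantDerivative.ContMDiffCovariantDerivative D ∞)
    (hs : ∀ k : K, ContMDiff (𝓡 m) (𝓡 m) ∞ fun x : M ↦ k • x)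
    (hK : ActsByIsometries m M K) (hDK : IsEquivariantConnection L D) {J : EndForm m V}
    (hJs : SmoothEndForm n J) (hJ : ∀ φ : EndForm m V, SmoothEndForm n φ →
      firstVariation D φ = ∫ y, oneInner n y (J y) (φ y) ∂riemVol m M) (k : K) :
    pullForm L k J = J := by
  have hPs := pullForm_smooth L hs k hJs
  have hsub : SmoothEndForm n (pullForm L k J - J) := smoothEndForm_iff.2 fun X σ hX hσ ↦
    ContMDiff.sub_section (smoothEndForm_iff.1 hPs X σ hX hσ) (smoothEndForm_iff.1 hJs X σ hX hσ)
  have e (x : M) : oneInner n x ((pullForm L k J - J) x) ((pullForm L k J - J) x) =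
      oneInner n x (pullForm L k J x) (pullForm L k J x) -
        2 * oneInner n x (J x) (pullForm L k J x) + oneInner n x (J x) (J x) := by
    have h1 (A B : TangentSpace (𝓡 m) x →L[ℝ] V x →L[ℝ] V x) :
        oneInner n x (A - B) (A - B) = oneInner n x A A - 2 * oneInner n x B A +
          oneInner n x B B := by
      rw [oneInner_sub_left, oneInner_comm A (A - B), oneInner_comm B (A - B), oneInner_sub_left,
        oneInner_sub_left, oneInner_comm A B]
      ring
    exact h1 _ _
  have iPP := integrable_of_smooth (oneInner_smooth hPs hPs)
  have iJP : Integrable (fun x ↦ 2 * oneInner n x (J x) (pullForm L k J x)) (riemVol m M) :=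
    (integrable_of_smooth (oneInner_smooth hJs hPs)).const_mul 2
  have iJJ := integrable_of_smooth (oneInner_smooth hJs hJs)
  -- ‖k*J‖² = ‖J‖² because the measure and the fibre metrics are invariant. The cross term is the
  -- first variation at k*J, which equals the one at J, namely ‖J‖². So the total is 1 − 2 + 1 times
  -- ‖J‖².
  have h : ∫ x, oneInner n x ((pullForm L k J - J) x) ((pullForm L k J - J) x) ∂riemVol m M
      = 0 := by
    simp only [e]
    have iS : Integrable (fun x ↦ oneInner n x (pullForm L k J x) (pullForm L k J x) -
        2 * oneInner n x (J x) (pullForm L k J x)) (riemVol m M) := iPP.sub iJP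
    rw [integral_add iS iJJ, integral_sub iPP iJP, integral_const_mul,
      integral_oneInner_pullForm hs hK, ← hJ _ hPs, firstVariation_pullForm hD hs hK hDK k hJs,
      hJ _ hJs]
    ring
  ext1 x
  exact sub_eq_zero.1 (eq_zero_of_integral_oneInner hsub h x)

/-- Symmetric criticality. -/
theorem firstVariation_eq_zero {G : Subgroup (Euc n ≃ₗᵢ[ℝ] Euc n)} {P : GStructure m n V G}
    (hD : CovariantDerivative.ContMDiffCovariantDerivative D ∞) (hDG : IsGConnection P D)
    (hs : ∀ k : K, ContMDiff (𝓡 m) (𝓡 m) ∞ fun x : M ↦ k • x)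
    (hK : ActsByIsometries m M K) (hDK : IsEquivariantConnection L D)
    (hcrit : ∀ φ : EndForm m V, IsAdForm P φ → IsEquivariantForm L φ → firstVariation D φ = 0)
    {φ : EndForm m V} (hφ : SmoothEndForm n φ) : firstVariation D φ = 0 := by
  obtain ⟨J, hJad, hJ⟩ := exists_codifferential hD hDG
  have hinv := pullForm_eq_self hD hs hK hDK hJad.1 hJ
  have heq : IsEquivariantForm L J := fun k x u v ↦ by
    rw [← lam_pullForm, hinv]
  -- J is an equivariant element of Ω¹(ad P), so it may serve as its own test form.
  have h0 := hcrit J hJad heq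
  rw [hJ J hJad.1] at h0
  have hJ0 := eq_zero_of_integral_oneInner hJad.1 h0
  rw [hJ φ hφ]
  simp only [hJ0, oneInner_zero_left, integral_zero]

end Invariance
end YangMills

end

/-! ### Conclusion: the principle of symmetric criticality -/

theorem mainTheorem7 {m n : ℕ}
    {M : Type*} [TopologicalSpace M] [T2Space M] [CompactSpace M]
    [ChartedSpace (YangMills.Euc m) M] [IsManifold (𝓡 m) ∞ M]
    [MeasurableSpace M] [BorelSpace M]
    [RiemannianBundle (fun x : M ↦ TangentSpace (𝓡 m) x)]
    [IsContMDiffRiemannianBundle (𝓡 m) ∞ (YangMills.Euc m) (fun x : M ↦ TangentSpace (𝓡 m) x)]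
    {V : M → Type*} [TopologicalSpace (TotalSpace (YangMills.Euc n) V)]
    [∀ x, NormedAddCommGroup (V x)] [∀ x, InnerProductSpace ℝ (V x)]
    [FiberBundle (YangMills.Euc n) V] [VectorBundle ℝ (YangMills.Euc n) V]
    [ContMDiffVectorBundle ∞ (YangMills.Euc n) V (𝓡 m)]
    [IsContMDiffRiemannianBundle (𝓡 m) ∞ (YangMills.Euc n) V]
    (G : Subgroup (YangMills.Euc n ≃ₗᵢ[ℝ] YangMills.Euc n)) (hG : YangMills.IsCompactGroup G)
    (P : YangMills.GStructure m n V G)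
    {EK : Type*} [NormedAddCommGroup EK] [NormedSpace ℝ EK] [FiniteDimensional ℝ EK]
    {HK : Type*} [TopologicalSpace HK] (IK : ModelWithCorners ℝ EK HK)
    {K : Type*} [Group K] [TopologicalSpace K] [ChartedSpace HK K] [LieGroup IK ∞ K]
    [CompactSpace K] [MulAction K M] [ContMDiffSMul IK (𝓡 m) ∞ K M]
    (hK : YangMills.ActsByIsometries m M K) (L : YangMills.IsometricLift m n V K IK)
    (D : CovariantDerivative (𝓡 m) (YangMills.Euc n) V)
    (hDsmooth : CovariantDerivative.ContMDiffCovariantDerivative D ∞)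
    (hDG : YangMills.IsGConnection P D) (hDK : YangMills.IsEquivariantConnection L D)
    (hcrit : ∀ φ : YangMills.EndForm m V, YangMills.IsAdForm P φ →
      YangMills.IsEquivariantForm L φ → YangMills.firstVariation D φ = 0) :
    YangMills.IsYangMills P D := by
  intro φ hφ
  have hs (k : K) : ContMDiff (𝓡 m) (𝓡 m) ∞ fun x : M ↦ k • x :=
    ContMDiffSMul.contMDiff_const_smul (I := IK) k
  have h := YangMills.hasDerivAt_YM_vary hDsmooth hφ.1
  rwa [YangMills.firstVariation_eq_zero hDsmooth hDG hs hK hDK hcrit hφ.1] at h
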